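/- **Geometry.** Let $V=\{x\in\mathbb R^4: x_0>|\mathbf x|\}$ be the open forward light cone in Minkowski space, with $x^2=x_0^2-|\mathbf x|^2$. For a set $X$ let $X^c$ be the interior of $\{y\in V:(x-y)^2<0\ \text{for all }x\in X\}$. Double cones are the sets $(a+V)\cap(b-V)$ with $a\in V$, $b\in a+V$. Fix $\tau>0$ and the time shell $H_\tau=\{x: x_0=\sqrt{|\mathbf x|^2+\tau^2}\}$, identified with the open unit ball $\mathbf B\subset\mathbb R^3$ by $x\mapsto \mathbf x/x_0$. A hypercone (based on $H_\tau$) is the causal completion $(X^{c})^{c}$ of the set $X\subset H_\tau$ corresponding to a pointed open convex cone $K\subset\mathbf B$ with apex in $\mathbf B$ and elliptical base (truncated by $\mathbf B$). Hypercones $C_a,C_b$ are spacelike separated if $C_a\subset C_b^{\,c}$. A funnel is a decreasing sequence of hypercones $C_n$ with $\bigcup_n C_n^{\,c}=V$. **Observables.** Let $\mathcal O\mapsto\mathfrak A(\mathcal O)$ be a net of unital $C^*$-algebras of bounded operators on a Hilbert space $\mathcal H$, indexed by the double cones, increasing in $\mathcal O$ and local: $[\mathfrak A(\mathcal O_1),\mathfrak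 A(\mathcal O_2)]=0$ if $\mathcal O_1\subset\mathcal O_2^{\,c}$. Let $\mathfrak A(V)$ and $\mathfrak A(C)$ ($C$ a hypercone) be the $C^*$-algebras generated by the $\mathfrak A(\mathcal O)$ with $\mathcal O\subset V$, respectively $\mathcal O\subset C$, and $\mathfrak A(C^c)$ the one generated by the $\mathfrak A(C_1)$ with $C_1\subset C^c$ a hypercone; write $\mathfrak R(\cdot)$ for their weak closures. Assume that $\Omega\in\mathcal H$ is a unit vector cyclic for $\mathfrak A(V)$, with vector state $\omega_0$ (the vacuum); that $\mathfrak R(V)$ is a factor (for example of type III$_1$); and that hypercone duality holds: $\mathfrak A(C^c)'\cap\mathfrak R(V)=\mathfrak R(C)$ and $\mathfrak A(C)'\cap\mathfrak R(V)=\mathfrak R(C^c)$ for every hypercone $C$. **Morphisms.** A morphism localized in a hypercone $C$ is a $*$-homomorphism $\sigma_C:\mathfrak A(V)\to\mathfrak R(V)$, considered together with $C$, such that $\sigma_C$ is the identity on $\mathfrak A(C^c)$ and $\sigma_C(\mathfrak A(C_1))^-=\mathfrak R(C_1)$ (weak closure) for all hypercones $C_1\supseteq C$. For two morphisms, $(\sigma,\rho)$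 denotes the set of unitaries $W\in\mathfrak R(V)$ with $W\sigma(A)W^{-1}=\rho(A)$ for $A\in\mathfrak A(V)$, and $\sigma\simeq\rho$ means $(\sigma,\rho)\neq\emptyset$. An extension $\tilde\sigma$ of $\sigma$ based on a funnel $(C_n)$ is a morphism into $\mathfrak R(V)$ of the $C^*$-algebra generated by $\bigcup_n\mathfrak R(C_n^{\,c})$ that extends $\sigma$ and is normal on each $\mathfrak R(C_n^{\,c})$. For localized morphisms $\sigma$ and $\rho_C$ the composition is $\sigma\bullet\rho_{C}=\tilde\sigma\circ\rho_{C}$, where $\tilde\sigma$ is an extension of $\sigma$ based on a funnel with $C_m\subset C^c$ for some $m$. For $\sigma_a\simeq\sigma_b$ localized in spacelike separated hypercones $C_a,C_b$ the exchange intertwiner is $$\varepsilon(\sigma_a,\sigma_b)=W^{-1}\tilde\sigma_a(W),\qquad W\in(\sigma_b,\sigma_a),$$ where $\tilde\sigma_a$ is an extension of $\sigma_a$ based on a funnel inside some hypercone $C_0\subset C_a^{\,c}\cap C_b^{\,c}$. **Charge classes.** The charge class of a state $\omega$ on $\mathfrak A(V)$ is the norm closure of $\{\omega\circ\mathrm{Ad}\,u: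 u\in\mathfrak A(V)\text{ unitary}\}$. A simple charge class $\mathscr C$ is the charge class of a primary state (one whose GNS representation generates a factor) together with its morphisms: a full $\simeq$-equivalence class of localized morphisms $\sigma$, containing a morphism localized in each hypercone, with $\omega_0\circ\sigma\in\mathscr C$. A simple charge class $\bar{\mathscr C}$ is conjugate to $\mathscr C$ if for every morphism $\sigma_C$ of $\mathscr C$ there is a morphism $\bar\sigma_C$ of $\bar{\mathscr C}$, localized in the same hypercone, with $\bar\sigma_C\bullet\sigma_C=\sigma_C\bullet\bar\sigma_C=\iota$, the identity. **Proposition.** Every simple charge class has a conjugate simple charge class. To every simple charge class $\mathscr C$ one can assign a statistics parameter $\varepsilon_{\mathscr C}\in\{\pm1\}$, depending only on the class, such that: (a) for any two morphisms $\sigma_a,\sigma_b$ of $\mathscr C$ localized in spacelike separated hypercones $C_a,C_b$, the exchange intertwiner exists, is independent of all choices in its definition (of $C_0$, the funnel, the extension and $W$), and $\varepsilon(\sigma_a,\sigma_b)=\varepsilon_{\mathscr C}\,1$; (b) if $\bar{\mathscr C}$ is conjugate to $\mathscr C$, then $\varepsilon_{\bar{\mathscr C}}=\varepsilon_{\mathscr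 C}$. -/

import Mathlib

open scoped InnerProductSpace ComplexOrder

universe u

noncomputable section

namespace LightCone

/-! ### Geometry of the forward light cone -/

/-- Euclidean three-space. -/
abbrev Space : Type := EuclideanSpace ℝ (Fin 3)

/-- Minkowski space, a point being a pair (time, position). -/
abbrev Minkowski : Type := ℝ × Space

/-- The Lorentz square `x₀² - |𝐱|²`. -/
def lorentzSq (x : Minkowski) : ℝ := x.1 ^ 2 - ‖x.2‖ ^ 2

/-- The open forward light cone `V`. -/
def cone : Set Minkowski := {x | ‖x.2‖ < x.1}

/-- The spacelike complement in `V` of a set `X`: the interior of the set of points of `V` that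
are spacelike to every point of `X`. -/
def spacelikeCompl (X : Set Minkowski) : Set Minkowski :=
  interior {y | y ∈ cone ∧ ∀ x ∈ X, lorentzSq (x - y) < 0}

/-- A (nonempty) double cone that is relatively compact in `V`, given by its two tips. -/
structure DoubleCone where
  /-- the past tip -/
  past : Minkowski
  /-- the future tip -/
  future : Minkowski
  past_mem : past ∈ cone
  future_mem : future - past ∈ cone

/-- The points of a double cone. -/
def DoubleCone.region (O : DoubleCone) : Set Minkowski :=
  {x | x - O.past ∈ cone ∧ O.future - x ∈ cone}

/-- The hyperboloid (time shell) `H_τ`. -/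
def hyperboloid (τ : ℝ) : Set Minkowski := {x | x.1 = √(‖x.2‖ ^ 2 + τ ^ 2)}

/-- The projection of the time shell onto the open unit ball (Beltrami-Klein model). -/
def klein (x : Minkowski) : Space := x.1⁻¹ • x.2

/-- The open circular cone `{w | w₂ > √(w₀² + w₁²)}` of Euclidean three-space. -/
def circularCone : Set Space := {w | √(w 0 ^ 2 + w 1 ^ 2) < w 2}

/-- The pointed open convex cones with elliptical base in the unit ball: cones whose apex `a` lies
in the open unit ball and whose set of directions is a linear image of the circular cone,
truncated by the ball. -/
def IsEllipticCone (K : Set Space) : Prop :=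
  ∃ (a : Space) (L : Space ≃ₗ[ℝ] Space), ‖a‖ < 1 ∧
    K = {v | ‖v‖ < 1 ∧ v - a ∈ L '' circularCone}

/-- The hyperbolic cone on `H_τ` whose image in the Beltrami-Klein model is `K`. -/
def hyperbolicCone (τ : ℝ) (K : Set Space) : Set Minkowski :=
  {x | x ∈ hyperboloid τ ∧ klein x ∈ K}

/-- A hypercone based on `H_τ`: the causal completion `(X^c)^c` of a hyperbolic cone `X`. -/
structure Hypercone (τ : ℝ) where
  /-- the points of the hypercone -/
  region : Set Minkowski
  exists_base : ∃ K : Set Space, IsEllipticCone K ∧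
    region = spacelikeCompl (spacelikeCompl (hyperbolicCone τ K))

namespace Hypercone

variable {τ : ℝ}

/-- The spacelike complement of a hypercone. -/
def compl (C : Hypercone τ) : Set Minkowski := spacelikeCompl C.region

/-- Two hypercones are spacelike separated. -/
def SpacelikeSep (C₁ C₂ : Hypercone τ) : Prop := C₁.region ⊆ C₂.compl

end Hypercone

/-- A funnel: a decreasing sequence of hypercones whose spacelike complements exhaust `V`. -/
def IsFunnel {τ : ℝ} (c : ℕ → Hypercone τ) : Prop :=
  (∀ n, (c (n + 1)).region ⊆ (c n).region) ∧ ⋃ n, (c n).compl = cone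

/-! ### Operator algebras -/

section Operators

variable {H : Type u} [NormedAddCommGroup H] [InnerProductSpace ℂ H] [CompleteSpace H]

/-- The weak closure of a unital star subalgebra of `B(H)`, i.e. its double commutant. -/
def weakClosure (S : StarSubalgebra ℂ (H →L[ℂ] H)) : VonNeumannAlgebra H where
  toStarSubalgebra := StarSubalgebra.centralizer ℂ
    (StarSubalgebra.centralizer ℂ (S : Set (H →L[ℂ] H)) : Set (H →L[ℂ] H))
  centralizer_centralizer' := by simp

/-- A von Neumann algebra is a factor if its centre consists of the multiples of the identity. -/
def IsFactor (M : VonNeumannAlgebra H) : Prop :=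
  ∀ z ∈ M, z ∈ M.commutant → ∃ c : ℂ, z = c • (1 : H →L[ℂ] H)

/-- The closed unital star subalgebra of `B(H)` generated by a set of operators. -/
def cstarGen (s : Set (H →L[ℂ] H)) : StarSubalgebra ℂ (H →L[ℂ] H) :=
  (StarAlgebra.adjoin ℂ s).topologicalClosure

/-- The closed algebra generated by the algebras `alg O` with `O` contained in `X`. -/
def regionAlg (alg : DoubleCone → StarSubalgebra ℂ (H →L[ℂ] H)) (X : Set Minkowski) :
    StarSubalgebra ℂ (H →L[ℂ] H) :=
  cstarGen (⋃ (O : DoubleCone) (_ : O.region ⊆ X), (alg O : Set (H →L[ℂ] H)))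

/-- The algebra of the spacelike complement of the hypercone `C`: the closed algebra generated by
the algebras of the hypercones `C₁` contained in the spacelike complement. -/
def complAlg (τ : ℝ) (alg : DoubleCone → StarSubalgebra ℂ (H →L[ℂ] H)) (C : Hypercone τ) :
    StarSubalgebra ℂ (H →L[ℂ] H) :=
  cstarGen (⋃ (C₁ : Hypercone τ) (_ : C₁.region ⊆ C.compl),
    (regionAlg alg C₁.region : Set (H →L[ℂ] H)))

end Operators

/-- A local net of observable algebras on the forward light cone in its vacuum representation:
unital C*-algebras `alg O` on a Hilbert space `H`, with isotony, locality, a cyclic unit vector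
`Ω` inducing the vacuum state, factoriality of the weak closure of the global algebra,
and duality for the hypercones based on `H_τ`. -/
structure ObservableNet (τ : ℝ) (H : Type u) [NormedAddCommGroup H] [InnerProductSpace ℂ H]
    [CompleteSpace H] where
  /-- the local algebras -/
  alg : DoubleCone → StarSubalgebra ℂ (H →L[ℂ] H)
  isClosed_alg : ∀ O, IsClosed (alg O : Set (H →L[ℂ] H))
  isotony : ∀ O₁ O₂ : DoubleCone, O₁.region ⊆ O₂.region → alg O₁ ≤ alg O₂
  locality : ∀ O₁ O₂ : DoubleCone, O₁.region ⊆ spacelikeCompl O₂.region →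
    ∀ A ∈ alg O₁, ∀ B ∈ alg O₂, A * B = B * A
  /-- the vacuum vector -/
  Ω : H
  norm_Ω : ‖Ω‖ = 1
  cyclic_Ω : Dense {x : H | ∃ A ∈ regionAlg alg cone, A Ω = x}
  factor : IsFactor (weakClosure (regionAlg alg cone))
  duality : ∀ (C : Hypercone τ) (X : H →L[ℂ] H),
    (X ∈ weakClosure (regionAlg alg cone) ∧ ∀ B ∈ complAlg τ alg C, B * X = X * B) ↔
      X ∈ weakClosure (regionAlg alg C.region)
  duality_compl : ∀ (C : Hypercone τ) (X : H →L[ℂ] H),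
    (X ∈ weakClosure (regionAlg alg cone) ∧ ∀ B ∈ regionAlg alg C.region, B * X = X * B) ↔
      X ∈ weakClosure (complAlg τ alg C)

namespace ObservableNet

variable {τ : ℝ} {H : Type u} [NormedAddCommGroup H] [InnerProductSpace ℂ H] [CompleteSpace H]
  (T : ObservableNet τ H)

/-- The global algebra `𝔄(V)`. -/
abbrev algV : StarSubalgebra ℂ (H →L[ℂ] H) := regionAlg T.alg cone

/-- The hypercone algebra `𝔄(C)`. -/
abbrev algC (C : Hypercone τ) : StarSubalgebra ℂ (H →L[ℂ] H) := regionAlg T.alg C.region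

/-- The algebra `𝔄(C^c)` of the spacelike complement of a hypercone. -/
abbrev algCc (C : Hypercone τ) : StarSubalgebra ℂ (H →L[ℂ] H) := complAlg τ T.alg C

/-- The weak closure `ℜ(V)` of `𝔄(V)`. -/
abbrev vnV : VonNeumannAlgebra H := weakClosure T.algV

/-- The weak closure `ℜ(C)` of `𝔄(C)`. -/
abbrev vnC (C : Hypercone τ) : VonNeumannAlgebra H := weakClosure (T.algC C)

/-- The weak closure `ℜ(C^c)` of `𝔄(C^c)`. -/
abbrev vnCc (C : Hypercone τ) : VonNeumannAlgebra H := weakClosure (T.algCc C)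

/-! ### States and charge classes -/

/-- States of `𝔄(V)`: normalized positive linear functionals. -/
def IsState (ω : T.algV →ₗ[ℂ] ℂ) : Prop :=
  ω 1 = 1 ∧ ∀ A : T.algV, 0 ≤ ω (star A * A)

/-- A functional is primary if the weak closure of its GNS representation (the cyclic
representation `(K, π, ξ)` inducing it, unique up to unitary equivalence) is a factor. -/
def IsPrimary (ω : T.algV →ₗ[ℂ] ℂ) : Prop :=
  ∃ (K : Type u) (_ : NormedAddCommGroup K) (_ : InnerProductSpace ℂ K) (_ : CompleteSpace K)
    (π : T.algV →⋆ₐ[ℂ] (K →L[ℂ] K)) (ξ : K),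
    Dense {x : K | ∃ A : T.algV, π A ξ = x} ∧
    (∀ A : T.algV, ω A = ⟪ξ, π A ξ⟫_ℂ) ∧
    IsFactor (weakClosure π.range)

/-- The charge class of `ω`: the norm closure of the set of functionals `ω ∘ Ad u`, with `u` a
unitary of `𝔄(V)`. -/
def chargeClass (ω : T.algV →ₗ[ℂ] ℂ) : Set (T.algV →ₗ[ℂ] ℂ) :=
  {φ | ∀ δ : ℝ, 0 < δ → ∃ u : T.algV, u ∈ unitary T.algV ∧
    ∀ A : T.algV, ‖φ A - ω (u * A * star u)‖ ≤ δ * ‖A‖}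

/-! ### Localized morphisms, extensions, composition and exchange -/

/-- A morphism `σ : 𝔄(V) → ℜ(V)` together with a hypercone `C` in which it is localized:
`σ` is the identity on `𝔄(C^c)`, and `σ(𝔄(C₁))` has weak closure `ℜ(C₁)` for all `C₁ ⊇ C`. -/
structure LocMorphism where
  /-- the hypercone of localization -/
  loc : Hypercone τ
  /-- the morphism -/
  hom : T.algV →⋆ₐ[ℂ] (H →L[ℂ] H)
  hom_mem : ∀ A : T.algV, hom A ∈ T.vnV
  hom_eq : ∀ A : T.algV, (A : H →L[ℂ] H) ∈ T.algCc loc → hom A = A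
  weakClosure_image : ∀ C₁ : Hypercone τ, loc.region ⊆ C₁.region →
    weakClosure (((T.algC C₁).comap T.algV.subtype).map hom) = T.vnC C₁

variable {T}

/-- `W` is a unitary of `ℜ(V)` with `W σ(A) W⁻¹ = τ(A)` for all `A` in `𝔄(V)`. -/
def IsIntertwiner (σ ρ : T.LocMorphism) (W : H →L[ℂ] H) : Prop :=
  W ∈ T.vnV ∧ W ∈ unitary (H →L[ℂ] H) ∧ ∀ A : T.algV, W * σ.hom A * star W = ρ.hom A

/-- Equivalence of morphisms by a unitary intertwiner in `ℜ(V)`. -/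
def Equivalent (σ ρ : T.LocMorphism) : Prop := ∃ W, IsIntertwiner σ ρ W

/-- The functional `ω₀ ∘ σ`, where `ω₀` is the vacuum state. -/
def LocMorphism.vacuumComp (σ : T.LocMorphism) : T.algV →ₗ[ℂ] ℂ where
  toFun A := ⟪T.Ω, σ.hom A T.Ω⟫_ℂ
  map_add' A B := by simp
  map_smul' c A := by simp

variable (T) in
/-- The C*-inductive limit of the algebras `ℜ(c_n^c)` of a funnel `c`. -/
def funnelAlg (c : ℕ → Hypercone τ) : StarSubalgebra ℂ (H →L[ℂ] H) :=
  cstarGen (⋃ n, (T.vnCc (c n) : Set (H →L[ℂ] H)))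

/-- An extension of `σ` to a morphism of the funnel algebra into `ℜ(V)` that is normal on each
`ℜ(c_n^c)`; normality is spelled out by saying that every matrix element of the extension is an
ultraweakly continuous functional `A ↦ ∑ ⟪u_k, A v_k⟫` with `(u_k)`, `(v_k)` square summable. -/
structure Extension (σ : T.LocMorphism) (c : ℕ → Hypercone τ) where
  /-- the extended morphism -/
  hom : T.funnelAlg c →⋆ₐ[ℂ] (H →L[ℂ] H)
  hom_mem : ∀ A, hom A ∈ T.vnV
  hom_eq : ∀ (A : T.algV) (hA : (A : H →L[ℂ] H) ∈ T.funnelAlg c), hom ⟨A, hA⟩ = σ.hom A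
  normal : ∀ (n : ℕ) (x y : H), ∃ u v : ℕ → H,
    Summable (fun k => ‖u k‖ ^ 2) ∧ Summable (fun k => ‖v k‖ ^ 2) ∧
    ∀ A : T.funnelAlg c, (A : H →L[ℂ] H) ∈ T.vnCc (c n) →
      HasSum (fun k => ⟪u k, (A : H →L[ℂ] H) (v k)⟫_ℂ) ⟪x, hom A y⟫_ℂ

/-- `κ` is the composition `σ • ρ`: it is `A ↦ σ̃(ρ(A))` for an extension `σ̃` of `σ`, based on a
funnel that enters the spacelike complement of the localization hypercone `C` of `ρ` (so that
`ℜ(C)` is in the domain of `σ̃`). -/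
def IsComposition (σ ρ : T.LocMorphism) (κ : T.algV → (H →L[ℂ] H)) : Prop :=
  ∃ (c : ℕ → Hypercone τ) (s : Extension σ c), IsFunnel c ∧
    (∃ m, (c m).region ⊆ ρ.loc.compl) ∧
    ∀ A : T.algV, ∃ h : ρ.hom A ∈ T.funnelAlg c, κ A = s.hom ⟨ρ.hom A, h⟩

/-- `E` is the exchange intertwiner `ε(σ, ρ) = W⁻¹ σ̃(W)`, formed with a unitary intertwiner
`W` from `ρ` to `σ` and an extension `σ̃` of `σ` based on a funnel inside some hypercone `C₀` in
the common spacelike complement of the localization hypercones. -/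
def IsExchange (σ ρ : T.LocMorphism) (E : H →L[ℂ] H) : Prop :=
  ∃ (C₀ : Hypercone τ) (c : ℕ → Hypercone τ) (s : Extension σ c) (W : H →L[ℂ] H)
    (hW : W ∈ T.funnelAlg c),
    C₀.region ⊆ σ.loc.compl ∧ C₀.region ⊆ ρ.loc.compl ∧
    IsFunnel c ∧ (∀ n, (c n).region ⊆ C₀.region) ∧
    IsIntertwiner ρ σ W ∧ E = star W * s.hom ⟨W, hW⟩

variable (T) in
/-- A simple charge class: a charge class of primary states, together with the corresponding
morphisms, which form one full equivalence class of localized morphisms, have representatives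
localized in every hypercone, and induce states of the class from the vacuum. -/
structure SimpleChargeClass where
  /-- the states of the class -/
  states : Set (T.algV →ₗ[ℂ] ℂ)
  isChargeClass : ∃ ω, T.IsState ω ∧ T.IsPrimary ω ∧ states = T.chargeClass ω
  /-- the morphisms of the class -/
  morphisms : Set T.LocMorphism
  exists_loc : ∀ C : Hypercone τ, ∃ σ ∈ morphisms, σ.loc = C
  vacuumComp_mem : ∀ σ ∈ morphisms, σ.vacuumComp ∈ states
  equivalent : ∀ σ ∈ morphisms, ∀ ρ ∈ morphisms, Equivalent σ ρ
  mem_of_equivalent : ∀ σ ∈ morphisms, ∀ ρ, Equivalent σ ρ → ρ ∈ morphisms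

/-- `D` is conjugate to `C`: each morphism `σ` of `C` has an inverse `σ'` for the composition
among the morphisms of `D` that are localized in the same hypercone. -/
def IsConjugate (C D : T.SimpleChargeClass) : Prop :=
  ∀ σ ∈ C.morphisms, ∃ σ' ∈ D.morphisms, σ'.loc = σ.loc ∧
    IsComposition σ' σ (fun A => (A : H →L[ℂ] H)) ∧
    IsComposition σ σ' (fun A => (A : H →L[ℂ] H))

end ObservableNet

end LightCone

end

namespace LightCone

open Set Filter Topology

/-! ### The causal structure in the Klein model -/

/-! Geometry. Projection of the time shell to the unit ball turns the causal structure into convex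
geometry: a hypercone is determined by its elliptic base cone, inclusion and spacelike separation
become inclusion and disjointness of bases (`region_subset_iff`, `sep_iff`), and a funnel shrinks to
a point of the unit sphere. What matters about a hypercone is mostly which small caps of the ball it
contains or avoids.

Statistics. By duality, an intertwiner between morphisms localized in a hypercone `e` lies in
`ℜ(e)`. If `V` carries `σ` to a morphism localized far away, then `σ` acts as `A ↦ V⁻¹ A V` on
everything spacelike to that place, and normality forces every extension to do the same
(`Extension.hom_eq_conj`). The exchange intertwiner is therefore a group commutator `W⁻¹ V⁻¹ W V`,
attached to three hypercones `a`, `b`, `c`. Since `σ_a` and `σ_b` commute as maps, the commutator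
commutes with all observables, and factoriality makes it a scalar (`exists_exchange_eq_smul_one`).
The scalar is unchanged when one of the three hypercones moves inside a hypercone spacelike to the
other two; configurations of three distinct points of the sphere are connected by such moves
(`triple_induction`), so only the class matters. Interchanging `a` and `b` replaces the commutator
by its adjoint, hence the scalar is real of modulus one (`exists_exchangeValue`).

Conjugates. The inverse of the local formula, `A ↦ V A V⁻¹`, defines the conjugate morphism
(`exists_isConjugateMorphism`). It does not depend on where the charge is carried, because the part
of the sphere outside a convex cone is connected (`exists_rel_of_sep`). That equivalent morphisms
induce states in one norm-closed charge class is a Kaplansky-type approximation by unitaries of the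
C*-algebra (`exists_unitary_approx`). Any conjugate class contains these morphisms
(`IsConjugate.mem_morphisms`), and with intertwiners to a common reference morphism the two exchange
operators take the forms `g k` and `k g`, so their scalar values agree. -/

/-- The point of the time shell over a point of the unit ball. -/
noncomputable def lift (τ : ℝ) (v : Space) : Minkowski :=
  (τ / √(1 - ‖v‖ ^ 2), (τ / √(1 - ‖v‖ ^ 2)) • v)

/-- A function that extends continuously to the closed ball and is positive at `v` exactly if
`y` is spacelike to `lift τ v`. -/
noncomputable def gap (τ : ℝ) (y : Minkowski) (v : Space) : ℝ :=
  2 * τ * (y.1 - ⟪y.2, v⟫_ℝ) - (τ ^ 2 + lorentzSq y) * √(1 - ‖v‖ ^ 2)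

variable {τ : ℝ}

theorem continuous_lorentzSq : Continuous lorentzSq := by
  unfold lorentzSq; fun_prop

theorem lorentzSq_sub_comm (x y : Minkowski) : lorentzSq (x - y) = lorentzSq (y - x) := by
  simp only [lorentzSq, Prod.fst_sub, Prod.snd_sub]
  rw [norm_sub_rev]; ring

theorem isOpen_cone : IsOpen cone :=
  isOpen_lt (by fun_prop) (by fun_prop)

theorem continuous_gap : Continuous fun p : Minkowski × Space => gap τ p.1 p.2 := by
  have := continuous_lorentzSq
  unfold gap; fun_prop

theorem one_sub_sq_pos {v : Space} (hv : ‖v‖ < 1) : 0 < 1 - ‖v‖ ^ 2 := by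
  nlinarith [norm_nonneg v]

theorem sqrt_mul_lorentzSq {v : Space} (hv : ‖v‖ < 1) (y : Minkowski) :
    √(1 - ‖v‖ ^ 2) * lorentzSq (lift τ v - y) = - gap τ y v := by
  have h0 := one_sub_sq_pos hv
  have hs : 0 < √(1 - ‖v‖ ^ 2) := Real.sqrt_pos.2 h0
  have hsq : √(1 - ‖v‖ ^ 2) ^ 2 = 1 - ‖v‖ ^ 2 := Real.sq_sqrt h0.le
  have hn : ‖(τ / √(1 - ‖v‖ ^ 2)) • v - y.2‖ ^ 2 =
      (τ / √(1 - ‖v‖ ^ 2)) ^ 2 * ‖v‖ ^ 2 - 2 * (τ / √(1 - ‖v‖ ^ 2)) * ⟪y.2, v⟫_ℝ + ‖y.2‖ ^ 2 := by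
    rw [norm_sub_sq_real, norm_smul, real_inner_smul_left, real_inner_comm, mul_pow]
    simp only [Real.norm_eq_abs, sq_abs]; ring
  simp only [lorentzSq, lift, gap, Prod.fst_sub, Prod.snd_sub, hn]
  generalize √(1 - ‖v‖ ^ 2) = s at *
  have : ‖v‖ ^ 2 = 1 - s ^ 2 := by linarith
  rw [this]
  field_simp
  ring

theorem lorentzSq_neg_iff {v : Space} (hv : ‖v‖ < 1) (y : Minkowski) :
    lorentzSq (lift τ v - y) < 0 ↔ 0 < gap τ y v := by
  have hs : 0 < √(1 - ‖v‖ ^ 2) := Real.sqrt_pos.2 (one_sub_sq_pos hv)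
  have := sqrt_mul_lorentzSq (τ := τ) hv y
  constructor
  · intro h
    have := mul_neg_of_pos_of_neg hs h
    linarith
  · intro h
    by_contra h'
    have := mul_nonneg hs.le (not_lt.1 h')
    linarith

theorem lorentzSq_lift {v : Space} (hv : ‖v‖ < 1) : lorentzSq (lift τ v) = τ ^ 2 := by
  have h0 := one_sub_sq_pos hv
  have hs : 0 < √(1 - ‖v‖ ^ 2) := Real.sqrt_pos.2 h0
  have hsq : √(1 - ‖v‖ ^ 2) ^ 2 = 1 - ‖v‖ ^ 2 := Real.sq_sqrt h0.le
  simp only [lorentzSq, lift, norm_smul, mul_pow, Real.norm_eq_abs, sq_abs]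
  generalize √(1 - ‖v‖ ^ 2) = s at *
  have : ‖v‖ ^ 2 = 1 - s ^ 2 := by linarith
  rw [this]
  field_simp
  ring

theorem lift_mem_cone (hτ : 0 < τ) {v : Space} (hv : ‖v‖ < 1) : lift τ v ∈ cone := by
  have hs : 0 < √(1 - ‖v‖ ^ 2) := Real.sqrt_pos.2 (one_sub_sq_pos hv)
  have : 0 < τ / √(1 - ‖v‖ ^ 2) := by positivity
  simp only [cone, lift, mem_ofPred_eq, norm_smul, Real.norm_eq_abs, abs_of_pos this]
  nlinarith

theorem continuousOn_lift : ContinuousOn (lift τ) {v | ‖v‖ < 1} := by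
  have : ∀ v ∈ {v : Space | ‖v‖ < 1}, √(1 - ‖v‖ ^ 2) ≠ 0 := fun v hv =>
    (Real.sqrt_pos.2 (one_sub_sq_pos hv)).ne'
  unfold lift
  fun_prop (disch := assumption)

theorem lift_mem_hyperboloid (hτ : 0 < τ) {v : Space} (hv : ‖v‖ < 1) :
    lift τ v ∈ hyperboloid τ := by
  have h1 := lorentzSq_lift (τ := τ) hv
  have h2 : ‖(lift τ v).2‖ < (lift τ v).1 := lift_mem_cone hτ hv
  simp only [lorentzSq] at h1
  rw [hyperboloid, mem_ofPred_eq, eq_comm, Real.sqrt_eq_iff_mul_self_eq (by positivity)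
    ((norm_nonneg _).trans h2.le)]
  linarith

theorem klein_lift (hτ : 0 < τ) {v : Space} (hv : ‖v‖ < 1) : klein (lift τ v) = v := by
  have hs : 0 < √(1 - ‖v‖ ^ 2) := Real.sqrt_pos.2 (one_sub_sq_pos hv)
  simp only [klein, lift, smul_smul]
  rw [inv_mul_cancel₀ (by positivity), one_smul]

theorem norm_klein_lt {x : Minkowski} (hx : x ∈ cone) : ‖klein x‖ < 1 := by
  have h : ‖x.2‖ < x.1 := hx
  have h0 : 0 < x.1 := (norm_nonneg _).trans_lt h
  rw [klein, norm_smul, norm_inv, Real.norm_eq_abs, abs_of_pos h0, inv_mul_lt_one₀ h0]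
  exact h

theorem lift_klein (hτ : 0 < τ) {x : Minkowski} (hx : x ∈ cone) (hx' : lorentzSq x = τ ^ 2) :
    lift τ (klein x) = x := by
  have h : ‖x.2‖ < x.1 := hx
  have h0 : 0 < x.1 := (norm_nonneg _).trans_lt h
  have h1 : 1 - ‖klein x‖ ^ 2 = (τ / x.1) ^ 2 := by
    rw [klein, norm_smul, norm_inv, Real.norm_eq_abs, abs_of_pos h0, div_pow, ← hx', lorentzSq]
    field_simp
  have h2 : √(1 - ‖klein x‖ ^ 2) = τ / x.1 := by
    rw [h1, Real.sqrt_sq (by positivity)]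
  have h3 : τ / (τ / x.1) = x.1 := by field_simp
  rw [lift, h2, h3, klein, smul_smul, mul_inv_cancel₀ h0.ne', one_smul]

theorem mem_cone_of_mem_hyperboloid (hτ : 0 < τ) {x : Minkowski} (hx : x ∈ hyperboloid τ) :
    x ∈ cone ∧ lorentzSq x = τ ^ 2 := by
  have h : x.1 = √(‖x.2‖ ^ 2 + τ ^ 2) := hx
  constructor
  · show ‖x.2‖ < x.1
    rw [h]
    apply Real.lt_sqrt_of_sq_lt
    nlinarith
  · rw [lorentzSq, h, Real.sq_sqrt (by positivity)]; ring

theorem forall_hyperbolicCone_iff (hτ : 0 < τ) {K : Set Space} (hK : ∀ v ∈ K, ‖v‖ < 1)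
    (P : Minkowski → Prop) :
    (∀ x ∈ hyperbolicCone τ K, P x) ↔ ∀ v ∈ K, P (lift τ v) := by
  constructor
  · intro h v hv
    exact h _ ⟨lift_mem_hyperboloid hτ (hK v hv), by rwa [klein_lift hτ (hK v hv)]⟩
  · rintro h x ⟨hx, hxK⟩
    obtain ⟨h1, h2⟩ := mem_cone_of_mem_hyperboloid hτ hx
    have := h _ hxK
    rwa [lift_klein hτ h1 h2] at this

theorem gap_pos_of_mem_spacelikeCompl (hτ : 0 < τ) {K : Set Space} (hK : ∀ v ∈ K, ‖v‖ < 1)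
    {y : Minkowski} (hy : y ∈ spacelikeCompl (hyperbolicCone τ K)) {v : Space} (hv : v ∈ K) :
    0 < gap τ y v := by
  have := (interior_subset hy).2
  rw [forall_hyperbolicCone_iff hτ hK] at this
  exact (lorentzSq_neg_iff (hK v hv) y).1 (this v hv)

theorem eventually_gap_pos {F : Set Space} (hF : IsCompact F) {y : Minkowski}
    (h : ∀ v ∈ F, 0 < gap τ y v) : ∀ᶠ z in 𝓝 y, ∀ v ∈ F, 0 < gap τ z v := by
  apply hF.eventually_forall_of_forall_eventually
  intro v hv
  exact continuous_gap.continuousAt.eventually (lt_mem_nhds (h v hv))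

theorem isCompact_closure_of_ball {K : Set Space} (hK : ∀ v ∈ K, ‖v‖ < 1) :
    IsCompact (closure K) :=
  Metric.isCompact_of_isClosed_isBounded isClosed_closure
    ((Metric.isBounded_ball (x := (0 : Space)) (r := 1)).subset
      (fun v hv => by simpa using hK v hv)).closure

theorem norm_le_of_mem_closure {K : Set Space} (hK : ∀ v ∈ K, ‖v‖ < 1) {v : Space}
    (hv : v ∈ closure K) : ‖v‖ ≤ 1 :=
  closure_minimal (fun v hv => (hK v hv).le) (isClosed_le continuous_norm continuous_const) hv

/-- Positivity on the compact closure, boundary sphere included, is stable under small changes of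
`y`; this is what the interior in `spacelikeCompl` requires. -/
theorem mem_spacelikeCompl_of_gap_pos (hτ : 0 < τ) {K : Set Space} (hK : ∀ v ∈ K, ‖v‖ < 1)
    {y : Minkowski} (hy : y ∈ cone) (h : ∀ v ∈ closure K, 0 < gap τ y v) :
    y ∈ spacelikeCompl (hyperbolicCone τ K) := by
  rw [spacelikeCompl, mem_interior_iff_mem_nhds]
  filter_upwards [eventually_gap_pos (isCompact_closure_of_ball hK) h, isOpen_cone.mem_nhds hy]
    with z hz hzc
  refine ⟨hzc, ?_⟩
  rw [forall_hyperbolicCone_iff hτ hK]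
  exact fun v hv => (lorentzSq_neg_iff (hK v hv) z).2 (hz v (subset_closure hv))

/-- Distinct points of the shell are spacelike to each other. With `s`, `t` the two square roots,
this is the strict reversed Cauchy-Schwarz inequality `s t < 1 - ⟪w, v⟫`, obtained by adding `‖v -
w‖² > 0` and `(s - t)² ≥ 0`; it survives at the boundary `‖v‖ = 1`. -/
theorem gap_lift_pos (hτ : 0 < τ) {w v : Space} (hw : ‖w‖ < 1) (hv : ‖v‖ ≤ 1) (hne : v ≠ w) :
    0 < gap τ (lift τ w) v := by
  have h0 := one_sub_sq_pos hw
  have hs : 0 < √(1 - ‖w‖ ^ 2) := Real.sqrt_pos.2 h0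
  have hsq : √(1 - ‖w‖ ^ 2) ^ 2 = 1 - ‖w‖ ^ 2 := Real.sq_sqrt h0.le
  have htq : √(1 - ‖v‖ ^ 2) ^ 2 = 1 - ‖v‖ ^ 2 :=
    Real.sq_sqrt (by nlinarith [norm_nonneg v])
  have hvw : 0 < ‖v - w‖ ^ 2 := by
    have := norm_pos_iff.2 (sub_ne_zero.2 hne); positivity
  rw [norm_sub_sq_real, real_inner_comm] at hvw
  rw [gap, lorentzSq_lift hw]
  simp only [lift, real_inner_smul_left]
  generalize √(1 - ‖w‖ ^ 2) = s at *
  generalize √(1 - ‖v‖ ^ 2) = t at *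
  have hst : s * t < 1 - ⟪w, v⟫_ℝ := by nlinarith [sq_nonneg (s - t)]
  have : 2 * τ * (τ / s - τ / s * ⟪w, v⟫_ℝ) - (τ ^ 2 + τ ^ 2) * t =
      2 * τ ^ 2 / s * (1 - ⟪w, v⟫_ℝ - s * t) := by
    field_simp
    ring
  rw [this]
  apply mul_pos (by positivity) (by linarith)

theorem lift_mem_spacelikeCompl (hτ : 0 < τ) {K : Set Space} (hK : ∀ v ∈ K, ‖v‖ < 1)
    {w : Space} (hw : ‖w‖ < 1) (hwK : w ∉ closure K) :
    lift τ w ∈ spacelikeCompl (hyperbolicCone τ K) :=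
  mem_spacelikeCompl_of_gap_pos hτ hK (lift_mem_cone hτ hw) fun _ hv =>
    gap_lift_pos hτ hw (norm_le_of_mem_closure hK hv) fun h => hwK (h ▸ hv)

theorem lorentzSq_nonneg_of_norm_le {w : Minkowski} (h : ‖w.2‖ ≤ w.1) : 0 ≤ lorentzSq w := by
  rw [lorentzSq]; nlinarith [norm_nonneg w.2]

theorem norm_snd_add_le {w z : Minkowski} (hw : ‖w.2‖ ≤ w.1) (hz : ‖z.2‖ ≤ z.1) :
    ‖(w + z).2‖ ≤ (w + z).1 :=
  (norm_add_le _ _).trans (add_le_add hw hz)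

theorem norm_snd_smul_le {w : Minkowski} (hw : ‖w.2‖ ≤ w.1) {r : ℝ} (hr : 0 ≤ r) :
    ‖(r • w).2‖ ≤ (r • w).1 := by
  simp only [Prod.smul_snd, Prod.smul_fst, norm_smul, Real.norm_eq_abs, abs_of_nonneg hr,
    smul_eq_mul]
  exact mul_le_mul_of_nonneg_left hw hr

theorem smul_mem_cone {w : Minkowski} (hw : w ∈ cone) {r : ℝ} (hr : 0 < r) : r • w ∈ cone := by
  simp only [cone, mem_ofPred_eq, Prod.smul_snd, Prod.smul_fst, norm_smul, Real.norm_eq_abs,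
    abs_of_pos hr, smul_eq_mul]
  exact mul_lt_mul_of_pos_left hw hr

theorem lorentzSq_smul (r : ℝ) (w : Minkowski) : lorentzSq (r • w) = r ^ 2 * lorentzSq w := by
  simp only [lorentzSq, Prod.smul_snd, Prod.smul_fst, norm_smul, Real.norm_eq_abs, mul_pow,
    sq_abs, smul_eq_mul]
  ring

theorem lorentzSq_pos {w : Minkowski} (hw : w ∈ cone) : 0 < lorentzSq w := by
  have : ‖w.2‖ < w.1 := hw
  rw [lorentzSq]; nlinarith [norm_nonneg w.2]

theorem add_mem_cone {w z : Minkowski} (hw : w ∈ cone) (hz : ‖z.2‖ ≤ z.1) : w + z ∈ cone :=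
  (norm_add_le _ _).trans_lt (add_lt_add_of_lt_of_le hw hz)

/-- Two causally related points of the cone are both causally related to some point of the time
shell. -/
theorem exists_shell_point (hτ : 0 < τ) {y z : Minkowski} (hy : y ∈ cone) (hz : z ∈ cone)
    (h : 0 ≤ lorentzSq (y - z)) :
    ∃ x ∈ cone, lorentzSq x = τ ^ 2 ∧ 0 ≤ lorentzSq (x - y) ∧ 0 ≤ lorentzSq (x - z) := by
  wlog hyz : z.1 ≤ y.1 generalizing y z
  · obtain ⟨x, h1, h2, h3, h4⟩ := this hz hy (by rwa [lorentzSq_sub_comm]) (not_le.1 hyz).le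
    exact ⟨x, h1, h2, h4, h3⟩
  have hd : ‖(y - z).2‖ ≤ (y - z).1 := by
    rw [lorentzSq] at h
    exact abs_le_of_sq_le_sq' (by linarith) (by simpa using hyz) |>.2
  -- Radial rescaling to the shell moves a point into its past if it lies above the shell and into
  -- its future if it lies below.
  have key : ∀ w ∈ cone, ∃ r : ℝ, 0 < r ∧ r • w ∈ cone ∧ lorentzSq (r • w) = τ ^ 2 ∧
      (τ ^ 2 ≤ lorentzSq w → r ≤ 1) ∧ (lorentzSq w ≤ τ ^ 2 → 1 ≤ r) := by
    intro w hw
    have hp := lorentzSq_pos hw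
    have hp' := Real.sqrt_pos.2 hp
    refine ⟨τ / √(lorentzSq w), by positivity, smul_mem_cone hw (by positivity), ?_, ?_, ?_⟩
    · rw [lorentzSq_smul, div_pow, Real.sq_sqrt hp.le]; field_simp
    · intro h; rw [div_le_one hp']; exact Real.le_sqrt_of_sq_le h
    · intro h; rw [one_le_div hp']; exact Real.sqrt_le_iff.2 ⟨hτ.le, h⟩
  -- With `z` the earlier point: if `z` is above the shell project `z`, if `y` is below project `y`;
  -- otherwise the causal segment from `z` to `y` crosses the shell.
  by_cases h1 : τ ^ 2 ≤ lorentzSq z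
  · obtain ⟨r, hr, hrc, hrs, hr1, -⟩ := key z hz
    have hz' : ‖((1 - r) • z).2‖ ≤ ((1 - r) • z).1 :=
      norm_snd_smul_le (le_of_lt hz) (by linarith [hr1 h1])
    refine ⟨r • z, hrc, hrs, ?_, ?_⟩
    · rw [lorentzSq_sub_comm, show y - r • z = (y - z) + (1 - r) • z by module]
      exact lorentzSq_nonneg_of_norm_le (norm_snd_add_le hd hz')
    · rw [lorentzSq_sub_comm, show z - r • z = (1 - r) • z by module]
      exact lorentzSq_nonneg_of_norm_le hz'
  by_cases h2 : lorentzSq y ≤ τ ^ 2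
  · obtain ⟨r, hr, hrc, hrs, -, hr1⟩ := key y hy
    have hy' : ‖((r - 1) • y).2‖ ≤ ((r - 1) • y).1 :=
      norm_snd_smul_le (le_of_lt hy) (by linarith [hr1 h2])
    refine ⟨r • y, hrc, hrs, ?_, ?_⟩
    · rw [show r • y - y = (r - 1) • y by module]
      exact lorentzSq_nonneg_of_norm_le hy'
    · rw [show r • y - z = (r - 1) • y + (y - z) by module]
      exact lorentzSq_nonneg_of_norm_le (norm_snd_add_le hy' hd)
  have hc : ContinuousOn (fun t : ℝ => lorentzSq (z + t • (y - z))) (Icc 0 1) := by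
    have := continuous_lorentzSq
    fun_prop
  obtain ⟨t, ht, htx⟩ := intermediate_value_Icc zero_le_one hc
    (show τ ^ 2 ∈ Icc _ _ from ⟨by simpa using (not_le.1 h1).le, by simpa using (not_le.1 h2).le⟩)
  refine ⟨z + t • (y - z), add_mem_cone hz (norm_snd_smul_le hd ht.1), htx, ?_, ?_⟩
  · rw [lorentzSq_sub_comm, show y - (z + t • (y - z)) = (1 - t) • (y - z) by module]
    exact lorentzSq_nonneg_of_norm_le (norm_snd_smul_le hd (by linarith [ht.2]))
  · rw [show z + t • (y - z) - z = t • (y - z) by module]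
    exact lorentzSq_nonneg_of_norm_le (norm_snd_smul_le hd ht.1)

/-- The shell points causally related to `y` all lie over `K`, and by compactness of the rest of the
closed ball this persists near `y`. A point of `X^c` causally related to such a neighbour would
share with it a causally related shell point, which could lie neither over `K` nor off `K`. -/
theorem mem_causalCompletion (hτ : 0 < τ) {K : Set Space} (hK : ∀ v ∈ K, ‖v‖ < 1)
    (hKo : IsOpen K) {y : Minkowski} (hy : y ∈ cone)
    (h : ∀ v, ‖v‖ ≤ 1 → gap τ y v ≤ 0 → v ∈ K) :
    y ∈ spacelikeCompl (spacelikeCompl (hyperbolicCone τ K)) := by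
  have hF : IsCompact (Metric.closedBall (0 : Space) 1 \ K) :=
    (isCompact_closedBall _ _).diff hKo
  rw [spacelikeCompl, mem_interior_iff_mem_nhds]
  filter_upwards [eventually_gap_pos hF (y := y) (τ := τ) (fun v hv => by
    by_contra hc
    exact hv.2 (h v (by simpa using hv.1) (not_lt.1 hc))), isOpen_cone.mem_nhds hy] with z hz hzc
  refine ⟨hzc, fun x hx => ?_⟩
  by_contra hc
  have hxc : x ∈ cone := (interior_subset hx).1
  obtain ⟨p, hp, hpτ, h1, h2⟩ := exists_shell_point hτ hxc hzc (not_lt.1 hc)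
  have hv := norm_klein_lt hp
  rw [← lift_klein hτ hp hpτ, ← not_lt, lorentzSq_neg_iff hv, not_lt] at h1 h2
  by_cases hpK : klein p ∈ K
  · exact absurd (gap_pos_of_mem_spacelikeCompl hτ hK hx hpK) (not_lt.2 h1)
  · exact absurd (hz _ ⟨by simpa using hv.le, hpK⟩) (not_lt.2 h2)

theorem spacelikeCompl_anti {X Y : Set Minkowski} (h : X ⊆ Y) :
    spacelikeCompl Y ⊆ spacelikeCompl X :=
  interior_mono fun _ hy => ⟨hy.1, fun x hx => hy.2 x (h hx)⟩

/-! ### Elliptic cones and bases of hypercones -/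

theorem sqrt_sq_add_sq_eq (w : Space) : √(w 0 ^ 2 + w 1 ^ 2) = ‖!₂[w 0, w 1]‖ := by
  simp [EuclideanSpace.norm_eq, Fin.sum_univ_two]

theorem circularCone_add {v w : Space} (hv : √(v 0 ^ 2 + v 1 ^ 2) ≤ v 2) (hw : w ∈ circularCone) :
    v + w ∈ circularCone := by
  have h : √(w 0 ^ 2 + w 1 ^ 2) < w 2 := hw
  rw [sqrt_sq_add_sq_eq] at hv h
  rw [circularCone, mem_ofPred_eq, sqrt_sq_add_sq_eq]
  have := norm_add_le !₂[v 0, v 1] !₂[w 0, w 1]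
  have e : !₂[(v + w) 0, (v + w) 1] = !₂[v 0, v 1] + !₂[w 0, w 1] := by
    ext i; fin_cases i <;> simp
  rw [e]
  simp only [PiLp.add_apply]
  linarith

theorem circularCone_smul {w : Space} (hw : w ∈ circularCone) {r : ℝ} (hr : 0 < r) :
    r • w ∈ circularCone := by
  have h : √(w 0 ^ 2 + w 1 ^ 2) < w 2 := hw
  have e : (r • w) 0 ^ 2 + (r • w) 1 ^ 2 = r ^ 2 * (w 0 ^ 2 + w 1 ^ 2) := by
    simp only [PiLp.smul_apply, smul_eq_mul]; ring
  rw [circularCone, mem_ofPred_eq, e, Real.sqrt_mul (by positivity), Real.sqrt_sq hr.le]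
  simpa using mul_lt_mul_of_pos_left h hr

theorem isOpen_circularCone : IsOpen circularCone :=
  isOpen_lt (by fun_prop) (by fun_prop)

theorem convex_circularCone : Convex ℝ circularCone := by
  rw [convex_iff_forall_pos]
  intro v hv w hw a b ha hb _
  exact circularCone_add (le_of_lt (circularCone_smul hv ha)) (circularCone_smul hw hb)

theorem isOpen_image_circularCone (L : Space ≃ₗ[ℝ] Space) : IsOpen (L '' circularCone) :=
  L.toContinuousLinearEquiv.isOpenMap _ isOpen_circularCone

theorem IsEllipticCone.norm_lt {K : Set Space} (hK : IsEllipticCone K) : ∀ v ∈ K, ‖v‖ < 1 := by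
  obtain ⟨a, L, -, rfl⟩ := hK
  exact fun v hv => hv.1

theorem IsEllipticCone.isOpen {K : Set Space} (hK : IsEllipticCone K) : IsOpen K := by
  obtain ⟨a, L, -, rfl⟩ := hK
  exact (isOpen_lt continuous_norm continuous_const).inter
    ((isOpen_image_circularCone L).preimage (by fun_prop : Continuous fun v => v - a))

theorem IsEllipticCone.convex {K : Set Space} (hK : IsEllipticCone K) : Convex ℝ K := by
  obtain ⟨a, L, -, rfl⟩ := hK
  have h1 : Convex ℝ {v : Space | ‖v‖ < 1} := by
    have := convex_ball (0 : Space) 1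
    simpa [Metric.ball, dist_zero_right] using this
  have h2 : Convex ℝ {v : Space | v - a ∈ L '' circularCone} := by
    rw [convex_iff_forall_pos]
    rintro v ⟨v', hv, hv'⟩ w ⟨w', hw, hw'⟩ b c hb hc hbc
    refine ⟨b • v' + c • w', (convex_iff_forall_pos.1 convex_circularCone) hv hw hb hc hbc, ?_⟩
    rw [map_add, map_smul, map_smul, hv', hw']
    have : a = b • a + c • a := by rw [← add_smul, hbc, one_smul]
    nth_rewrite 3 [this]
    module
  exact h1.inter h2

theorem basis_mem_circularCone : !₂[(0 : ℝ), 0, 1] ∈ circularCone := by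
  simp [circularCone]

theorem exists_pos_norm_add_smul_lt {a : Space} (ha : ‖a‖ < 1) (w : Space) :
    ∃ r : ℝ, 0 < r ∧ ‖a + r • w‖ < 1 := by
  have hc : Continuous fun r : ℝ => ‖a + r • w‖ := by fun_prop
  have : ∀ᶠ r : ℝ in 𝓝[>] 0, ‖a + r • w‖ < 1 :=
    nhdsWithin_le_nhds (hc.continuousAt.eventually (gt_mem_nhds (by simpa using ha)))
  obtain ⟨r, hr, hr'⟩ := (this.and self_mem_nhdsWithin).exists
  exact ⟨r, hr', hr⟩

theorem IsEllipticCone.nonempty {K : Set Space} (hK : IsEllipticCone K) : K.Nonempty := by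
  obtain ⟨a, L, ha, rfl⟩ := hK
  obtain ⟨r, hr, hr'⟩ := exists_pos_norm_add_smul_lt ha (L !₂[(0 : ℝ), 0, 1])
  refine ⟨_, hr', r • !₂[(0 : ℝ), 0, 1], circularCone_smul basis_mem_circularCone hr, ?_⟩
  rw [map_smul]; abel

/-- The base of a hypercone in the Klein model. -/
def base (C : Hypercone τ) : Set Space := {v | ‖v‖ < 1 ∧ lift τ v ∈ C.region}

/-- A hypercone remembers its cone: points outside the closure of `K` lift into `X^c`, so the open
set `base C` lies in the interior of that closure, which is `K` itself since `K` is open and convex.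
-/
theorem base_eq (hτ : 0 < τ) {C : Hypercone τ} {K : Set Space} (hK : IsEllipticCone K)
    (h : C.region = spacelikeCompl (spacelikeCompl (hyperbolicCone τ K))) : base C = K := by
  apply Subset.antisymm
  · have hsub : base C ⊆ closure K := by
      rintro v ⟨hv, hvC⟩
      by_contra hc
      rw [h] at hvC
      have := (interior_subset hvC).2 _ (lift_mem_spacelikeCompl hτ hK.norm_lt hv hc)
      simp [lorentzSq] at this
    have hopen : IsOpen (base C) := by
      have hr : IsOpen C.region := by rw [h]; exact isOpen_interior
      exact continuousOn_lift.isOpen_inter_preimage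
        (isOpen_lt continuous_norm continuous_const) hr
    have := interior_maximal hsub hopen
    rwa [hK.convex.interior_closure_eq_interior_of_nonempty_interior
      (by rw [hK.isOpen.interior_eq]; exact hK.nonempty), hK.isOpen.interior_eq] at this
  · intro v hv
    refine ⟨hK.norm_lt v hv, ?_⟩
    rw [h]
    refine mem_causalCompletion hτ hK.norm_lt hK.isOpen (lift_mem_cone hτ (hK.norm_lt v hv)) ?_
    intro u hu hg
    by_contra hc
    exact absurd (gap_lift_pos hτ (hK.norm_lt v hv) hu (fun e => hc (e ▸ hv))) (not_lt.2 hg)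

theorem isEllipticCone_base (hτ : 0 < τ) (C : Hypercone τ) : IsEllipticCone (base C) := by
  obtain ⟨K, hK, h⟩ := C.exists_base
  rwa [base_eq hτ hK h]

theorem region_eq (hτ : 0 < τ) (C : Hypercone τ) :
    C.region = spacelikeCompl (spacelikeCompl (hyperbolicCone τ (base C))) := by
  obtain ⟨K, hK, h⟩ := C.exists_base
  rwa [base_eq hτ hK h]

/-- The hypercone with a given base. -/
def Hypercone.ofBase (τ : ℝ) (K : Set Space) (hK : IsEllipticCone K) : Hypercone τ :=
  ⟨_, K, hK, rfl⟩

theorem base_ofBase (hτ : 0 < τ) {K : Set Space} (hK : IsEllipticCone K) :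
    base (Hypercone.ofBase τ K hK) = K :=
  base_eq hτ hK rfl

theorem region_subset_cone (C : Hypercone τ) : C.region ⊆ cone := by
  obtain ⟨K, hK, h⟩ := C.exists_base
  rw [h]; exact fun x hx => (interior_subset hx).1

theorem compl_subset_cone (C : Hypercone τ) : C.compl ⊆ cone :=
  fun _ hx => (interior_subset hx).1

theorem region_subset_iff (hτ : 0 < τ) {C D : Hypercone τ} :
    C.region ⊆ D.region ↔ base C ⊆ base D := by
  refine ⟨fun h v hv => ⟨hv.1, h hv.2⟩, fun h => ?_⟩
  rw [region_eq hτ C, region_eq hτ D]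
  exact spacelikeCompl_anti (spacelikeCompl_anti fun x hx => ⟨hx.1, h hx.2⟩)

/-- Disjoint bases suffice because an open set disjoint from `base D` is also disjoint from its
closure; taking causal completions of the resulting inclusion gives separation of the full regions.
-/
theorem sep_iff (hτ : 0 < τ) {C D : Hypercone τ} :
    C.SpacelikeSep D ↔ Disjoint (base C) (base D) := by
  constructor
  · intro h
    rw [Set.disjoint_left]
    intro v hv hv'
    have := (interior_subset (h hv.2)).2 _ hv'.2
    simp [lorentzSq] at this
  · intro h
    have hC := isEllipticCone_base hτ C
    have hD := isEllipticCone_base hτ D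
    have h1 : hyperbolicCone τ (base C) ⊆ spacelikeCompl (hyperbolicCone τ (base D)) := by
      intro x
      revert x
      rw [forall_hyperbolicCone_iff hτ hC.norm_lt]
      intro v hv
      refine lift_mem_spacelikeCompl hτ hD.norm_lt hv.1 fun hc => ?_
      exact Set.disjoint_left.1 (h.closure_right hC.isOpen) hv hc
    rw [Hypercone.SpacelikeSep, Hypercone.compl, region_eq hτ C, region_eq hτ D]
    have hopen : ∀ X : Set Minkowski, IsOpen X → X ⊆ cone →
        X ⊆ spacelikeCompl (spacelikeCompl X) := fun X hX hXV =>
      interior_maximal (fun x hx => ⟨hXV hx, fun y hy => by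
        rw [lorentzSq_sub_comm]; exact (interior_subset hy).2 x hx⟩) hX
    have h2 := spacelikeCompl_anti (spacelikeCompl_anti h1)
    refine h2.trans (spacelikeCompl_anti ?_)
    exact Subset.rfl

theorem sep_symm (hτ : 0 < τ) {C D : Hypercone τ} (h : C.SpacelikeSep D) : D.SpacelikeSep C := by
  rw [sep_iff hτ] at *; exact h.symm

theorem sep_mono (hτ : 0 < τ) {C D C' D' : Hypercone τ} (h : C.SpacelikeSep D)
    (hC : C'.region ⊆ C.region) (hD : D'.region ⊆ D.region) : C'.SpacelikeSep D' := by
  rw [sep_iff hτ] at *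
  rw [region_subset_iff hτ] at *
  exact h.mono hC hD

/-- As `‖v‖ → 1` the square root in `gap` tends to zero while its first term stays above `2 τ m`.
Bounded sets away from the light cone thus see only a compact part of the shell. -/
theorem exists_radius_of_bounds (hτ : 0 < τ) {m M : ℝ} (hm : 0 < m) :
    ∃ R : ℝ, 0 < R ∧ R < 1 ∧ ∀ y ∈ cone, m ≤ y.1 - ‖y.2‖ → y.1 ≤ M → ∀ v : Space, ‖v‖ ≤ 1 →
      gap τ y v ≤ 0 → ‖v‖ ≤ R := by
  have hc : ContinuousAt (fun r : ℝ => 2 * τ * m - (τ ^ 2 + M ^ 2) * √(1 - r ^ 2)) 1 := by fun_prop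
  have h1 : ∀ᶠ r in 𝓝[<] (1 : ℝ), 0 < 2 * τ * m - (τ ^ 2 + M ^ 2) * √(1 - r ^ 2) :=
    nhdsWithin_le_nhds (hc.eventually (lt_mem_nhds (by simp; positivity)))
  obtain ⟨R, ⟨hR, hR1⟩, hR0⟩ := ((h1.and self_mem_nhdsWithin).and
    (nhdsWithin_le_nhds (lt_mem_nhds (zero_lt_one)))).exists
  refine ⟨R, hR0, hR1, fun y hy hym hyM v hv hg => ?_⟩
  by_contra hc
  rw [not_le] at hc
  have hyc : ‖y.2‖ < y.1 := hy
  have hs : √(1 - ‖v‖ ^ 2) ≤ √(1 - R ^ 2) := Real.sqrt_le_sqrt (by nlinarith)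
  have hin : ⟪y.2, v⟫_ℝ ≤ ‖y.2‖ := by
    have := real_inner_le_norm y.2 v
    nlinarith [norm_nonneg y.2]
  have hl0 := lorentzSq_pos hy
  have hl : lorentzSq y ≤ M ^ 2 := by
    rw [lorentzSq]; nlinarith [norm_nonneg y.2, sq_nonneg ‖y.2‖]
  have h3 : (τ ^ 2 + lorentzSq y) * √(1 - ‖v‖ ^ 2) ≤ (τ ^ 2 + M ^ 2) * √(1 - R ^ 2) := by gcongr
  have h4 : 2 * τ * m ≤ 2 * τ * (y.1 - ⟪y.2, v⟫_ℝ) :=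
    mul_le_mul_of_nonneg_left (by linarith) (by positivity)
  rw [gap] at hg
  linarith

theorem exists_radius_region (hτ : 0 < τ) (O : DoubleCone) :
    ∃ R : ℝ, 0 < R ∧ R < 1 ∧ ∀ C : Hypercone τ, Metric.closedBall 0 R ⊆ base C →
      O.region ⊆ C.region := by
  have hp : ‖O.past.2‖ < O.past.1 := O.past_mem
  obtain ⟨R, h0, h1, hR⟩ := exists_radius_of_bounds hτ (m := O.past.1 - ‖O.past.2‖)
    (M := O.future.1) (by linarith)
  refine ⟨R, h0, h1, fun C hC x hx => ?_⟩
  have hx1 : ‖(x - O.past).2‖ < (x - O.past).1 := hx.1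
  have hx2 : ‖(O.future - x).2‖ < (O.future - x).1 := hx.2
  have hxV : x ∈ cone := by
    have := add_mem_cone (O.past_mem) hx1.le
    simpa using this
  have hE := isEllipticCone_base hτ C
  rw [region_eq hτ C]
  refine mem_causalCompletion hτ hE.norm_lt hE.isOpen hxV fun v hv hg => hC ?_
  rw [mem_closedBall_zero_iff]
  simp only [Prod.fst_sub, Prod.snd_sub] at hx1 hx2
  refine hR x hxV ?_ ?_ v hv hg
  · have := norm_sub_norm_le x.2 O.past.2
    linarith
  · linarith [norm_nonneg (O.future.2 - x.2)]

/-- The bases of a funnel leave every compact subset of the unit ball. -/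
theorem IsFunnel.exists_disjoint (hτ : 0 < τ) {c : ℕ → Hypercone τ} (hc : IsFunnel c) {R : ℝ}
    (hR : R < 1) : ∃ n, Disjoint (base (c n)) (Metric.closedBall 0 R) := by
  have hanti : ∀ m n, m ≤ n → (c m).compl ⊆ (c n).compl := fun m n hmn =>
    spacelikeCompl_anti (antitone_nat_of_succ_le (f := fun n => (c n).region) hc.1 hmn)
  have hlift : ContinuousOn (lift τ) (Metric.closedBall 0 R) :=
    continuousOn_lift.mono fun v hv => by
      rw [mem_closedBall_zero_iff] at hv; exact hv.trans_lt hR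
  have hcomp : IsCompact (lift τ '' Metric.closedBall 0 R) :=
    (isCompact_closedBall _ _).image_of_continuousOn hlift
  obtain ⟨n, hn⟩ := hcomp.elim_directed_cover (fun n => (c n).compl) (fun n => isOpen_interior)
    (by
      rw [hc.2]
      rintro _ ⟨v, hv, rfl⟩
      rw [mem_closedBall_zero_iff] at hv
      exact lift_mem_cone hτ (hv.trans_lt hR))
    (fun i j => ⟨max i j, hanti _ _ (le_max_left _ _), hanti _ _ (le_max_right _ _)⟩)
  refine ⟨n, Set.disjoint_left.2 fun v hv hv' => ?_⟩
  have := (interior_subset (hn ⟨v, hv', rfl⟩)).2 _ hv.2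
  simp [lorentzSq] at this

/-- A point `y` of `V` belongs to a hypercone as soon as the base covers the ball of radius supplied
by `exists_radius_of_bounds` at `y`; a funnel member spacelike to that hypercone has `y` in its
complement. -/
theorem isFunnel_of_bases (hτ : 0 < τ) {c : ℕ → Hypercone τ}
    (hc : ∀ n, base (c (n + 1)) ⊆ base (c n))
    (h : ∀ R < 1, ∃ n, ∃ D : Hypercone τ, Metric.closedBall 0 R ⊆ base D ∧
      Disjoint (base D) (base (c n))) :
    IsFunnel c := by
  refine ⟨fun n => (region_subset_iff hτ).2 (hc n), ?_⟩
  apply Subset.antisymm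
  · exact iUnion_subset fun n => compl_subset_cone _
  intro y hy
  have hy' : ‖y.2‖ < y.1 := hy
  obtain ⟨R, h0, h1, hR⟩ := exists_radius_of_bounds hτ (m := y.1 - ‖y.2‖) (M := y.1) (by linarith)
  obtain ⟨n, D, hD, hn⟩ := h R h1
  have hE := isEllipticCone_base hτ D
  refine mem_iUnion.2 ⟨n, (sep_iff hτ).2 hn ?_⟩
  rw [region_eq hτ D]
  refine mem_causalCompletion hτ hE.norm_lt hE.isOpen hy fun v hv hg => hD ?_
  rw [mem_closedBall_zero_iff]
  exact hR y hy le_rfl le_rfl v hv hg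

end LightCone

namespace LightCone

open Set Filter Topology

variable {τ : ℝ}

/-! ### Caps of the unit ball -/

/-- A cap of the open unit ball. -/
def cap (p : Space) (s : ℝ) : Set Space := {v | ‖v‖ < 1 ∧ s < ⟪p, v⟫_ℝ}

theorem cap_anti (p : Space) {s t : ℝ} (h : s ≤ t) : cap p t ⊆ cap p s :=
  fun _ hv => ⟨hv.1, h.trans_lt hv.2⟩

/-- The linear equivalence scaling the third coordinate. -/
noncomputable def scaleThird (δ : ℝ) (hδ : δ ≠ 0) : Space ≃ₗ[ℝ] Space where
  toFun u := !₂[u 0, u 1, δ * u 2]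
  invFun u := !₂[u 0, u 1, δ⁻¹ * u 2]
  map_add' u v := by ext i; fin_cases i <;> simp [mul_add]
  map_smul' r u := by ext i; fin_cases i <;> simp [mul_left_comm]
  left_inv u := by ext i; fin_cases i <;> simp [hδ]
  right_inv u := by ext i; fin_cases i <;> simp [hδ]

theorem norm_basis : ‖(!₂[(0 : ℝ), 0, 1] : Space)‖ = 1 := by
  simp [EuclideanSpace.norm_eq, Fin.sum_univ_three]

/-- Scaling the third coordinate adjusts the opening angle, with cosine `κ`, and a reflection turns
the third axis into `q`. -/
theorem exists_equiv_image_circularCone {q : Space} (hq : ‖q‖ = 1) {κ : ℝ} (h0 : 0 < κ)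
    (h1 : κ < 1) : ∃ L : Space ≃ₗ[ℝ] Space, L '' circularCone = {w | κ * ‖w‖ < ⟪q, w⟫_ℝ} := by
  have hk : 0 < 1 - κ ^ 2 := by nlinarith
  have hs : 0 < √(1 - κ ^ 2) := Real.sqrt_pos.2 hk
  have hss : √(1 - κ ^ 2) ^ 2 = 1 - κ ^ 2 := Real.sq_sqrt hk.le
  have hδ : κ / √(1 - κ ^ 2) ≠ 0 := by positivity
  set T : Space ≃ₗᵢ[ℝ] Space := (ℝ ∙ (!₂[(0 : ℝ), 0, 1] - q))ᗮ.reflection with hT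
  have hTe : T !₂[(0 : ℝ), 0, 1] = q := Submodule.reflection_sub (by rw [norm_basis, hq])
  refine ⟨(scaleThird _ hδ).trans T.toLinearEquiv, ?_⟩
  ext w
  obtain ⟨u, rfl⟩ := T.surjective w
  obtain ⟨x, rfl⟩ := (scaleThird _ hδ).surjective u
  have hin : ⟪q, T (scaleThird _ hδ x)⟫_ℝ = κ / √(1 - κ ^ 2) * x 2 := by
    rw [← hTe, T.inner_map_map]
    simp [scaleThird, PiLp.inner_apply, Fin.sum_univ_three]
  have hn : ‖T (scaleThird _ hδ x)‖ = √(x 0 ^ 2 + x 1 ^ 2 + (κ / √(1 - κ ^ 2) * x 2) ^ 2) := by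
    rw [T.norm_map]
    simp [scaleThird, EuclideanSpace.norm_eq, Fin.sum_univ_three]
  have hmem : T (scaleThird _ hδ x) ∈ (((scaleThird _ hδ).trans T.toLinearEquiv :
      Space ≃ₗ[ℝ] Space) : Space → Space) '' circularCone ↔ x ∈ circularCone := by
    constructor
    · rintro ⟨y, hy, hxy⟩
      have : y = x := (scaleThird _ hδ).injective (T.injective hxy)
      exact this ▸ hy
    · exact fun h => ⟨x, h, rfl⟩
  rw [hmem, mem_ofPred_eq, hin, hn, circularCone, mem_ofPred_eq]
  generalize √(1 - κ ^ 2) = s at *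
  rw [show κ / s * x 2 = κ * (x 2 / s) by ring]
  rw [mul_lt_mul_iff_right₀ h0]
  have e : x 0 ^ 2 + x 1 ^ 2 + (κ * (x 2 / s)) ^ 2 =
      (x 0 ^ 2 + x 1 ^ 2) + (1 - s ^ 2) * (x 2 / s) ^ 2 := by rw [hss]; ring
  have e2 : (x 2 / s) ^ 2 - (1 - s ^ 2) * (x 2 / s) ^ 2 = x 2 ^ 2 := by field_simp; ring
  constructor
  · intro h
    have hx : 0 < x 2 := (Real.sqrt_nonneg _).trans_lt h
    rw [Real.sqrt_lt' hx] at h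
    rw [Real.sqrt_lt' (by positivity), e]
    linarith
  · intro h
    have hx : 0 < x 2 / s := (Real.sqrt_nonneg _).trans_lt h
    rw [Real.sqrt_lt' hx, e] at h
    have hx2 : 0 < x 2 := by
      have := mul_pos hx hs
      rwa [div_mul_cancel₀ _ hs.ne'] at this
    rw [Real.sqrt_lt' hx2]
    linarith

theorem exists_circular_cone {q : Space} (hq : ‖q‖ = 1) {κ : ℝ} (h0 : 0 < κ) (h1 : κ < 1)
    {s : ℝ} (hs : |s| < 1) :
    IsEllipticCone {v | ‖v‖ < 1 ∧ κ * ‖v - s • q‖ < ⟪q, v⟫_ℝ - s} := by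
  obtain ⟨L, hL⟩ := exists_equiv_image_circularCone hq h0 h1
  refine ⟨s • q, L, by rw [norm_smul, hq]; simpa using hs, ?_⟩
  rw [hL]
  ext v
  simp only [mem_ofPred_eq, inner_sub_right, real_inner_smul_right, real_inner_self_eq_norm_sq, hq]
  simp

/-- A very wide cone with apex `s • q` is nearly a half space. It allows cones and caps to be used
interchangeably in the sequel. -/
theorem exists_hypercone_between (hτ : 0 < τ) {q : Space} (hq : ‖q‖ = 1) {s t : ℝ} (hs : -1 < s)
    (hs1 : s < 1) (hst : s < t) :
    ∃ C : Hypercone τ, cap q t ⊆ base C ∧ base C ⊆ cap q s := by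
  -- Points of the ball have distance at most `2` from the apex, so `2 κ ≤ t - s` puts the cap at
  -- height `t` inside the cone.
  set κ := min ((t - s) / 2) (1 / 2) with hκ
  have h0 : 0 < κ := lt_min (by linarith) (by norm_num)
  have h1 : κ < 1 := (min_le_right _ _).trans_lt (by norm_num)
  have hE := exists_circular_cone hq h0 h1 (abs_lt.2 ⟨hs, hs1⟩)
  refine ⟨Hypercone.ofBase τ _ hE, ?_, ?_⟩ <;> rw [base_ofBase hτ hE]
  · rintro v ⟨hv, hvt⟩
    refine ⟨hv, ?_⟩
    have h2 : ‖v - s • q‖ ≤ 2 := by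
      refine (norm_sub_le _ _).trans ?_
      rw [norm_smul, hq, Real.norm_eq_abs]
      linarith [(abs_lt.2 ⟨hs, hs1⟩ : |s| < 1)]
    have h3 : κ ≤ (t - s) / 2 := min_le_left _ _
    nlinarith [norm_nonneg (v - s • q)]
  · rintro v ⟨hv, hvt⟩
    exact ⟨hv, by nlinarith [norm_nonneg (v - s • q)]⟩

theorem exists_hypercone_in_cap (hτ : 0 < τ) {q : Space} (hq : ‖q‖ = 1) {s : ℝ} (hs1 : s < 1) :
    ∃ C : Hypercone τ, base C ⊆ cap q s := by
  obtain ⟨C, -, hC⟩ := exists_hypercone_between hτ hq (s := max s 0) (t := 1)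
    (by linarith [le_max_right s 0]) (max_lt hs1 one_pos) (max_lt hs1 one_pos)
  exact ⟨C, hC.trans (cap_anti q (le_max_left _ _))⟩

/-- For heights near `1` this gives hypercones that fill the ball except for a small cap at `q`;
they play the role of arbitrarily large hypercones. -/
theorem exists_hypercone_halfball (hτ : 0 < τ) {q : Space} (hq : ‖q‖ = 1) {s t : ℝ} (hs : -1 < t)
    (hs1 : t < 1) (hst : s < t) :
    ∃ C : Hypercone τ, (∀ v, ‖v‖ < 1 → ⟪q, v⟫_ℝ < s → v ∈ base C) ∧
      ∀ v ∈ base C, ⟪q, v⟫_ℝ < t := by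
  obtain ⟨C, h1, h2⟩ := exists_hypercone_between hτ (q := -q) (by rwa [norm_neg]) (s := -t)
    (t := -s) (by linarith) (by linarith) (by linarith)
  refine ⟨C, fun v hv hvs => h1 ⟨hv, ?_⟩, fun v hv => ?_⟩
  · rw [inner_neg_left]; linarith
  · have := (h2 hv).2
    rw [inner_neg_left] at this; linarith

theorem base_nonempty (hτ : 0 < τ) (C : Hypercone τ) : (base C).Nonempty :=
  (isEllipticCone_base hτ C).nonempty

theorem norm_sub_sq_lt {q v : Space} (hq : ‖q‖ = 1) (hv : ‖v‖ ≤ 1) :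
    ‖v - q‖ ^ 2 ≤ 2 - 2 * ⟪q, v⟫_ℝ := by
  rw [norm_sub_sq_real, hq, real_inner_comm]
  nlinarith [norm_nonneg v]

theorem exists_cap_subset {q : Space} (hq : ‖q‖ = 1) {U : Set Space} (hU : U ∈ 𝓝 q) :
    ∃ s : ℝ, 0 < s ∧ s < 1 ∧ ∀ v, ‖v‖ ≤ 1 → s < ⟪q, v⟫_ℝ → v ∈ U := by
  obtain ⟨ε, hε, h⟩ := Metric.mem_nhds_iff.1 hU
  refine ⟨max (1 - ε ^ 2 / 2) (1 / 2), lt_max_of_lt_right (by norm_num), max_lt (by nlinarith)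
    (by norm_num), fun v hv hvs => h ?_⟩
  rw [mem_ball_iff_norm]
  have h1 := norm_sub_sq_lt hq hv
  have h2 := (le_max_left (1 - ε ^ 2 / 2) (1 / 2)).trans_lt hvs
  exact lt_of_pow_lt_pow_left₀ 2 hε.le (by linarith)

theorem exists_cap_subset_cap {q : Space} (hq : ‖q‖ = 1) {n : Space} {s : ℝ}
    (h : s < ⟪n, q⟫_ℝ) : ∃ t : ℝ, 0 < t ∧ t < 1 ∧ cap q t ⊆ cap n s := by
  have hc : Continuous fun v : Space => ⟪n, v⟫_ℝ := by fun_prop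
  obtain ⟨t, h0, h1, ht⟩ := exists_cap_subset hq
    (hc.continuousAt.eventually (lt_mem_nhds h) : {v | s < ⟪n, v⟫_ℝ} ∈ 𝓝 q)
  exact ⟨t, h0, h1, fun v hv => ⟨hv.1, ht v hv.1.le hv.2⟩⟩

theorem inner_lt_one {p q : Space} (hp : ‖p‖ = 1) (hq : ‖q‖ = 1) (h : p ≠ q) : ⟪p, q⟫_ℝ < 1 := by
  have h1 := norm_pos_iff.2 (sub_ne_zero.2 h)
  have h2 := norm_sub_sq_real p q
  rw [hp, hq] at h2
  nlinarith

theorem exists_unit_notMem (F : Set Space) (hF : F.Finite) : ∃ p : Space, ‖p‖ = 1 ∧ p ∉ F := by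
  have hr : 1 < Module.rank ℝ Space := by
    rw [← Module.finrank_eq_rank, finrank_euclideanSpace]; norm_num
  have hconn : IsPreconnected (Metric.sphere (0 : Space) 1) := isPreconnected_sphere hr 0 1
  have hnt : (Metric.sphere (0 : Space) 1).Nontrivial := by
    refine ⟨!₂[(0 : ℝ), 0, 1], by simpa using norm_basis, -!₂[(0 : ℝ), 0, 1],
      by simpa using norm_basis, fun h => ?_⟩
    have h2 : (1 : ℝ) = -1 := congrArg (fun v : Space => v 2) h
    norm_num at h2
  obtain ⟨p, hp, hpF⟩ := (hconn.infinite_of_nontrivial hnt).exists_notMem_finite hF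
  exact ⟨p, by simpa using hp, hpF⟩

/-! ### Radial projection to the sphere -/

/-- The time at which the ray from `a` in the direction `w` leaves the unit ball. -/
noncomputable def exitTime (a w : Space) : ℝ :=
  (-⟪a, w⟫_ℝ + √(⟪a, w⟫_ℝ ^ 2 + ‖w‖ ^ 2 * (1 - ‖a‖ ^ 2))) / ‖w‖ ^ 2

/-- The point at which the ray from `a` in the direction `w` leaves the unit ball. -/
noncomputable def exitPoint (a w : Space) : Space := a + exitTime a w • w

theorem exitTime_pos {a w : Space} (ha : ‖a‖ < 1) (hw : w ≠ 0) : 0 < exitTime a w := by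
  have h1 := one_sub_sq_pos ha
  have h2 : 0 < ‖w‖ := norm_pos_iff.2 hw
  have h3 : |⟪a, w⟫_ℝ| < √(⟪a, w⟫_ℝ ^ 2 + ‖w‖ ^ 2 * (1 - ‖a‖ ^ 2)) := by
    apply Real.lt_sqrt_of_sq_lt
    rw [sq_abs]
    have : 0 < ‖w‖ ^ 2 * (1 - ‖a‖ ^ 2) := by positivity
    linarith
  have h4 := le_abs_self ⟪a, w⟫_ℝ
  exact div_pos (by linarith) (by positivity)

theorem norm_exitPoint {a w : Space} (ha : ‖a‖ < 1) (hw : w ≠ 0) : ‖exitPoint a w‖ = 1 := by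
  have h1 := one_sub_sq_pos ha
  have h2 : 0 < ‖w‖ := norm_pos_iff.2 hw
  have h3 : √(⟪a, w⟫_ℝ ^ 2 + ‖w‖ ^ 2 * (1 - ‖a‖ ^ 2)) ^ 2 =
      ⟪a, w⟫_ℝ ^ 2 + ‖w‖ ^ 2 * (1 - ‖a‖ ^ 2) := Real.sq_sqrt (by positivity)
  have h4 : ‖exitPoint a w‖ ^ 2 = 1 := by
    rw [exitPoint, norm_add_sq_real, real_inner_smul_right, norm_smul, mul_pow, Real.norm_eq_abs,
      sq_abs, exitTime]
    generalize √(⟪a, w⟫_ℝ ^ 2 + ‖w‖ ^ 2 * (1 - ‖a‖ ^ 2)) = r at *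
    field_simp
    linear_combination h3
  nlinarith [norm_nonneg (exitPoint a w)]

theorem exitPoint_sub {a q : Space} (ha : ‖a‖ < 1) (hq : ‖q‖ = 1) : exitPoint a (q - a) = q := by
  have hne : q - a ≠ 0 := by
    intro h; rw [sub_eq_zero] at h; rw [h] at hq; linarith
  have h2 : 0 < ‖q - a‖ := norm_pos_iff.2 hne
  have hn : ‖q - a‖ ^ 2 = 1 - 2 * ⟪a, q⟫_ℝ + ‖a‖ ^ 2 := by
    rw [norm_sub_sq_real, hq, real_inner_comm]; ring
  have hi : ⟪a, q - a⟫_ℝ = ⟪a, q⟫_ℝ - ‖a‖ ^ 2 := by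
    rw [inner_sub_right, real_inner_self_eq_norm_sq]
  have h3 : ⟪a, q⟫_ℝ ≤ 1 := by
    have := real_inner_le_norm a q
    rw [hq] at this; linarith
  have h4 : √(⟪a, q - a⟫_ℝ ^ 2 + ‖q - a‖ ^ 2 * (1 - ‖a‖ ^ 2)) = 1 - ⟪a, q⟫_ℝ := by
    rw [Real.sqrt_eq_iff_mul_self_eq (by have := one_sub_sq_pos ha; positivity) (by linarith),
      hn, hi]
    ring
  have : exitTime a (q - a) = 1 := by
    rw [exitTime, h4, hi, hn, div_eq_one_iff_eq (by rw [← hn]; positivity)]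
    ring
  rw [exitPoint, this, one_smul]; abel

theorem continuousAt_exitPoint (a : Space) {w : Space} (hw : w ≠ 0) :
    ContinuousAt (exitPoint a) w := by
  have h2 : ‖w‖ ^ 2 ≠ 0 := by
    have := norm_pos_iff.2 hw; positivity
  unfold exitPoint exitTime
  fun_prop (disch := assumption)

theorem isClosed_image_closedCone (L : Space ≃ₗ[ℝ] Space) :
    IsClosed (L '' {u : Space | √(u 0 ^ 2 + u 1 ^ 2) ≤ u 2}) :=
  L.toContinuousLinearEquiv.toHomeomorph.isClosedMap _
    (isClosed_le (by fun_prop) (by fun_prop))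

theorem circularCone_subset : circularCone ⊆ {u : Space | √(u 0 ^ 2 + u 1 ^ 2) ≤ u 2} :=
  fun u hu => (show √(u 0 ^ 2 + u 1 ^ 2) < u 2 from hu).le

theorem exists_cap_disjoint {a : Space} {L : Space ≃ₗ[ℝ] Space} {q : Space} (hq : ‖q‖ = 1)
    (h : q - a ∉ L '' {u : Space | √(u 0 ^ 2 + u 1 ^ 2) ≤ u 2}) :
    ∃ s : ℝ, 0 < s ∧ s < 1 ∧
      ∀ v ∈ {v : Space | ‖v‖ < 1 ∧ v - a ∈ L '' circularCone}, ⟪q, v⟫_ℝ ≤ s := by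
  have hc : Continuous fun v : Space => v - a := by fun_prop
  obtain ⟨s, h0, h1, hs⟩ := exists_cap_subset hq
    (((isClosed_image_closedCone L).isOpen_compl.preimage hc).mem_nhds h)
  refine ⟨s, h0, h1, fun v hv => ?_⟩
  by_contra hlt
  exact hs v hv.1.le (not_le.1 hlt) (image_mono circularCone_subset hv.2)

/-- The axis of the cone leaves the ball at a point interior to the untruncated cone. -/
theorem exists_cap_subset_base (hτ : 0 < τ) (C : Hypercone τ) :
    ∃ q : Space, ‖q‖ = 1 ∧ ∃ s : ℝ, 0 < s ∧ s < 1 ∧ cap q s ⊆ base C := by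
  obtain ⟨a, L, ha, hK⟩ := isEllipticCone_base hτ C
  have hne : L !₂[(0 : ℝ), 0, 1] ≠ 0 := by
    rw [Ne, LinearEquiv.map_eq_zero_iff]
    intro h; have := norm_basis; rw [h] at this; simp at this
  have hq := norm_exitPoint ha hne
  have ht := exitTime_pos ha hne
  have hc : Continuous fun v : Space => v - a := by fun_prop
  have hmem : exitPoint a (L !₂[(0 : ℝ), 0, 1]) - a ∈ L '' circularCone :=
    ⟨_, circularCone_smul basis_mem_circularCone ht, by rw [map_smul, exitPoint]; abel⟩
  obtain ⟨s, h0, h1, hs⟩ := exists_cap_subset hq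
    (((isOpen_image_circularCone L).preimage hc).mem_nhds hmem)
  refine ⟨_, hq, s, h0, h1, fun v hv => ?_⟩
  rw [hK]
  exact ⟨hv.1, hs v hv.1.le hv.2⟩

/-- A sphere point with a cap disjoint from an elliptic cone is outside its closure. -/
theorem notMem_closedCone {a : Space} (ha : ‖a‖ < 1) {L : Space ≃ₗ[ℝ] Space} {q : Space}
    (hq : ‖q‖ = 1) {s : ℝ} (hs : s < 1)
    (h : ∀ v ∈ {v : Space | ‖v‖ < 1 ∧ v - a ∈ L '' circularCone}, ⟪q, v⟫_ℝ ≤ s) :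
    q - a ∉ L '' {u : Space | √(u 0 ^ 2 + u 1 ^ 2) ≤ u 2} := by
  rintro ⟨u, hu, hua⟩
  have hu' : √(u 0 ^ 2 + u 1 ^ 2) ≤ u 2 := hu
  -- If `q - a` were in the closed cone, then pulling `q` slightly towards the apex (by `θ`) enters
  -- the ball and pushing along the axis (by `η`) enters the open cone, while staying above height
  -- `s`.
  have hc : Continuous fun θ : ℝ => ⟪q, a + (1 - θ) • (q - a)⟫_ℝ := by fun_prop
  have h1 : ∀ᶠ θ in 𝓝[>] (0 : ℝ), s < ⟪q, a + (1 - θ) • (q - a)⟫_ℝ :=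
    nhdsWithin_le_nhds (hc.continuousAt.eventually (lt_mem_nhds (by
      simpa [hq] using hs)))
  obtain ⟨θ, ⟨hθs, hθ0⟩, hθ1⟩ := ((h1.and self_mem_nhdsWithin).and
    (nhdsWithin_le_nhds (gt_mem_nhds (zero_lt_one)))).exists
  replace hθ0 : 0 < θ := hθ0
  have hn : ‖a + (1 - θ) • (q - a)‖ < 1 := by
    rw [show a + (1 - θ) • (q - a) = θ • a + (1 - θ) • q by module]
    refine (norm_add_le _ _).trans_lt ?_
    rw [norm_smul, norm_smul, hq, Real.norm_eq_abs, Real.norm_eq_abs, abs_of_pos hθ0,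
      abs_of_pos (by linarith)]
    nlinarith
  set x := a + (1 - θ) • (q - a) with hx
  have hc1 : Continuous fun η : ℝ => ‖x + η • L !₂[(0 : ℝ), 0, 1]‖ := by fun_prop
  have hc2 : Continuous fun η : ℝ => ⟪q, x + η • L !₂[(0 : ℝ), 0, 1]⟫_ℝ := by fun_prop
  have h2 : ∀ᶠ η in 𝓝[>] (0 : ℝ), ‖x + η • L !₂[(0 : ℝ), 0, 1]‖ < 1 :=
    nhdsWithin_le_nhds (hc1.continuousAt.eventually (gt_mem_nhds (by simpa using hn)))
  have h3 : ∀ᶠ η in 𝓝[>] (0 : ℝ), s < ⟪q, x + η • L !₂[(0 : ℝ), 0, 1]⟫_ℝ :=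
    nhdsWithin_le_nhds (hc2.continuousAt.eventually (lt_mem_nhds (by simpa using hθs)))
  obtain ⟨η, ⟨hη1, hη2⟩, hη0⟩ := ((h2.and h3).and self_mem_nhdsWithin).exists
  replace hη0 : 0 < η := hη0
  refine absurd (h _ ⟨hη1, (1 - θ) • u + η • !₂[(0 : ℝ), 0, 1], circularCone_add ?_
    (circularCone_smul basis_mem_circularCone hη0), ?_⟩) (not_le.2 hη2)
  · have e : ((1 - θ) • u) 0 ^ 2 + ((1 - θ) • u) 1 ^ 2 = (1 - θ) ^ 2 * (u 0 ^ 2 + u 1 ^ 2) := by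
      simp only [PiLp.smul_apply, smul_eq_mul]; ring
    rw [e, Real.sqrt_mul (by positivity), Real.sqrt_sq (by linarith)]
    simp only [PiLp.smul_apply, smul_eq_mul]
    exact mul_le_mul_of_nonneg_left hu' (by linarith)
  · rw [map_add, map_smul, map_smul, hua, hx]; abel

end LightCone

namespace LightCone

open Set Filter Topology

variable {τ : ℝ}

/-! ### Enclosing hypercones and funnels -/

/-- The point sought is where the axis, followed backwards from the apex, leaves the ball. -/
theorem exists_outer_point (hτ : 0 < τ) (C : Hypercone τ) :
    ∃ q : Space, ‖q‖ = 1 ∧ ∃ t : ℝ, t < 1 ∧ ∀ v ∈ base C, ⟪q, v⟫_ℝ ≤ t := by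
  obtain ⟨a, L, ha, hK⟩ := isEllipticCone_base hτ C
  have hne : L (-!₂[(0 : ℝ), 0, 1]) ≠ 0 := by
    rw [Ne, LinearEquiv.map_eq_zero_iff, neg_eq_zero]
    intro h; have := norm_basis; rw [h] at this; simp at this
  have hq := norm_exitPoint ha hne
  have ht := exitTime_pos ha hne
  obtain ⟨s, h0, h1, hs⟩ := exists_cap_disjoint (a := a) (L := L) hq (by
    rintro ⟨u, hu, hua⟩
    have h2 : L u = L (exitTime a (L (-!₂[(0 : ℝ), 0, 1])) • (-!₂[(0 : ℝ), 0, 1])) := by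
      rw [hua, map_smul, exitPoint]; abel
    have h3 := L.injective h2
    rw [h3] at hu
    generalize exitTime a (L (-!₂[(0 : ℝ), 0, 1])) = r at *
    have h4 : √((r • (-!₂[(0 : ℝ), 0, 1]) : Space) 0 ^ 2 +
      (r • (-!₂[(0 : ℝ), 0, 1]) : Space) 1 ^ 2) ≤ (r • (-!₂[(0 : ℝ), 0, 1]) : Space) 2 := hu
    have h5 := (Real.sqrt_nonneg _).trans h4
    simp at h5
    linarith)
  exact ⟨_, hq, s, h1, fun v hv => hs v (hK ▸ hv)⟩

/-- The enclosing hypercone omits only a smaller cap at `q`. Room for `C` and for any double cone is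
thus left near every sphere point that has a cap avoiding `C`. -/
theorem exists_enclosing (hτ : 0 < τ) {q : Space} (hq : ‖q‖ = 1) {t : ℝ} (ht : t < 1)
    {C : Hypercone τ} (hC : ∀ v ∈ base C, ⟪q, v⟫_ℝ ≤ t) (O : DoubleCone) :
    ∃ D : Hypercone τ, C.region ⊆ D.region ∧ O.region ⊆ D.region ∧
      ∃ s : ℝ, t ≤ s ∧ 0 < s ∧ s < 1 ∧ ∀ v ∈ base D, ⟪q, v⟫_ℝ ≤ s := by
  obtain ⟨R, h0, h1, hR⟩ := exists_radius_region hτ O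
  have hm : max t R < 1 := max_lt ht h1
  have hmt := le_max_left t R
  have hmR := le_max_right t R
  obtain ⟨D, hD1, hD2⟩ := exists_hypercone_halfball hτ hq (s := (max t R + 1) / 2)
    (t := (max t R + 3) / 4) (by linarith) (by linarith) (by linarith)
  refine ⟨D, (region_subset_iff hτ).2 fun v hv => hD1 v hv.1 ?_, hR D fun v hv => hD1 v ?_ ?_,
    (max t R + 3) / 4, by linarith, by linarith, by linarith, fun v hv => (hD2 v hv).le⟩
  · linarith [hC v hv]
  · rw [mem_closedBall_zero_iff] at hv; linarith
  · rw [mem_closedBall_zero_iff] at hv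
    have := real_inner_le_norm q v
    rw [hq] at this; linarith

theorem sep_of_cap (hτ : 0 < τ) {q : Space} {s : ℝ} {C D : Hypercone τ} (hC : base C ⊆ cap q s)
    (hD : ∀ v ∈ base D, ⟪q, v⟫_ℝ ≤ s) : C.SpacelikeSep D :=
  (sep_iff hτ).2 (Set.disjoint_left.2 fun v hv hv' => absurd (hC hv).2 (not_lt.2 (hD v hv')))

theorem inner_le_of_sep (hτ : 0 < τ) {q : Space} {s : ℝ} {C D : Hypercone τ}
    (hC : cap q s ⊆ base C) (h : C.SpacelikeSep D) : ∀ v ∈ base D, ⟪q, v⟫_ℝ ≤ s := by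
  intro v hv
  by_contra hc
  exact Set.disjoint_left.1 ((sep_iff hτ).1 h) (hC ⟨hv.1, not_le.1 hc⟩) hv

/-- The cones have a fixed opening and apices `r n • q` moving outward to `q`. -/
theorem exists_funnel_in_cap (hτ : 0 < τ) {q : Space} (hq : ‖q‖ = 1) {s : ℝ} (hs : s < 1) :
    ∃ c : ℕ → Hypercone τ, IsFunnel c ∧ (∀ n, base (c n) ⊆ cap q s) ∧
      ∀ t < 1, ∃ n, base (c n) ⊆ cap q t := by
  set r : ℕ → ℝ := fun n => 1 - (1 - max s 0) * (1 / ((n : ℝ) + 1)) with hr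
  have hm : 0 < 1 - max s 0 := by have := max_lt hs one_pos; linarith
  have hm1 : 0 ≤ max s 0 := le_max_right _ _
  have hr1 : ∀ n, r n < 1 := fun n => by
    have : 0 < (1 - max s 0) * (1 / ((n : ℝ) + 1)) := by positivity
    simp only [hr]; linarith
  have hrm : ∀ n, max s 0 ≤ r n := fun n => by
    have h1 : 1 / ((n : ℝ) + 1) ≤ 1 := by
      rw [div_le_one (by positivity)]; linarith [n.cast_nonneg (α := ℝ)]
    simp only [hr]; nlinarith
  have hmono : ∀ n, r n ≤ r (n + 1) := fun n => by
    have : 1 / (((n + 1 : ℕ) : ℝ) + 1) ≤ 1 / ((n : ℝ) + 1) :=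
      one_div_le_one_div_of_le (by positivity) (by push_cast; linarith)
    simp only [hr]; nlinarith
  have hlim : Tendsto r atTop (𝓝 1) := by
    have := (tendsto_one_div_add_atTop_nhds_zero_nat (𝕜 := ℝ)).const_mul (1 - max s 0)
    simpa [hr] using this.const_sub 1
  have hE : ∀ n, IsEllipticCone {v | ‖v‖ < 1 ∧ (1 / 2) * ‖v - r n • q‖ < ⟪q, v⟫_ℝ - r n} :=
    fun n => exists_circular_cone hq (by norm_num) (by norm_num)
      (abs_lt.2 ⟨by linarith [hrm n], hr1 n⟩)
  set c : ℕ → Hypercone τ := fun n => Hypercone.ofBase τ _ (hE n) with hc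
  have hb : ∀ n, base (c n) = _ := fun n => base_ofBase hτ (hE n)
  have hcap : ∀ n, base (c n) ⊆ cap q (r n) := by
    intro n v hv
    rw [hb] at hv
    exact ⟨hv.1, by linarith [hv.2, norm_nonneg (v - r n • q)]⟩
  have hex : ∀ t < 1, ∃ n, base (c n) ⊆ cap q t := by
    intro t ht
    obtain ⟨n, hn⟩ := (hlim.eventually (lt_mem_nhds ht)).exists
    exact ⟨n, (hcap n).trans (cap_anti q hn.le)⟩
  refine ⟨c, isFunnel_of_bases hτ ?_ ?_, fun n => (hcap n).trans (cap_anti q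
    ((le_max_left _ _).trans (hrm n))), hex⟩
  · intro n v hv
    rw [hb] at hv ⊢
    refine ⟨hv.1, ?_⟩
    have h1 : ‖v - r n • q‖ ≤ ‖v - r (n + 1) • q‖ + (r (n + 1) - r n) := by
      have := norm_add_le (v - r (n + 1) • q) ((r (n + 1) - r n) • q)
      rw [norm_smul, hq, Real.norm_eq_abs, abs_of_nonneg (by linarith [hmono n])] at this
      rw [show v - r n • q = (v - r (n + 1) • q) + (r (n + 1) - r n) • q by module]
      linarith
    linarith [hv.2, hmono n]
  · intro R hR
    have h1 : max R 0 < 1 := max_lt hR one_pos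
    have h2 := le_max_left R 0
    have h3 := le_max_right R 0
    obtain ⟨D, hD1, hD2⟩ := exists_hypercone_halfball hτ hq (s := (max R 0 + 1) / 2)
      (t := (max R 0 + 3) / 4) (by linarith) (by linarith) (by linarith)
    obtain ⟨n, hn⟩ := hex ((max R 0 + 3) / 4) (by linarith)
    refine ⟨n, D, fun v hv => ?_, ?_⟩
    · rw [mem_closedBall_zero_iff] at hv
      have := real_inner_le_norm q v
      rw [hq] at this
      exact hD1 v (by linarith) (by linarith)
    · exact Set.disjoint_left.2 fun v hv hv' => absurd (hn hv').2 (not_lt.2 (hD2 v hv).le)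

theorem exists_sep (hτ : 0 < τ) (C : Hypercone τ) : ∃ D : Hypercone τ, D.SpacelikeSep C := by
  obtain ⟨q, hq, t, ht, hC⟩ := exists_outer_point hτ C
  obtain ⟨D, hD⟩ := exists_hypercone_in_cap hτ hq ht
  exact ⟨D, sep_of_cap hτ hD hC⟩

/-- Inside a hypercone `E` spacelike to `C` there is a funnel which leaves room for hypercones
that contain `C` and any given double cone. -/
theorem exists_funnel_enclosing (hτ : 0 < τ) {C E : Hypercone τ} (h : E.SpacelikeSep C) :
    ∃ c : ℕ → Hypercone τ, IsFunnel c ∧ (∀ n, (c n).region ⊆ E.region) ∧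
      ∀ O : DoubleCone, ∃ n, ∃ D : Hypercone τ, C.region ⊆ D.region ∧ O.region ⊆ D.region ∧
        (c n).SpacelikeSep D := by
  obtain ⟨q, hq, s, h0, h1, hs⟩ := exists_cap_subset_base hτ E
  obtain ⟨c, hc, hcs, hct⟩ := exists_funnel_in_cap hτ hq h1
  refine ⟨c, hc, fun n => (region_subset_iff hτ).2 ((hcs n).trans hs), fun O => ?_⟩
  obtain ⟨D, hCD, hOD, t, -, -, ht1, hD⟩ := exists_enclosing hτ hq h1 (inner_le_of_sep hτ hs h) O
  obtain ⟨n, hn⟩ := hct t ht1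
  exact ⟨n, D, hCD, hOD, sep_of_cap hτ hn hD⟩

theorem exists_enclosing_sep (hτ : 0 < τ) {C E : Hypercone τ} (h : E.SpacelikeSep C)
    (O : DoubleCone) : ∃ c D : Hypercone τ, c.region ⊆ E.region ∧ C.region ⊆ D.region ∧
      O.region ⊆ D.region ∧ c.SpacelikeSep D := by
  obtain ⟨c, -, hc, hO⟩ := exists_funnel_enclosing hτ h
  obtain ⟨n, D, h1, h2, h3⟩ := hO O
  exact ⟨c n, D, hc n, h1, h2, h3⟩

theorem IsFunnel.base_anti (hτ : 0 < τ) {c : ℕ → Hypercone τ} (hc : IsFunnel c) :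
    Antitone fun n => base (c n) :=
  antitone_nat_of_succ_le fun n => (region_subset_iff hτ).1 (hc.1 n)

/-- The bases of a funnel shrink to a point of the unit sphere. -/
theorem IsFunnel.exists_limit (hτ : 0 < τ) {c : ℕ → Hypercone τ} (hc : IsFunnel c) :
    ∃ p : Space, ‖p‖ = 1 ∧ ∀ s < 1, ∃ n, base (c n) ⊆ cap p s := by
  choose k hk using fun n => base_nonempty hτ (c n)
  have hanti := hc.base_anti hτ
  have key : ∀ s < 1, ∃ n, ∀ x ∈ base (c n), ∀ y ∈ base (c n), s < ⟪x, y⟫_ℝ := by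
    intro s hs
    set R := 1 - (1 - max s 0) / 8 with hR
    have hm := max_lt hs (one_pos)
    have hm0 := le_max_right s 0
    have hms := le_max_left s 0
    obtain ⟨n, hn⟩ := hc.exists_disjoint hτ (R := R) (by linarith)
    refine ⟨n, fun x hx y hy => ?_⟩
    -- By convexity the midpoint of two base points also avoids the ball of radius `R`; a midpoint
    -- of norm close to `1` forces the two points to be close to each other.
    have hmid := (isEllipticCone_base hτ (c n)).convex hx hy (a := 1 / 2) (b := 1 / 2)
      (by norm_num) (by norm_num) (by norm_num)
    have h1 : R < ‖(1 / 2 : ℝ) • x + (1 / 2 : ℝ) • y‖ := by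
      by_contra hcon
      exact Set.disjoint_left.1 hn hmid (by
        rw [mem_closedBall_zero_iff]; exact not_lt.1 hcon)
    rw [← smul_add, norm_smul] at h1
    have h2 : 2 * R < ‖x + y‖ := by norm_num at h1; linarith
    have h3 := norm_add_sq_real x y
    nlinarith [hx.1, hy.1, norm_nonneg x, norm_nonneg y]
  obtain ⟨p, -, φ, hφ, hp⟩ := (isCompact_closedBall (0 : Space) 1).tendsto_subseq
    (x := k) (fun n => by rw [mem_closedBall_zero_iff]; exact (hk n).1.le)
  have key2 : ∀ s < 1, ∃ n, ∀ x ∈ base (c n), s ≤ ⟪p, x⟫_ℝ := by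
    intro s hs
    obtain ⟨n, hn⟩ := key s hs
    refine ⟨n, fun x hx => ?_⟩
    have hl : Tendsto (fun m => ⟪(k ∘ φ) m, x⟫_ℝ) atTop (𝓝 ⟪p, x⟫_ℝ) :=
      hp.inner tendsto_const_nhds
    refine ge_of_tendsto hl ?_
    filter_upwards [eventually_ge_atTop n] with m hm
    exact (hn _ (hanti (hm.trans (hφ.id_le m)) (hk _)) x hx).le
  have hp1 : ‖p‖ ≤ 1 := by
    refine le_of_tendsto hp.norm (Eventually.of_forall fun m => (hk _).1.le)
  have hp2 : 1 ≤ ‖p‖ := by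
    by_contra hcon
    rw [not_le] at hcon
    obtain ⟨n, hn⟩ := key2 ((1 + ‖p‖) / 2) (by linarith)
    have h1 := hn _ (hk n)
    have h2 := real_inner_le_norm p (k n)
    nlinarith [(hk n).1, norm_nonneg p]
  refine ⟨p, le_antisymm hp1 hp2, fun s hs => ?_⟩
  obtain ⟨n, hn⟩ := key2 ((1 + s) / 2) (by linarith)
  exact ⟨n, fun x hx => ⟨hx.1, by linarith [hn x hx]⟩⟩

/-- A hypercone is contained in a larger one, such that every funnel entering the complement of
the latter leaves room for hypercones that contain the former and any given double cone. -/
theorem exists_enlargement (hτ : 0 < τ) (C : Hypercone τ) :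
    ∃ C' : Hypercone τ, C.region ⊆ C'.region ∧ ∀ c : ℕ → Hypercone τ, IsFunnel c →
      (∃ m, (c m).SpacelikeSep C') → ∀ O : DoubleCone, ∃ n, ∃ D : Hypercone τ,
        C.region ⊆ D.region ∧ O.region ⊆ D.region ∧ (c n).SpacelikeSep D := by
  obtain ⟨q, hq, t', ht', hCt'⟩ := exists_outer_point hτ C
  set t := max t' 0 with htdef
  have ht : t < 1 := max_lt ht' one_pos
  have ht0 : 0 ≤ t := le_max_right _ _
  have hC : ∀ v ∈ base C, ⟪q, v⟫_ℝ ≤ t := fun v hv => (hCt' v hv).trans (le_max_left _ _)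
  -- A funnel in the complement of `C` alone could converge to a sphere point touching the closure
  -- of the base of `C`. The margin between the heights `t` and `(t + 1) / 2` excludes this.
  obtain ⟨D, hD1, -⟩ := exists_hypercone_halfball hτ hq (s := (t + 1) / 2)
    (t := (t + 3) / 4) (by linarith) (by linarith) (by linarith)
  refine ⟨D, (region_subset_iff hτ).2 fun v hv => hD1 v hv.1 (by linarith [hC v hv]), ?_⟩
  rintro c hc ⟨m, hm⟩ O
  obtain ⟨p, hp, hpc⟩ := hc.exists_limit hτ
  have hqp : t < ⟪q, p⟫_ℝ := by
    by_contra hcon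
    obtain ⟨s, -, hs1, hs⟩ := exists_cap_subset_cap (n := -q) (s := -((t + 1) / 2)) hp (by
      rw [inner_neg_left]; linarith)
    obtain ⟨n, hn⟩ := hpc s hs1
    obtain ⟨x, hx⟩ := base_nonempty hτ (c (max m n))
    have h1 := (hs (hn (hc.base_anti hτ (le_max_right m n) hx))).2
    rw [inner_neg_left] at h1
    exact Set.disjoint_left.1 ((sep_iff hτ).1 hm) (hc.base_anti hτ (le_max_left m n) hx)
      (hD1 x hx.1 (by linarith))
  obtain ⟨s, -, hs1, hs⟩ := exists_cap_subset_cap hp hqp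
  obtain ⟨D', h1, h2, r, -, -, hr1, hr⟩ := exists_enclosing hτ hp hs1 (C := C) (fun v hv => by
    by_contra hcon
    exact absurd (hs ⟨hv.1, not_le.1 hcon⟩).2 (not_lt.2 (hC v hv))) O
  obtain ⟨n, hn⟩ := hpc r hr1
  exact ⟨n, D', h1, h2, sep_of_cap hτ hn hr⟩

/-- Two hypercones contain hypercones lying in a common one. -/
theorem exists_common_enclosing (hτ : 0 < τ) (C C' : Hypercone τ) :
    ∃ b b' D : Hypercone τ, b.region ⊆ C.region ∧ b'.region ⊆ C'.region ∧
      b.region ⊆ D.region ∧ b'.region ⊆ D.region := by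
  obtain ⟨q, hq, s, h0, h1, hs⟩ := exists_cap_subset_base hτ C
  obtain ⟨q', hq', s', h0', h1', hs'⟩ := exists_cap_subset_base hτ C'
  -- A ball without a small cap at a third point `p` contains small caps at both `q` and `q'`.
  obtain ⟨p, hp, hpF⟩ := exists_unit_notMem {q, q'} (by simp)
  simp only [mem_insert_iff, mem_singleton_iff, not_or] at hpF
  have i1 := inner_lt_one hp hq hpF.1
  have i2 := inner_lt_one hp hq' hpF.2
  set t := max (max ⟪p, q⟫_ℝ ⟪p, q'⟫_ℝ) 0 with ht
  have ht1 : t < 1 := max_lt (max_lt i1 i2) one_pos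
  have ht0 : 0 ≤ t := le_max_right _ _
  have j1 : ⟪p, q⟫_ℝ ≤ t := (le_max_left _ _).trans (le_max_left _ _)
  have j2 : ⟪p, q'⟫_ℝ ≤ t := (le_max_right _ _).trans (le_max_left _ _)
  obtain ⟨D, hD1, -⟩ := exists_hypercone_halfball hτ hp (s := (t + 1) / 2)
    (t := (t + 3) / 4) (by linarith) (by linarith) (by linarith)
  have aux : ∀ (x : Space) (r : ℝ) (E : Hypercone τ), ‖x‖ = 1 → ⟪p, x⟫_ℝ ≤ t → r < 1 →
      cap x r ⊆ base E → ∃ b : Hypercone τ, b.region ⊆ E.region ∧ b.region ⊆ D.region := by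
    intro x r E hx hxt hr hE
    obtain ⟨u, -, hu1, hu⟩ := exists_cap_subset_cap (n := -p) (s := -((t + 1) / 2)) hx (by
      rw [inner_neg_left]; linarith)
    obtain ⟨b, hb⟩ := exists_hypercone_in_cap hτ hx (max_lt hu1 hr)
    refine ⟨b, (region_subset_iff hτ).2 ((hb.trans (cap_anti x (le_max_right _ _))).trans hE),
      (region_subset_iff hτ).2 fun v hv => hD1 v hv.1 ?_⟩
    have := (hu (cap_anti x (le_max_left _ _) (hb hv))).2
    rw [inner_neg_left] at this; linarith
  obtain ⟨b, hb1, hb2⟩ := aux q s C hq j1 h1 hs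
  obtain ⟨b', hb1', hb2'⟩ := aux q' s' C' hq' j2 h1' hs'
  exact ⟨b, b', D, hb1, hb1', hb2, hb2'⟩

theorem exists_hypercone (hτ : 0 < τ) : ∃ _ : Hypercone τ, True :=
  let ⟨C, _⟩ := exists_hypercone_in_cap hτ norm_basis (zero_lt_one)
  ⟨C, trivial⟩

/-- Three pairwise spacelike separated hypercones, the first two in a common hypercone separated
from the third one. -/
theorem exists_triple (hτ : 0 < τ) : ∃ a b c D : Hypercone τ, a.SpacelikeSep b ∧
    c.SpacelikeSep D ∧ a.region ⊆ D.region ∧ b.region ⊆ D.region := by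
  obtain ⟨C, -⟩ := exists_hypercone hτ
  obtain ⟨b, hb⟩ := exists_sep hτ C
  obtain ⟨a', b', D, h1, h2, h3, h4⟩ := exists_common_enclosing hτ C b
  obtain ⟨c, hc⟩ := exists_sep hτ D
  exact ⟨a', b', c, D, sep_mono hτ (sep_symm hτ hb) h1 h2, hc, h3, h4⟩

/-- The common spacelike complement of two spacelike separated hypercones contains a
hypercone. -/
theorem exists_common_sep (hτ : 0 < τ) {A B : Hypercone τ} (h : A.SpacelikeSep B) :
    ∃ C : Hypercone τ, C.SpacelikeSep A ∧ C.SpacelikeSep B := by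
  have hA := isEllipticCone_base hτ A
  have hB := isEllipticCone_base hτ B
  obtain ⟨f, u, hfA, hfB⟩ := geometric_hahn_banach_open_open hA.convex hA.isOpen hB.convex
    hB.isOpen ((sep_iff hτ).1 h)
  obtain ⟨a, L, ha, hK⟩ := hA
  set y := (InnerProductSpace.toDual ℝ Space).symm
    (f.comp (L.toContinuousLinearEquiv : Space →L[ℝ] Space)) with hy
  have hyf : ∀ x, f (L x) = y 0 * x 0 + y 1 * x 1 + y 2 * x 2 := by
    intro x
    have := InnerProductSpace.toDual_symm_apply (𝕜 := ℝ) (x := x)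
      (y := f.comp (L.toContinuousLinearEquiv : Space →L[ℝ] Space))
    rw [← hy] at this
    rw [show f (L x) = ⟪y, x⟫_ℝ from this.symm]
    simp [PiLp.inner_apply, Fin.sum_univ_three]
    ring
  -- In coordinates where `A` has the standard circular directions, a direction is needed that stays
  -- on the side of `A` of the separating plane but leaves the closed cone; the witness depends on
  -- the normal `y` of the plane.
  have hex : ∃ x : Space, f (L x) < 0 ∧ ¬ √(x 0 ^ 2 + x 1 ^ 2) ≤ x 2 := by
    by_cases h2 : 0 < y 2
    · refine ⟨!₂[0, 0, -1], by rw [hyf]; simpa using h2, by simp⟩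
    by_cases h01 : y 0 = 0 ∧ y 1 = 0
    · refine ⟨!₂[2, 0, 1], ?_, ?_⟩
      · rw [hyf]
        simp only [h01.1, h01.2]
        simp
        refine lt_of_le_of_ne (not_lt.1 h2) fun h2' => ?_
        have hz : ∀ x, f x = 0 := fun x => by
          rw [← L.apply_symm_apply x, hyf, h01.1, h01.2, h2']; ring
        obtain ⟨x, hx⟩ := base_nonempty hτ A
        obtain ⟨x', hx'⟩ := base_nonempty hτ B
        have e1 := hfA x hx
        have e2 := hfB x' hx'
        rw [hz] at e1 e2
        linarith
      · simp
    · refine ⟨!₂[-y 0, -y 1, 0], ?_, ?_⟩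
      · rw [hyf]
        simp
        rw [not_and_or] at h01
        rcases h01 with h0 | h0 <;> have := mul_self_pos.2 h0
        · nlinarith [mul_self_nonneg (y 1)]
        · nlinarith [mul_self_nonneg (y 0)]
      · simp
        rw [not_and_or] at h01
        rcases h01 with h0 | h0 <;> positivity
  obtain ⟨x, hx1, hx2⟩ := hex
  -- The apex is a limit of points of the cone along its axis.
  have hfa : f a ≤ u := by
    have hcont : Continuous fun r : ℝ => f (a + r • L !₂[(0 : ℝ), 0, 1]) := by fun_prop
    have hcn : Continuous fun r : ℝ => ‖a + r • L !₂[(0 : ℝ), 0, 1]‖ := by fun_prop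
    have ht : Tendsto (fun r : ℝ => f (a + r • L !₂[(0 : ℝ), 0, 1])) (𝓝[>] 0) (𝓝 (f a)) := by
      have := hcont.tendsto 0
      simp only [zero_smul, add_zero] at this
      exact this.mono_left nhdsWithin_le_nhds
    refine le_of_tendsto ht ?_
    have h1 : ∀ᶠ r : ℝ in 𝓝[>] 0, ‖a + r • L !₂[(0 : ℝ), 0, 1]‖ < 1 :=
      nhdsWithin_le_nhds (hcn.continuousAt.eventually (gt_mem_nhds (by simpa using ha)))
    filter_upwards [h1, self_mem_nhdsWithin] with r hr hr0
    refine (hfA _ ?_).le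
    rw [hK]
    exact ⟨hr, _, circularCone_smul basis_mem_circularCone hr0, by rw [map_smul]; abel⟩
  have hne : L x ≠ 0 := by
    intro h0; rw [h0, map_zero] at hx1; exact lt_irrefl _ hx1
  have hq := norm_exitPoint ha hne
  have ht := exitTime_pos ha hne
  obtain ⟨s, -, hs1, hs⟩ := exists_cap_disjoint (a := a) (L := L) hq (by
    rintro ⟨v, hv, hva⟩
    have h2 : L v = L (exitTime a (L x) • x) := by
      rw [hva, map_smul, exitPoint]; abel
    have h3 := L.injective h2
    generalize exitTime a (L x) = r at *
    have h4 : √(v 0 ^ 2 + v 1 ^ 2) ≤ v 2 := hv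
    rw [h3] at h4
    have e : (r • x) 0 ^ 2 + (r • x) 1 ^ 2 = r ^ 2 * (x 0 ^ 2 + x 1 ^ 2) := by
      simp only [PiLp.smul_apply, smul_eq_mul]; ring
    rw [e, Real.sqrt_mul (by positivity), Real.sqrt_sq ht.le] at h4
    simp only [PiLp.smul_apply, smul_eq_mul] at h4
    exact hx2 (le_of_mul_le_mul_left h4 ht))
  -- The exit point is outside the closed cone of `A` and strictly on the side of the plane opposite
  -- to `B`, so a small cap there avoids both.
  have hfq : f (exitPoint a (L x)) < u := by
    rw [exitPoint, map_add, map_smul, smul_eq_mul]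
    have := mul_neg_of_pos_of_neg ht hx1
    linarith
  obtain ⟨s', -, hs1', hs'⟩ := exists_cap_subset hq
    (f.continuous.continuousAt.eventually (gt_mem_nhds hfq) : {v | f v < u} ∈ 𝓝 _)
  obtain ⟨C, hC⟩ := exists_hypercone_in_cap hτ hq (max_lt hs1 hs1')
  refine ⟨C, sep_of_cap hτ hC fun v hv => (hs v (hK ▸ hv)).trans (le_max_left _ _),
    sep_of_cap hτ hC fun v hv => ?_⟩
  by_contra hcon
  have h3 := hs' v hv.1.le ((le_max_right _ _).trans_lt (not_le.1 hcon))
  exact absurd (hfB v hv) (not_lt.2 (le_of_lt h3))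

/-- The set of sphere points outside the closure of a hypercone is connected: an equivalence
relation between hypercones which holds whenever they lie in a hypercone that leaves room for a
hypercone containing `C` and `O` holds for small hypercones at any place outside `C`. -/
theorem exists_rel_of_sep (hτ : 0 < τ) (C : Hypercone τ) (O : DoubleCone)
    (R : Hypercone τ → Hypercone τ → Prop) (hsymm : ∀ c c', R c c' → R c' c)
    (htrans : ∀ c c' c'', R c c' → R c' c'' → R c c'')
    (hR : ∀ c c' e D : Hypercone τ, c.region ⊆ e.region → c'.region ⊆ e.region →
      e.SpacelikeSep D → C.region ⊆ D.region → O.region ⊆ D.region → R c c')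
    {c c' : Hypercone τ} (hc : c.SpacelikeSep C) (hc' : c'.SpacelikeSep C) :
    ∃ b b' : Hypercone τ, b.region ⊆ c.region ∧ b'.region ⊆ c'.region ∧ R b b' := by
  obtain ⟨a, L, ha, hK⟩ := isEllipticCone_base hτ C
  set F : Set Space := {u : Space | √(u 0 ^ 2 + u 1 ^ 2) ≤ u 2} with hF
  set N : Set Space := L '' Fᶜ with hN
  have hNnot : ∀ w ∈ N, ∀ r : ℝ, 0 < r → r • w ∉ L '' F := by
    rintro _ ⟨x, hx, rfl⟩ r hr ⟨v, hv, hvx⟩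
    rw [← map_smul] at hvx
    rw [L.injective hvx] at hv
    have h4 : √((r • x) 0 ^ 2 + (r • x) 1 ^ 2) ≤ (r • x) 2 := hv
    have e : (r • x) 0 ^ 2 + (r • x) 1 ^ 2 = r ^ 2 * (x 0 ^ 2 + x 1 ^ 2) := by
      simp only [PiLp.smul_apply, smul_eq_mul]; ring
    rw [e, Real.sqrt_mul (by positivity), Real.sqrt_sq hr.le] at h4
    simp only [PiLp.smul_apply, smul_eq_mul] at h4
    exact hx (le_of_mul_le_mul_left h4 hr)
  have hN0 : ∀ w ∈ N, w ≠ 0 := by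
    rintro _ ⟨x, hx, rfl⟩ h0
    rw [LinearEquiv.map_eq_zero_iff] at h0
    apply hx
    rw [h0]
    simp [hF]
  -- The complement of the closed circular cone is star-shaped about the negative axis, and `L`
  -- preserves connectedness.
  have hNconn : IsPreconnected N := by
    have hstar : StarConvex ℝ (-!₂[(0 : ℝ), 0, 1]) Fᶜ := by
      rw [starConvex_iff_forall_pos (by simp [hF])]
      intro x hx α β hα hβ _ hmem
      have h4 : √((α • (-!₂[(0 : ℝ), 0, 1]) + β • x : Space) 0 ^ 2 +
        (α • (-!₂[(0 : ℝ), 0, 1]) + β • x : Space) 1 ^ 2) ≤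
        (α • (-!₂[(0 : ℝ), 0, 1]) + β • x : Space) 2 := hmem
      have e : (α • (-!₂[(0 : ℝ), 0, 1]) + β • x : Space) 0 ^ 2 +
        (α • (-!₂[(0 : ℝ), 0, 1]) + β • x : Space) 1 ^ 2 = β ^ 2 * (x 0 ^ 2 + x 1 ^ 2) := by
        simp; ring
      rw [e, Real.sqrt_mul (by positivity), Real.sqrt_sq hβ.le] at h4
      simp at h4
      have h5 : β * √(x 0 ^ 2 + x 1 ^ 2) ≤ β * x 2 := by linarith
      exact hx (le_of_mul_le_mul_left h5 hβ)
    have := (hstar.isPathConnected (by simp [hF])).isConnected.isPreconnected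
    exact this.image _ L.toContinuousLinearEquiv.continuous.continuousOn
  have houter : ∀ w ∈ N, ∃ s : ℝ, s < 1 ∧ ∀ v ∈ base C, ⟪exitPoint a w, v⟫_ℝ ≤ s := by
    intro w hw
    obtain ⟨s, -, h1, hs⟩ := exists_cap_disjoint (a := a) (L := L)
      (norm_exitPoint ha (hN0 w hw)) (by
        rw [exitPoint, add_sub_cancel_left]
        exact hNnot w hw _ (exitTime_pos ha (hN0 w hw)))
    exact ⟨s, h1, fun v hv => hs v (hK ▸ hv)⟩
  -- The relation is passed from hypercones to directions by shrinking hypercones to exit points; it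
  -- is locally true, symmetric and transitive, hence global on the connected set `N`.
  let S : Space → Space → Prop := fun w w' => ∃ s < 1, ∀ c c' : Hypercone τ,
    base c ⊆ cap (exitPoint a w) s → base c' ⊆ cap (exitPoint a w') s → R c c'
  have hS : ∀ w ∈ N, ∀ w' ∈ N, S w w' := by
    intro w hw w' hw'
    refine hNconn.induction₂ S ?_ ?_ ?_ hw hw'
    · intro x hx
      have hq := norm_exitPoint ha (hN0 x hx)
      obtain ⟨s, hs1, hs⟩ := houter x hx
      -- Local validity: all hypercones near the exit point of `x` lie in one hypercone `e`, which
      -- is separated from an enclosure `D` of `C` and `O`.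
      obtain ⟨D, hCD, hOD, t, -, ht0, ht1, hD⟩ := exists_enclosing hτ hq hs1 hs O
      obtain ⟨e, he1, he2⟩ := exists_hypercone_between hτ hq (s := t) (t := (t + 1) / 2)
        (by linarith) ht1 (by linarith)
      have hsep : e.SpacelikeSep D := sep_of_cap hτ he2 hD
      have hnear : ∀ᶠ y in 𝓝[N] x, ‖exitPoint a y - exitPoint a x‖ < (1 - t) / 4 := by
        have := (continuousAt_exitPoint a (hN0 x hx)).eventually
          (Metric.ball_mem_nhds _ (show 0 < (1 - t) / 4 by linarith))
        filter_upwards [nhdsWithin_le_nhds this] with y hy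
        rwa [dist_eq_norm] at hy
      filter_upwards [hnear] with y hy
      refine ⟨(t + 3) / 4, by linarith, fun c c' h1 h2 => ?_⟩
      refine hR c c' e D ?_ ?_ hsep hCD hOD
      · exact (region_subset_iff hτ).2 ((h1.trans (cap_anti _ (by linarith))).trans he1)
      · refine (region_subset_iff hτ).2 (Subset.trans (b := cap (exitPoint a x) ((t + 1) / 2)) (fun v hv => ⟨hv.1, ?_⟩) he1)
        have h3 := (h2 hv).2
        have h4 := (real_inner_le_norm (exitPoint a y - exitPoint a x) v)
        rw [inner_sub_left] at h4
        nlinarith [hv.1, norm_nonneg v, norm_nonneg (exitPoint a y - exitPoint a x)]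
    · rintro x y z - hy - ⟨s, hs1, hs⟩ ⟨t, ht1, ht⟩
      refine ⟨max s t, max_lt hs1 ht1, fun c c' h1 h2 => ?_⟩
      obtain ⟨d, hd⟩ := exists_hypercone_in_cap hτ (norm_exitPoint ha (hN0 y hy)) (max_lt hs1 ht1)
      exact htrans c d c' (hs c d (h1.trans (cap_anti _ (le_max_left _ _)))
        (hd.trans (cap_anti _ (le_max_left _ _)))) (ht d c' (hd.trans (cap_anti _
        (le_max_right _ _))) (h2.trans (cap_anti _ (le_max_right _ _))))
    · rintro x y - - ⟨s, hs1, hs⟩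
      exact ⟨s, hs1, fun c c' h1 h2 => hsymm _ _ (hs c' c h2 h1)⟩
  have hpt : ∀ d : Hypercone τ, d.SpacelikeSep C → ∃ w ∈ N, ∃ s < 1,
      cap (exitPoint a w) s ⊆ base d ∧ ‖exitPoint a w‖ = 1 := by
    intro d hd
    obtain ⟨q, hq, s, h0, h1, hs⟩ := exists_cap_subset_base hτ d
    have hnot := notMem_closedCone ha (L := L) hq h1 (by
      rw [← hK]; exact inner_le_of_sep hτ hs hd)
    refine ⟨q - a, ?_, s, h1, ?_⟩
    · obtain ⟨x, hx⟩ := L.surjective (q - a)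
      exact ⟨x, fun hxF => hnot ⟨x, hxF, hx⟩, hx⟩
    · rw [exitPoint_sub ha hq]; exact ⟨hs, hq⟩
  obtain ⟨w, hw, s, hs1, hs, hq⟩ := hpt c hc
  obtain ⟨w', hw', s', hs1', hs', hq'⟩ := hpt c' hc'
  obtain ⟨t, ht1, ht⟩ := hS w hw w' hw'
  obtain ⟨b, hb⟩ := exists_hypercone_in_cap hτ hq (max_lt hs1 ht1)
  obtain ⟨b', hb'⟩ := exists_hypercone_in_cap hτ hq' (max_lt hs1' ht1)
  exact ⟨b, b', (region_subset_iff hτ).2 ((hb.trans (cap_anti _ (le_max_left _ _))).trans hs),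
    (region_subset_iff hτ).2 ((hb'.trans (cap_anti _ (le_max_left _ _))).trans hs'),
    ht b b' (hb.trans (cap_anti _ (le_max_right _ _))) (hb'.trans (cap_anti _ (le_max_right _ _)))⟩

end LightCone

namespace LightCone

open Set Filter Topology

variable {τ : ℝ}

/-! ### Connectedness of the configurations of three spacelike separated hypercones -/

/-- A relation between three hypercones holds for all small hypercones at the points `p`, `q`,
`r` of the unit sphere. -/
def HoldsNear (Q : Hypercone τ → Hypercone τ → Hypercone τ → Prop) (p q r : Space) : Prop :=
  ∃ s < 1, ∀ a b c : Hypercone τ, base a ⊆ cap p s → base b ⊆ cap q s → base c ⊆ cap r s → Q a b c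

/-- A plane strictly separating the two chords cuts the ball; a wide cone approximating the half
containing `p` and `p'` serves as `e`. -/
theorem exists_separating_hypercone (hτ : 0 < τ) {p p' q r : Space} (hp : ‖p‖ = 1) (hp' : ‖p'‖ = 1)
    (hq : ‖q‖ = 1) (hr : ‖r‖ = 1) (h : Disjoint (segment ℝ q r) (segment ℝ p p')) :
    ∃ e : Hypercone τ, ∃ s < 1, cap p s ⊆ base e ∧ cap p' s ⊆ base e ∧
      Disjoint (base e) (cap q s) ∧ Disjoint (base e) (cap r s) := by
  have hcomp : ∀ x y : Space, IsCompact (segment ℝ x y) := fun x y => by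
    rw [segment_eq_image]
    exact isCompact_Icc.image (by fun_prop)
  obtain ⟨f, u, v, hu, huv, hv⟩ := geometric_hahn_banach_compact_closed (convex_segment q r)
    (hcomp q r) (convex_segment p p') (hcomp p p').isClosed h
  set y := (InnerProductSpace.toDual ℝ Space).symm f with hy
  have hyf : ∀ x, f x = ⟪y, x⟫_ℝ := fun x => InnerProductSpace.toDual_symm_apply.symm
  have hne : 0 < ‖y‖ := by
    rw [norm_pos_iff]
    intro h0
    have h1 := hu q (left_mem_segment ℝ q r)
    have h2 := hv p (left_mem_segment ℝ p p')
    rw [hyf, h0, inner_zero_left] at h1 h2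
    linarith
  set n : Space := ‖y‖⁻¹ • y with hn
  have hn1 : ‖n‖ = 1 := by rw [hn, norm_smul, norm_inv, norm_norm, inv_mul_cancel₀ hne.ne']
  have hnx : ∀ x, ⟪n, x⟫_ℝ = f x / ‖y‖ := fun x => by
    rw [hn, real_inner_smul_left, hyf]; ring
  have hlow : ∀ x, f x < u → ⟪n, x⟫_ℝ < u / ‖y‖ := fun x hx => by
    rw [hnx]; exact div_lt_div_of_pos_right hx hne
  have hhigh : ∀ x, v < f x → v / ‖y‖ < ⟪n, x⟫_ℝ := fun x hx => by
    rw [hnx]; exact div_lt_div_of_pos_right hx hne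
  have huv' : u / ‖y‖ < v / ‖y‖ := div_lt_div_of_pos_right huv hne
  generalize u / ‖y‖ = u' at *
  generalize v / ‖y‖ = v' at *
  have hq' := hlow q (hu q (left_mem_segment ℝ q r))
  have hr' := hlow r (hu r (right_mem_segment ℝ q r))
  have hpn := hhigh p (hv p (left_mem_segment ℝ p p'))
  have hpn' := hhigh p' (hv p' (right_mem_segment ℝ p p'))
  have habs : ∀ x : Space, ‖x‖ = 1 → -1 ≤ ⟪n, x⟫_ℝ ∧ ⟪n, x⟫_ℝ ≤ 1 := fun x hx =>
    abs_le.1 (by simpa [hn1, hx] using abs_real_inner_le_norm n x)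
  obtain ⟨e, he1, he2⟩ := exists_hypercone_between hτ hn1 (s := u') (t := v')
    (by linarith [(habs q hq).1]) (by linarith [(habs p hp).2]) huv'
  obtain ⟨s1, -, hs1, h1⟩ := exists_cap_subset_cap hp hpn
  obtain ⟨s2, -, hs2, h2⟩ := exists_cap_subset_cap hp' hpn'
  obtain ⟨s3, -, hs3, h3⟩ := exists_cap_subset_cap (n := -n) (s := -u') hq (by
    rw [inner_neg_left]; linarith)
  obtain ⟨s4, -, hs4, h4⟩ := exists_cap_subset_cap (n := -n) (s := -u') hr (by
    rw [inner_neg_left]; linarith)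
  have hdis : ∀ x s, cap x s ⊆ cap (-n) (-u') → Disjoint (base e) (cap x s) := fun x s hx =>
    Set.disjoint_left.2 fun z hz hz' => by
      have i1 := (he2 hz).2
      have i2 := (hx hz').2
      rw [inner_neg_left] at i2
      linarith
  refine ⟨e, max (max s1 s2) (max s3 s4), max_lt (max_lt hs1 hs2) (max_lt hs3 hs4), ?_, ?_, ?_, ?_⟩
  · exact ((cap_anti p ((le_max_left s1 s2).trans (le_max_left _ _))).trans h1).trans he1
  · exact ((cap_anti p' ((le_max_right s1 s2).trans (le_max_left _ _))).trans h2).trans he1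
  · exact (hdis q s3 h3).mono_right (cap_anti q ((le_max_left s3 s4).trans (le_max_right _ _)))
  · exact (hdis r s4 h4).mono_right (cap_anti r ((le_max_right s3 s4).trans (le_max_right _ _)))

/-- Strict convexity of the ball. -/
theorem notMem_segment {p q r : Space} (hp : ‖p‖ = 1) (hq : ‖q‖ = 1) (hr : ‖r‖ = 1) (hpq : p ≠ q)
    (hpr : p ≠ r) : p ∉ segment ℝ q r := by
  rintro ⟨α, β, hα, hβ, hαβ, h⟩
  have h1 : α * ⟪p, q⟫_ℝ + β * ⟪p, r⟫_ℝ = 1 := by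
    rw [← real_inner_smul_right, ← real_inner_smul_right, ← inner_add_right, h,
      real_inner_self_eq_norm_sq, hp, one_pow]
  have h2 := inner_lt_one hp hq hpq
  have h3 := inner_lt_one hp hr hpr
  rcases hα.eq_or_lt with h0 | h0
  · subst h0; nlinarith
  · nlinarith

/-- A point of the sphere from which both `p` and `p'` can be reached on great circles' chords
avoiding the chord from `q` to `r`. -/
theorem exists_intermediate {p p' q r : Space} (hp : ‖p‖ = 1) (hp' : ‖p'‖ = 1)
    (hq : ‖q‖ = 1) (hr : ‖r‖ = 1) (hpq : p ≠ q) (hpr : p ≠ r) (hpq' : p' ≠ q) (hpr' : p' ≠ r) :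
    ∃ x : Space, ‖x‖ = 1 ∧ Disjoint (segment ℝ q r) (segment ℝ p x) ∧
      Disjoint (segment ℝ q r) (segment ℝ x p') := by
  by_cases hd : Disjoint (segment ℝ q r) (segment ℝ p p')
  · exact ⟨p', hp', hd, by
      rw [segment_same]
      exact Set.disjoint_singleton_right.2 (notMem_segment hp' hq hr hpq' hpr')⟩
  -- If the chords meet, all four points lie in the plane through `p`, `q`, `r` with normal `n`. A
  -- detour over a sphere point `x` off this plane avoids the chord from `q` to `r`.
  obtain ⟨n, hn, hn0⟩ : ∃ n ∈ (Submodule.span ℝ ({q - p, r - p} : Set Space))ᗮ, n ≠ 0 := by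
    apply Submodule.exists_mem_ne_zero_of_ne_bot
    intro hbot
    have h1 := Submodule.finrank_add_finrank_orthogonal
      (Submodule.span ℝ ({q - p, r - p} : Set Space))
    rw [hbot, finrank_bot, finrank_euclideanSpace, Fintype.card_fin] at h1
    have h2 := finrank_span_le_card (R := ℝ) ({q - p, r - p} : Set Space)
    have h3 : ({q - p, r - p} : Set Space).toFinset.card ≤ 2 := by
      rw [Set.toFinset_insert, Set.toFinset_singleton]
      exact Finset.card_le_two
    omega
  have hnq : ⟪n, q⟫_ℝ = ⟪n, p⟫_ℝ := by
    have := (Submodule.mem_orthogonal' _ _).1 hn (q - p) (Submodule.subset_span (by simp))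
    rw [inner_sub_right] at this; linarith
  have hnr : ⟪n, r⟫_ℝ = ⟪n, p⟫_ℝ := by
    have := (Submodule.mem_orthogonal' _ _).1 hn (r - p) (Submodule.subset_span (by simp))
    rw [inner_sub_right] at this; linarith
  have hseg : ∀ z ∈ segment ℝ q r, ⟪n, z⟫_ℝ = ⟪n, p⟫_ℝ := by
    rintro z ⟨α, β, -, -, hαβ, rfl⟩
    rw [inner_add_right, real_inner_smul_right, real_inner_smul_right, hnq, hnr, ← add_mul, hαβ,
      one_mul]
  have hnp' : ⟪n, p'⟫_ℝ = ⟪n, p⟫_ℝ := by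
    obtain ⟨z, hz, hz'⟩ := Set.not_disjoint_iff.1 hd
    have h1 := hseg z hz
    obtain ⟨α, β, hα, hβ, hαβ, rfl⟩ := hz'
    rw [inner_add_right, real_inner_smul_right, real_inner_smul_right] at h1
    have hβ0 : β ≠ 0 := by
      rintro rfl
      rw [add_zero] at hαβ
      subst hαβ
      rw [one_smul, zero_smul, add_zero] at hz
      exact notMem_segment hp hq hr hpq hpr hz
    have h2 : β * (⟪n, p'⟫_ℝ - ⟪n, p⟫_ℝ) = 0 := by
      have : α = 1 - β := by linarith
      rw [this] at h1; linarith
    have := (mul_eq_zero.1 h2).resolve_left hβ0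
    linarith
  have hnn : 0 < ‖n‖ := norm_pos_iff.2 hn0
  obtain ⟨x, hx, hnx⟩ : ∃ x : Space, ‖x‖ = 1 ∧ ⟪n, x⟫_ℝ ≠ ⟪n, p⟫_ℝ := by
    have h1 : ‖‖n‖⁻¹ • n‖ = 1 := by rw [norm_smul, norm_inv, norm_norm, inv_mul_cancel₀ hnn.ne']
    have h2 : ⟪n, ‖n‖⁻¹ • n⟫_ℝ = ‖n‖ := by
      rw [real_inner_smul_right, real_inner_self_eq_norm_sq]; field_simp
    by_cases hc : ⟪n, ‖n‖⁻¹ • n⟫_ℝ = ⟪n, p⟫_ℝ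
    · refine ⟨-(‖n‖⁻¹ • n), by rwa [norm_neg], ?_⟩
      rw [inner_neg_right, ← hc, h2]
      intro h; linarith
    · exact ⟨_, h1, hc⟩
  have haux : ∀ y : Space, ⟪n, y⟫_ℝ = ⟪n, p⟫_ℝ → y ∉ segment ℝ q r →
      Disjoint (segment ℝ q r) (segment ℝ y x) := by
    intro y hy hyn
    rw [Set.disjoint_left]
    rintro z hz ⟨α, β, hα, hβ, hαβ, rfl⟩
    have h1 := hseg _ hz
    rw [inner_add_right, real_inner_smul_right, real_inner_smul_right, hy] at h1
    have h2 : β * (⟪n, x⟫_ℝ - ⟪n, p⟫_ℝ) = 0 := by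
      have : α = 1 - β := by linarith
      rw [this] at h1; linarith
    have hβ0 := (mul_eq_zero.1 h2).resolve_right (sub_ne_zero.2 hnx)
    subst hβ0
    rw [add_zero] at hαβ
    subst hαβ
    rw [one_smul, zero_smul, add_zero] at hz
    exact hyn hz
  refine ⟨x, hx, haux p rfl (notMem_segment hp hq hr hpq hpr), ?_⟩
  rw [segment_symm ℝ x p']
  exact haux p' hnp' (notMem_segment hp' hq hr hpq' hpr')

/-- At most two moves are needed, each inside a hypercone cut off by a plane that separates the
moving chord from the chord joining the other two points. -/
theorem HoldsNear.move (hτ : 0 < τ) {Q : Hypercone τ → Hypercone τ → Hypercone τ → Prop}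
    (hQ : ∀ a a' b c e : Hypercone τ, a.region ⊆ e.region → a'.region ⊆ e.region →
      e.SpacelikeSep b → e.SpacelikeSep c → Q a b c → Q a' b c)
    {p p' q r : Space} (hp : ‖p‖ = 1) (hp' : ‖p'‖ = 1) (hq : ‖q‖ = 1) (hr : ‖r‖ = 1)
    (hpq : p ≠ q) (hpr : p ≠ r) (hpq' : p' ≠ q) (hpr' : p' ≠ r) (h : HoldsNear Q p q r) :
    HoldsNear Q p' q r := by
  have step : ∀ x y : Space, ‖x‖ = 1 → ‖y‖ = 1 → Disjoint (segment ℝ q r) (segment ℝ x y) →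
      HoldsNear Q x q r → HoldsNear Q y q r := by
    rintro x y hx hy hd ⟨s, hs, h⟩
    obtain ⟨e, t, ht, h1, h2, h3, h4⟩ := exists_separating_hypercone hτ hx hy hq hr hd
    refine ⟨max s t, max_lt hs ht, fun a' b c ha' hb hc => ?_⟩
    obtain ⟨a, ha⟩ := exists_hypercone_in_cap hτ hx (max_lt hs ht)
    refine hQ a a' b c e ?_ ?_ ?_ ?_ (h a b c (ha.trans (cap_anti _ (le_max_left _ _)))
      (hb.trans (cap_anti _ (le_max_left _ _))) (hc.trans (cap_anti _ (le_max_left _ _))))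
    · exact (region_subset_iff hτ).2 ((ha.trans (cap_anti _ (le_max_right _ _))).trans h1)
    · exact (region_subset_iff hτ).2 ((ha'.trans (cap_anti _ (le_max_right _ _))).trans h2)
    · exact (sep_iff hτ).2 (h3.mono_right (hb.trans (cap_anti _ (le_max_right _ _))))
    · exact (sep_iff hτ).2 (h4.mono_right (hc.trans (cap_anti _ (le_max_right _ _))))
  obtain ⟨x, hx, h1, h2⟩ := exists_intermediate hp hp' hq hr hpq hpr hpq' hpr'
  exact step x p' hx hp' h2 (step p x hp hx h1 h)

/-- A property of triples of pairwise spacelike separated hypercones which is not affected if one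
of them is moved within a hypercone separated from the two others holds for all triples if it
holds for one of them. -/
theorem triple_induction (hτ : 0 < τ) {Q : Hypercone τ → Hypercone τ → Hypercone τ → Prop}
    (hQa : ∀ a a' b c e : Hypercone τ, a.region ⊆ e.region → a'.region ⊆ e.region →
      e.SpacelikeSep b → e.SpacelikeSep c → Q a b c → Q a' b c)
    (hQb : ∀ a b b' c e : Hypercone τ, b.region ⊆ e.region → b'.region ⊆ e.region →
      e.SpacelikeSep a → e.SpacelikeSep c → Q a b c → Q a b' c)
    (hQc : ∀ a b c c' e : Hypercone τ, c.region ⊆ e.region → c'.region ⊆ e.region →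
      e.SpacelikeSep a → e.SpacelikeSep b → Q a b c → Q a b c')
    {a b c a' b' c' : Hypercone τ} (hab : a.SpacelikeSep b) (hac : a.SpacelikeSep c)
    (hbc : b.SpacelikeSep c) (hab' : a'.SpacelikeSep b') (hac' : a'.SpacelikeSep c')
    (hbc' : b'.SpacelikeSep c') (h : Q a b c) : Q a' b' c' := by
  have hdist : ∀ (x y : Hypercone τ) (p q : Space) (s t : ℝ), ‖p‖ = 1 → s < 1 → t < 1 →
      cap p s ⊆ base x → cap q t ⊆ base y → x.SpacelikeSep y → p ≠ q := by
    rintro x y p q s t hp hs ht hx hy hxy rfl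
    obtain ⟨z, hz⟩ := exists_hypercone_in_cap hτ hp (max_lt hs ht)
    obtain ⟨v, hv⟩ := base_nonempty hτ z
    exact Set.disjoint_left.1 ((sep_iff hτ).1 hxy) (hx (cap_anti p (le_max_left _ _) (hz hv)))
      (hy (cap_anti p (le_max_right _ _) (hz hv)))
  obtain ⟨p, hp, sp, -, hsp, hpa⟩ := exists_cap_subset_base hτ a
  obtain ⟨q, hq, sq, -, hsq, hqb⟩ := exists_cap_subset_base hτ b
  obtain ⟨r, hr, sr, -, hsr, hrc⟩ := exists_cap_subset_base hτ c
  obtain ⟨p', hp', sp', -, hsp', hpa'⟩ := exists_cap_subset_base hτ a'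
  obtain ⟨q', hq', sq', -, hsq', hqb'⟩ := exists_cap_subset_base hτ b'
  obtain ⟨r', hr', sr', -, hsr', hrc'⟩ := exists_cap_subset_base hτ c'
  have hpq := hdist a b p q sp sq hp hsp hsq hpa hqb hab
  have hpr := hdist a c p r sp sr hp hsp hsr hpa hrc hac
  have hqr := hdist b c q r sq sr hq hsq hsr hqb hrc hbc
  have hpq' := hdist a' b' p' q' sp' sq' hp' hsp' hsq' hpa' hqb' hab'
  have hpr' := hdist a' c' p' r' sp' sr' hp' hsp' hsr' hpa' hrc' hac'
  have hqr' := hdist b' c' q' r' sq' sr' hq' hsq' hsr' hqb' hrc' hbc'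
  have h0 : HoldsNear Q p q r := by
    refine ⟨max sp (max sq sr), max_lt hsp (max_lt hsq hsr), fun x y z hx hy hz => ?_⟩
    have hxa : x.region ⊆ a.region :=
      (region_subset_iff hτ).2 ((hx.trans (cap_anti _ (le_max_left _ _))).trans hpa)
    have hyb : y.region ⊆ b.region := (region_subset_iff hτ).2
      ((hy.trans (cap_anti _ ((le_max_left _ _).trans (le_max_right _ _)))).trans hqb)
    have hzc : z.region ⊆ c.region := (region_subset_iff hτ).2
      ((hz.trans (cap_anti _ ((le_max_right _ _).trans (le_max_right _ _)))).trans hrc)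
    have h1 := hQa a x b c a Subset.rfl hxa hab hac h
    have h2 := hQb x b y c b Subset.rfl hyb (sep_mono hτ (sep_symm hτ hab) Subset.rfl hxa) hbc h1
    exact hQc x y c z c Subset.rfl hzc (sep_mono hτ (sep_symm hτ hac) Subset.rfl hxa)
      (sep_mono hτ (sep_symm hτ hbc) Subset.rfl hyb) h2
  -- Passing through auxiliary points distinct from all six others lets the points be moved one at a
  -- time without collisions, even when the old and new triples overlap.
  obtain ⟨x, hx, hxF⟩ := exists_unit_notMem {p, q, r, p', q', r'} (Set.toFinite _)
  obtain ⟨y, hy, hyF⟩ := exists_unit_notMem {p, q, r, p', q', r', x} (Set.toFinite _)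
  obtain ⟨z, hz, hzF⟩ := exists_unit_notMem {p, q, r, p', q', r', x, y} (Set.toFinite _)
  simp only [mem_insert_iff, mem_singleton_iff, not_or] at hxF hyF hzF
  obtain ⟨x1, x2, x3, x4, x5, x6⟩ := hxF
  obtain ⟨y1, y2, y3, y4, y5, y6, y7⟩ := hyF
  obtain ⟨z1, z2, z3, z4, z5, z6, z7, z8⟩ := hzF
  have moveB : ∀ p q q' r : Space, ‖p‖ = 1 → ‖q‖ = 1 → ‖q'‖ = 1 → ‖r‖ = 1 → q ≠ p → q ≠ r →
      q' ≠ p → q' ≠ r → HoldsNear Q p q r → HoldsNear Q p q' r := by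
    rintro p q q' r h1 h2 h3 h4 h5 h6 h7 h8 ⟨s, hs, h⟩
    obtain ⟨t, ht, h'⟩ := HoldsNear.move hτ (Q := fun b a c => Q a b c)
      (fun b b' a c e i1 i2 i3 i4 => hQb a b b' c e i1 i2 i3 i4) h2 h3 h1 h4 h5 h6 h7 h8
      ⟨s, hs, fun b a c i1 i2 i3 => h a b c i2 i1 i3⟩
    exact ⟨t, ht, fun a b c i1 i2 i3 => h' b a c i2 i1 i3⟩
  have moveC : ∀ p q r r' : Space, ‖p‖ = 1 → ‖q‖ = 1 → ‖r‖ = 1 → ‖r'‖ = 1 → r ≠ p → r ≠ q →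
      r' ≠ p → r' ≠ q → HoldsNear Q p q r → HoldsNear Q p q r' := by
    rintro p q r r' h1 h2 h3 h4 h5 h6 h7 h8 ⟨s, hs, h⟩
    obtain ⟨t, ht, h'⟩ := HoldsNear.move hτ (Q := fun c a b => Q a b c)
      (fun c c' a b e i1 i2 i3 i4 => hQc a b c c' e i1 i2 i3 i4) h3 h4 h1 h2 h5 h6 h7 h8
      ⟨s, hs, fun c a b i1 i2 i3 => h a b c i2 i3 i1⟩
    exact ⟨t, ht, fun a b c i1 i2 i3 => h' c a b i3 i1 i2⟩
  have h1 := HoldsNear.move hτ hQa hp hx hq hr hpq hpr x2 x3 h0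
  have h2 := moveB x q y r hx hq hy hr (Ne.symm x2) hqr y7 y3 h1
  have h3 := moveC x y r z hx hy hr hz (Ne.symm x3) (Ne.symm y3) z7 z8 h2
  have h4 := HoldsNear.move hτ hQa hx hp' hy hz (Ne.symm y7) (Ne.symm z7) (Ne.symm y4)
    (Ne.symm z4) h3
  have h5 := moveB p' y q' z hp' hy hq' hz y4 (Ne.symm z8) hpq'.symm (Ne.symm z5) h4
  obtain ⟨s, hs, h6⟩ := moveC p' q' z r' hp' hq' hz hr' z4 z5 hpr'.symm hqr'.symm h5
  obtain ⟨u, hu⟩ := exists_hypercone_in_cap hτ hp' (max_lt hs hsp')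
  obtain ⟨v, hv⟩ := exists_hypercone_in_cap hτ hq' (max_lt hs hsq')
  obtain ⟨w, hw⟩ := exists_hypercone_in_cap hτ hr' (max_lt hs hsr')
  have h7 := h6 u v w (hu.trans (cap_anti _ (le_max_left _ _)))
    (hv.trans (cap_anti _ (le_max_left _ _))) (hw.trans (cap_anti _ (le_max_left _ _)))
  have hua : u.region ⊆ a'.region :=
    (region_subset_iff hτ).2 ((hu.trans (cap_anti _ (le_max_right _ _))).trans hpa')
  have hvb : v.region ⊆ b'.region :=
    (region_subset_iff hτ).2 ((hv.trans (cap_anti _ (le_max_right _ _))).trans hqb')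
  have hwc : w.region ⊆ c'.region :=
    (region_subset_iff hτ).2 ((hw.trans (cap_anti _ (le_max_right _ _))).trans hrc')
  have h8 := hQa u a' v w a' hua Subset.rfl (sep_mono hτ hab' Subset.rfl hvb)
    (sep_mono hτ hac' Subset.rfl hwc) h7
  have h9 := hQb a' v b' w b' hvb Subset.rfl (sep_symm hτ hab') (sep_mono hτ hbc' Subset.rfl hwc) h8
  exact hQc a' b' w c' c' hwc Subset.rfl (sep_symm hτ hac') (sep_symm hτ hbc') h9

end LightCone

namespace LightCone

open Set Filter Topology

section OperatorAlgebras

variable {H : Type u} [NormedAddCommGroup H] [InnerProductSpace ℂ H] [CompleteSpace H]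

/-! ### Weak closures -/

theorem mem_weakClosure_iff {S : StarSubalgebra ℂ (H →L[ℂ] H)} {X : H →L[ℂ] H} :
    X ∈ weakClosure S ↔ ∀ Y : H →L[ℂ] H, (∀ A ∈ S, A * Y = Y * A) → Y * X = X * Y := by
  show X ∈ StarSubalgebra.centralizer ℂ _ ↔ _
  rw [StarSubalgebra.mem_centralizer_iff]
  constructor
  · intro h Y hY
    refine (h Y ?_).1
    rw [SetLike.mem_coe, StarSubalgebra.mem_centralizer_iff]
    exact fun A hA => ⟨hY A hA, hY _ (star_mem hA)⟩
  · intro h Y hY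
    rw [SetLike.mem_coe, StarSubalgebra.mem_centralizer_iff] at hY
    refine ⟨h Y fun A hA => (hY A hA).1, h _ fun A hA => ?_⟩
    have := congrArg star (hY A hA).2
    simpa using this.symm

theorem mem_weakClosure {S : StarSubalgebra ℂ (H →L[ℂ] H)} {X : H →L[ℂ] H} (hX : X ∈ S) :
    X ∈ weakClosure S :=
  mem_weakClosure_iff.2 fun _ hY => (hY X hX).symm

theorem commute_of_mem_weakClosure {S : StarSubalgebra ℂ (H →L[ℂ] H)} {X Y : H →L[ℂ] H}
    (hX : X ∈ weakClosure S) (hY : ∀ A ∈ S, A * Y = Y * A) : X * Y = Y * X :=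
  (mem_weakClosure_iff.1 hX Y hY).symm

theorem weakClosure_subset {S T : StarSubalgebra ℂ (H →L[ℂ] H)} (h : ∀ A ∈ S, A ∈ weakClosure T)
    {X : H →L[ℂ] H} (hX : X ∈ weakClosure S) : X ∈ weakClosure T :=
  mem_weakClosure_iff.2 fun _ hY =>
    mem_weakClosure_iff.1 hX _ fun A hA => commute_of_mem_weakClosure (h A hA) hY

theorem weakClosure_mono {S T : StarSubalgebra ℂ (H →L[ℂ] H)} (h : S ≤ T) {X : H →L[ℂ] H}
    (hX : X ∈ weakClosure S) : X ∈ weakClosure T :=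
  weakClosure_subset (fun _ hA => mem_weakClosure (h hA)) hX

theorem isClosed_weakClosure (S : StarSubalgebra ℂ (H →L[ℂ] H)) :
    IsClosed (weakClosure S : Set (H →L[ℂ] H)) := by
  have : (weakClosure S : Set (H →L[ℂ] H)) =
      ⋂ (Y : H →L[ℂ] H) (_ : ∀ A ∈ S, A * Y = Y * A), {X | Y * X = X * Y} := by
    ext X
    simp only [mem_iInter]
    exact mem_weakClosure_iff
  rw [this]
  exact isClosed_iInter fun Y => isClosed_iInter fun _ =>
    isClosed_eq (by fun_prop) (by fun_prop)

/-- Conjugation by a unitary is compatible with weak closures. -/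
theorem conj_mem_weakClosure {S T : StarSubalgebra ℂ (H →L[ℂ] H)} {U : H →L[ℂ] H}
    (hU : U ∈ unitary (H →L[ℂ] H)) (h : ∀ A ∈ S, U * A * star U ∈ weakClosure T) {X : H →L[ℂ] H}
    (hX : X ∈ weakClosure S) : U * X * star U ∈ weakClosure T := by
  have h1 := Unitary.star_mul_self_of_mem hU
  have h2 := Unitary.mul_star_self_of_mem hU
  refine mem_weakClosure_iff.2 fun Y hY => ?_
  have key : ∀ Z : H →L[ℂ] H, Z * (star U * Y * U) = star U * Y * U * Z ↔
      U * Z * star U * Y = Y * (U * Z * star U) := by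
    intro Z
    constructor
    · intro e
      have := congrArg (fun B => U * B * star U) e
      calc U * Z * star U * Y = U * (Z * (star U * Y * U)) * star U := by
            simp only [mul_assoc, h2, mul_one]
        _ = U * (star U * Y * U * Z) * star U := this
        _ = (U * star U) * Y * (U * Z * star U) := by simp only [mul_assoc]
        _ = _ := by rw [h2, one_mul]
    · intro e
      have := congrArg (fun B => star U * B * U) e
      calc Z * (star U * Y * U) = (star U * U) * Z * (star U * Y * U) := by rw [h1, one_mul]
        _ = star U * (U * Z * star U * Y) * U := by simp only [mul_assoc]
        _ = star U * (Y * (U * Z * star U)) * U := this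
        _ = star U * Y * U * Z * (star U * U) := by simp only [mul_assoc]
        _ = _ := by rw [h1, mul_one]
  have h3 := commute_of_mem_weakClosure hX (Y := star U * Y * U) fun A hA =>
    (key A).2 (commute_of_mem_weakClosure (h A hA) hY)
  exact ((key X).1 h3).symm

/-! ### Generated C*-algebras and their morphisms -/

theorem isClosed_cstarGen (s : Set (H →L[ℂ] H)) : IsClosed (cstarGen s : Set (H →L[ℂ] H)) :=
  (StarAlgebra.adjoin ℂ s).isClosed_topologicalClosure

theorem subset_cstarGen (s : Set (H →L[ℂ] H)) : s ⊆ cstarGen s :=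
  (StarAlgebra.subset_adjoin ℂ s).trans (StarSubalgebra.le_topologicalClosure _)

theorem cstarGen_le {s : Set (H →L[ℂ] H)} {S : StarSubalgebra ℂ (H →L[ℂ] H)}
    (hS : IsClosed (S : Set (H →L[ℂ] H))) (h : s ⊆ S) : cstarGen s ≤ S :=
  StarSubalgebra.topologicalClosure_minimal (StarAlgebra.adjoin_le h) hS

theorem norm_starAlgHom_le {S : StarSubalgebra ℂ (H →L[ℂ] H)} (hS : IsClosed (S : Set (H →L[ℂ] H)))
    (φ : S →⋆ₐ[ℂ] (H →L[ℂ] H)) (x : S) : ‖φ x‖ ≤ ‖x‖ := by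
  have : IsClosed (S : Set (H →L[ℂ] H)) := hS
  exact NonUnitalStarAlgHom.norm_apply_le φ x

theorem continuous_starAlgHom {S : StarSubalgebra ℂ (H →L[ℂ] H)}
    (hS : IsClosed (S : Set (H →L[ℂ] H))) (φ : S →⋆ₐ[ℂ] (H →L[ℂ] H)) : Continuous φ :=
  AddMonoidHomClass.continuous_of_bound φ 1 (fun x => by simpa using norm_starAlgHom_le hS φ x)

/-- Two morphisms of C*-algebras that agree on a set agree on the C*-algebra it generates. -/
theorem eqOn_cstarGen {S T : StarSubalgebra ℂ (H →L[ℂ] H)} (hS : IsClosed (S : Set (H →L[ℂ] H)))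
    (hT : IsClosed (T : Set (H →L[ℂ] H)))
    (φ : S →⋆ₐ[ℂ] (H →L[ℂ] H)) (ψ : T →⋆ₐ[ℂ] (H →L[ℂ] H)) {s : Set (H →L[ℂ] H)}
    (hs : ∀ x ∈ s, ∃ (h : x ∈ S) (h' : x ∈ T), φ ⟨x, h⟩ = ψ ⟨x, h'⟩) {x : H →L[ℂ] H}
    (hx : x ∈ cstarGen s) : ∃ (h : x ∈ S) (h' : x ∈ T), φ ⟨x, h⟩ = ψ ⟨x, h'⟩ := by
  let E : StarSubalgebra ℂ (H →L[ℂ] H) :=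
    { carrier := {x | ∃ (h : x ∈ S) (h' : x ∈ T), φ ⟨x, h⟩ = ψ ⟨x, h'⟩}
      mul_mem' := by
        rintro a b ⟨h1, h2, h3⟩ ⟨h4, h5, h6⟩
        refine ⟨mul_mem h1 h4, mul_mem h2 h5, ?_⟩
        have e1 := map_mul φ ⟨a, h1⟩ ⟨b, h4⟩
        have e2 := map_mul ψ ⟨a, h2⟩ ⟨b, h5⟩
        rw [h3, h6] at e1
        exact e1.trans e2.symm
      add_mem' := by
        rintro a b ⟨h1, h2, h3⟩ ⟨h4, h5, h6⟩
        refine ⟨add_mem h1 h4, add_mem h2 h5, ?_⟩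
        have e1 := map_add φ ⟨a, h1⟩ ⟨b, h4⟩
        have e2 := map_add ψ ⟨a, h2⟩ ⟨b, h5⟩
        rw [h3, h6] at e1
        exact e1.trans e2.symm
      algebraMap_mem' := by
        intro r
        refine ⟨algebraMap_mem S r, algebraMap_mem T r, ?_⟩
        exact (AlgHomClass.commutes φ r).trans (AlgHomClass.commutes ψ r).symm
      star_mem' := by
        rintro a ⟨h1, h2, h3⟩
        refine ⟨star_mem h1, star_mem h2, ?_⟩
        have e1 := map_star φ ⟨a, h1⟩
        have e2 := map_star ψ ⟨a, h2⟩
        rw [h3] at e1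
        exact e1.trans e2.symm }
  have hE : IsClosed (E : Set (H →L[ℂ] H)) := by
    apply isClosed_of_closure_subset
    intro y hy
    obtain ⟨z, hz, hzy⟩ := mem_closure_iff_seq_limit.1 hy
    have hyS : y ∈ S := hS.mem_of_tendsto hzy (Eventually.of_forall fun n => (hz n).1)
    have hyT : y ∈ T := hT.mem_of_tendsto hzy (Eventually.of_forall fun n => (hz n).2.1)
    refine ⟨hyS, hyT, ?_⟩
    have t1 : Tendsto (fun n => (⟨z n, (hz n).1⟩ : S)) atTop (𝓝 ⟨y, hyS⟩) :=
      tendsto_subtype_rng.2 hzy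
    have t2 : Tendsto (fun n => (⟨z n, (hz n).2.1⟩ : T)) atTop (𝓝 ⟨y, hyT⟩) :=
      tendsto_subtype_rng.2 hzy
    have t3 := ((continuous_starAlgHom hS φ).tendsto _).comp t1
    have t4 := ((continuous_starAlgHom hT ψ).tendsto _).comp t2
    refine tendsto_nhds_unique t3 (t4.congr fun n => ?_)
    exact ((hz n).2.2).symm
  exact cstarGen_le hE hs hx

theorem conj_mul {U : H →L[ℂ] H} (hU : U ∈ unitary (H →L[ℂ] H)) (A B : H →L[ℂ] H) :
    U * A * star U * (U * B * star U) = U * (A * B) * star U := by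
  have h1 := Unitary.star_mul_self_of_mem hU
  calc U * A * star U * (U * B * star U) = U * A * (star U * U) * B * star U := by
        simp only [mul_assoc]
    _ = _ := by rw [h1]; simp only [mul_assoc, one_mul]

theorem conj_add (U A B : H →L[ℂ] H) :
    U * A * star U + U * B * star U = U * (A + B) * star U := by
  rw [mul_add, add_mul]

theorem conj_algebraMap {U : H →L[ℂ] H} (hU : U ∈ unitary (H →L[ℂ] H)) (r : ℂ) :
    U * algebraMap ℂ (H →L[ℂ] H) r * star U = algebraMap ℂ (H →L[ℂ] H) r := by
  rw [← Algebra.commutes, mul_assoc, Unitary.mul_star_self_of_mem hU, mul_one]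

theorem conj_one {U : H →L[ℂ] H} (hU : U ∈ unitary (H →L[ℂ] H)) : U * 1 * star U = 1 := by
  rw [mul_one, Unitary.mul_star_self_of_mem hU]

theorem conj_star (U A : H →L[ℂ] H) : star (U * A * star U) = U * star A * star U := by
  simp [mul_assoc]

/-- The conjugate of a morphism by a unitary. -/
noncomputable def conjHom {𝔅 : Type*} [Ring 𝔅] [StarRing 𝔅] [Algebra ℂ 𝔅]
    (φ : 𝔅 →⋆ₐ[ℂ] (H →L[ℂ] H)) (U : H →L[ℂ] H) (hU : U ∈ unitary (H →L[ℂ] H)) :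
    𝔅 →⋆ₐ[ℂ] (H →L[ℂ] H) where
  toFun A := U * φ A * star U
  map_one' := by rw [map_one, conj_one hU]
  map_mul' A B := by rw [map_mul, conj_mul hU]
  map_zero' := by simp
  map_add' A B := by rw [map_add, conj_add]
  commutes' r := (congrArg (fun X => U * X * star U) (AlgHomClass.commutes φ r)).trans
    (conj_algebraMap hU r)
  map_star' A := by rw [map_star, conj_star]

@[simp]
theorem conjHom_apply {𝔅 : Type*} [Ring 𝔅] [StarRing 𝔅] [Algebra ℂ 𝔅]
    (φ : 𝔅 →⋆ₐ[ℂ] (H →L[ℂ] H)) (U : H →L[ℂ] H) (hU : U ∈ unitary (H →L[ℂ] H)) (A : 𝔅) :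
    conjHom φ U hU A = U * φ A * star U := rfl

theorem norm_conj (U : H →L[ℂ] H) (hU : U ∈ unitary (H →L[ℂ] H)) (A : H →L[ℂ] H) :
    ‖U * A * star U‖ = ‖A‖ := by
  rw [CStarRing.norm_mul_mem_unitary _ (Unitary.star_mem hU), CStarRing.norm_mem_unitary_mul _ hU]

/-- If the conjugations by a sequence of unitaries are eventually constant on each element of a
generating set then they converge in norm to a morphism. -/
theorem exists_limit_hom (U : ℕ → H →L[ℂ] H) (hU : ∀ n, U n ∈ unitary (H →L[ℂ] H))
    (s : Set (H →L[ℂ] H))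
    (hs : ∀ A ∈ s, ∃ n, ∀ m ≥ n, U m * A * star (U m) = U n * A * star (U n)) :
    ∃ φ : cstarGen s →⋆ₐ[ℂ] (H →L[ℂ] H),
      ∀ A : cstarGen s, Tendsto (fun n => U n * A * star (U n)) atTop (𝓝 (φ A)) := by
  let E : StarSubalgebra ℂ (H →L[ℂ] H) :=
    { carrier := {A | ∃ L, Tendsto (fun n => U n * A * star (U n)) atTop (𝓝 L)}
      mul_mem' := by
        rintro A B ⟨L, hL⟩ ⟨M, hM⟩
        exact ⟨L * M, (hL.mul hM).congr fun n => conj_mul (hU n) A B⟩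
      add_mem' := by
        rintro A B ⟨L, hL⟩ ⟨M, hM⟩
        exact ⟨L + M, (hL.add hM).congr fun n => conj_add (U n) A B⟩
      algebraMap_mem' := fun r =>
        ⟨algebraMap ℂ _ r, tendsto_const_nhds.congr fun n => (conj_algebraMap (hU n) r).symm⟩
      star_mem' := by
        rintro A ⟨L, hL⟩
        exact ⟨star L, hL.star.congr fun n => conj_star (U n) A⟩ }
  -- Unitary conjugations are isometric, so convergence passes to norm limits by an `ε / 4`
  -- argument.
  have hE : IsClosed (E : Set (H →L[ℂ] H)) := by
    apply isClosed_of_closure_subset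
    intro A hA
    suffices CauchySeq fun n => U n * A * star (U n) from cauchySeq_tendsto_of_complete this
    rw [Metric.cauchySeq_iff']
    intro ε hε
    obtain ⟨B, ⟨L, hL⟩, hAB⟩ := Metric.mem_closure_iff.1 hA (ε / 4) (by linarith)
    obtain ⟨N, hN⟩ := Metric.cauchySeq_iff'.1 hL.cauchySeq (ε / 4) (by linarith)
    have hd : ∀ n, dist (U n * A * star (U n)) (U n * B * star (U n)) < ε / 4 := fun n => by
      rw [dist_eq_norm, ← sub_mul, ← mul_sub, norm_conj _ (hU n), ← dist_eq_norm]
      exact hAB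
    refine ⟨N, fun n hn => ?_⟩
    calc dist (U n * A * star (U n)) (U N * A * star (U N))
        ≤ dist (U n * A * star (U n)) (U n * B * star (U n)) +
          dist (U n * B * star (U n)) (U N * B * star (U N)) +
          dist (U N * B * star (U N)) (U N * A * star (U N)) := dist_triangle4 _ _ _ _
      _ < ε := by
        have := hd n
        have h1 := hd N
        rw [dist_comm] at h1
        have := hN n hn
        linarith
  have hle : cstarGen s ≤ E := by
    refine cstarGen_le hE fun A hA => ?_
    obtain ⟨n, hn⟩ := hs A hA
    exact ⟨_, tendsto_const_nhds.congr' ((eventually_ge_atTop n).mono fun m hm => (hn m hm).symm)⟩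
  choose L hL using fun A : cstarGen s => hle A.2
  have huniq : ∀ (A : cstarGen s) (M : H →L[ℂ] H),
      Tendsto (fun n => U n * (A : H →L[ℂ] H) * star (U n)) atTop (𝓝 M) → L A = M :=
    fun A M h => tendsto_nhds_unique (hL A) h
  refine ⟨{ toFun := L
            map_one' := huniq 1 1 (tendsto_const_nhds.congr fun n => (conj_one (hU n)).symm)
            map_mul' := fun A B => huniq (A * B) _ (((hL A).mul (hL B)).congr fun n =>
              conj_mul (hU n) A B)
            map_zero' := huniq 0 0 (tendsto_const_nhds.congr fun n => by simp)
            map_add' := fun A B => huniq (A + B) _ (((hL A).add (hL B)).congr fun n =>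
              conj_add (U n) A B)
            commutes' := fun r => huniq _ _ (tendsto_const_nhds.congr fun n =>
              (conj_algebraMap (hU n) r).symm)
            map_star' := fun A => huniq (star A) _ ((hL A).star.congr fun n =>
              conj_star (U n) A) }, hL⟩

/-! ### Ultraweak density -/

/-- The diagonal action of an operator on the square summable sequences. -/
noncomputable def amplify (ι : Type) (A : H →L[ℂ] H) :
    lp (fun _ : ι => H) 2 →L[ℂ] lp (fun _ : ι => H) 2 :=
  LinearMap.mkContinuous
    { toFun := fun f => ⟨fun i => A (f i), by
        refine memℓp_gen ?_
        have h := ((lp.memℓp f).summable (by norm_num)).mul_left (‖A‖ ^ 2)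
        refine Summable.of_nonneg_of_le (fun i => by positivity) (fun i => ?_) h
        simp only [ENNReal.toReal_ofNat, Real.rpow_ofNat]
        rw [← mul_pow]
        exact pow_le_pow_left₀ (norm_nonneg _) (A.le_opNorm _) 2⟩
      map_add' := fun f g => by ext i; exact map_add A (f i) (g i)
      map_smul' := fun c f => by ext i; exact map_smul A c (f i) } ‖A‖ fun f => by
    refine lp.norm_le_of_forall_sum_le (by norm_num) (by positivity) fun s => ?_
    simp only [ENNReal.toReal_ofNat, Real.rpow_ofNat, LinearMap.coe_mk, AddHom.coe_mk]
    have h := lp.sum_rpow_le_norm_rpow (p := 2) (by norm_num) f s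
    simp only [ENNReal.toReal_ofNat, Real.rpow_ofNat] at h
    calc ∑ i ∈ s, ‖A (f i)‖ ^ 2 ≤ ∑ i ∈ s, ‖A‖ ^ 2 * ‖f i‖ ^ 2 := by
          refine Finset.sum_le_sum fun i _ => ?_
          rw [← mul_pow]
          exact pow_le_pow_left₀ (norm_nonneg _) (A.le_opNorm _) 2
      _ = ‖A‖ ^ 2 * ∑ i ∈ s, ‖f i‖ ^ 2 := by rw [Finset.mul_sum]
      _ ≤ (‖A‖ * ‖f‖) ^ 2 := by rw [mul_pow]; gcongr

omit [CompleteSpace H] in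
@[simp]
theorem amplify_apply (ι : Type) (A : H →L[ℂ] H) (f : lp (fun _ : ι => H) 2) (i : ι) :
    amplify ι A f i = A (f i) := rfl

end OperatorAlgebras

end LightCone

namespace LightCone

open Set Filter Topology

section Density

variable {H : Type u} [NormedAddCommGroup H] [InnerProductSpace ℂ H] [CompleteSpace H]

/-- A subspace invariant under an operator and its adjoint reduces it. -/
theorem starProjection_comm {E : Type*} [NormedAddCommGroup E] [InnerProductSpace ℂ E]
    [CompleteSpace E] (K : Submodule ℂ E) [K.HasOrthogonalProjection] {B B' : E →L[ℂ] E}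
    (hadj : ∀ x y, ⟪x, B y⟫_ℂ = ⟪B' x, y⟫_ℂ) (hB : ∀ x ∈ K, B x ∈ K) (hB' : ∀ x ∈ K, B' x ∈ K)
    (x : E) : K.starProjection (B x) = B (K.starProjection x) := by
  refine Submodule.eq_starProjection_of_mem_orthogonal'
    (hB _ (Submodule.starProjection_apply_mem K x))
    (z := B (x - K.starProjection x)) ?_ (by rw [← map_add, add_sub_cancel])
  rw [Submodule.mem_orthogonal]
  intro k hk
  rw [hadj]
  exact (Submodule.mem_orthogonal _ _).1 (K.sub_starProjection_mem_orthogonal x) _ (hB' k hk)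

theorem inner_amplify (ι : Type) (A : H →L[ℂ] H) (f g : lp (fun _ : ι => H) 2) :
    ⟪f, amplify ι A g⟫_ℂ = ⟪amplify ι (star A) f, g⟫_ℂ := by
  rw [lp.inner_eq_tsum, lp.inner_eq_tsum]
  congr 1
  ext i
  simp only [amplify_apply]
  rw [ContinuousLinearMap.star_eq_adjoint, ContinuousLinearMap.adjoint_inner_left]

omit [CompleteSpace H] in
theorem amplify_mul (ι : Type) (A B : H →L[ℂ] H) (f : lp (fun _ : ι => H) 2) :
    amplify ι (A * B) f = amplify ι A (amplify ι B f) := by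
  ext i; rfl

/-- An ultraweakly continuous functional that vanishes on a unital star algebra vanishes on its
weak closure. -/
theorem inner_amplify_eq_zero (ι : Type) {S : StarSubalgebra ℂ (H →L[ℂ] H)}
    (u v : lp (fun _ : ι => H) 2) (h : ∀ A ∈ S, ⟪u, amplify ι A v⟫_ℂ = 0) {X : H →L[ℂ] H}
    (hX : X ∈ weakClosure S) : ⟪u, amplify ι X v⟫_ℂ = 0 := by
  classical
  let M : Submodule ℂ (lp (fun _ : ι => H) 2) :=
    { carrier := {w | ∃ A ∈ S, amplify ι A v = w}
      zero_mem' := ⟨0, zero_mem S, by ext i; simp⟩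
      add_mem' := by
        rintro _ _ ⟨A, hA, rfl⟩ ⟨B, hB, rfl⟩
        exact ⟨A + B, add_mem hA hB, by ext i; simp⟩
      smul_mem' := by
        rintro c _ ⟨A, hA, rfl⟩
        exact ⟨c • A, S.smul_mem hA c, by ext i; simp⟩ }
  let K := M.topologicalClosure
  have hKB : ∀ B ∈ S, ∀ x ∈ K, amplify ι B x ∈ K := by
    intro B hB x hx
    have h1 : MapsTo (amplify ι B) (M : Set (lp (fun _ : ι => H) 2)) M := by
      rintro _ ⟨A, hA, rfl⟩
      exact ⟨B * A, mul_mem hB hA, amplify_mul ι B A v⟩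
    exact h1.closure (amplify ι B).continuous hx
  have : CompleteSpace K := M.isClosed_topologicalClosure.completeSpace_coe
  let P := K.starProjection
  have hPB : ∀ B ∈ S, ∀ x, P (amplify ι B x) = amplify ι B (P x) := fun B hB x =>
    starProjection_comm K (inner_amplify ι B) (hKB B hB) (hKB _ (star_mem hB)) x
  -- The bicommutant argument: the matrix entries `Y` of the projection `P` commute with `S`, hence
  -- with `X`, so `P` commutes with the diagonal action of `X`.
  have hPX : P ∘L amplify ι X = amplify ι X ∘L P := by
    refine lp.ext_continuousLinearMap (by norm_num) fun j => ?_
    ext x i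
    let Y : H →L[ℂ] H := (lp.evalCLM ℂ (fun _ : ι => H) 2 i) ∘L P ∘L
      (lp.singleContinuousLinearMap ℂ (fun _ : ι => H) 2 j)
    have hsingle : ∀ (A : H →L[ℂ] H) (z : H), amplify ι A (lp.single 2 j z) =
        lp.single 2 j (A z) := by
      intro A z
      ext k
      simp only [amplify_apply, lp.single_apply]
      by_cases hk : k = j
      · subst hk; simp
      · simp [hk]
    have hY : ∀ A ∈ S, A * Y = Y * A := by
      intro A hA
      ext z
      show A (P (lp.single 2 j z) i) = P (lp.single 2 j (A z)) i
      rw [← hsingle, hPB A hA, amplify_apply]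
    have := congrArg (fun B : H →L[ℂ] H => B x) (mem_weakClosure_iff.1 hX Y hY)
    have h2 : P (lp.single 2 j (X x)) i = X (P (lp.single 2 j x) i) := this
    show P (amplify ι X (lp.single 2 j x)) i = amplify ι X (P (lp.single 2 j x)) i
    rw [hsingle, amplify_apply, h2]
  have hvM : v ∈ M := ⟨1, one_mem S, by ext i; simp⟩
  have hvK : v ∈ K := M.le_topologicalClosure hvM
  have hXv : amplify ι X v ∈ K := by
    have h1 := congrArg (fun B => B v) hPX
    have h2 : P (amplify ι X v) = amplify ι X (P v) := h1
    rw [show P v = v from Submodule.starProjection_eq_self_iff.2 hvK] at h2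
    exact Submodule.starProjection_eq_self_iff.1 h2
  have hK : (K : Set (lp (fun _ : ι => H) 2)) ⊆ {w | ⟪u, w⟫_ℂ = 0} := by
    refine closure_minimal ?_ (isClosed_eq (by fun_prop) continuous_const)
    rintro _ ⟨A, hA, rfl⟩
    exact h A hA
  exact hK hXv

/-- A vector that is orthogonal to `S v` is orthogonal to `ℜ v`, with `ℜ` the weak closure of
`S`. -/
theorem inner_eq_zero_of_mem_weakClosure {S : StarSubalgebra ℂ (H →L[ℂ] H)} {x y x' y' : H}
    (h : ∀ A ∈ S, ⟪x, A y⟫_ℂ + ⟪x', A y'⟫_ℂ = 0) {X : H →L[ℂ] H} (hX : X ∈ weakClosure S) :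
    ⟪x, X y⟫_ℂ + ⟪x', X y'⟫_ℂ = 0 := by
  let pair (a b : H) : lp (fun _ : Bool => H) 2 :=
    ⟨fun i => if i then a else b, memℓp_gen (Summable.of_finite)⟩
  have hp : ∀ A : H →L[ℂ] H, ⟪pair x x', amplify Bool A (pair y y')⟫_ℂ =
      ⟪x, A y⟫_ℂ + ⟪x', A y'⟫_ℂ := by
    intro A
    rw [lp.inner_eq_tsum, tsum_fintype, Fintype.sum_bool]
    rfl
  rw [← hp]
  exact inner_amplify_eq_zero Bool _ _ (fun A hA => (hp A).trans (h A hA)) hX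

/-- Density of a star algebra in its weak closure, simultaneously for the operators and their
adjoints. -/
theorem exists_approx_star {S : StarSubalgebra ℂ (H →L[ℂ] H)} {W : H →L[ℂ] H}
    (hW : W ∈ weakClosure S) (x y : H) {ε : ℝ} (hε : 0 < ε) :
    ∃ T ∈ S, ‖T x - W x‖ < ε ∧ ‖star T y - star W y‖ < ε := by
  let _ : InnerProductSpace ℝ (WithLp 2 (H × H)) := InnerProductSpace.rclikeToReal ℂ _
  -- The subspace is only real because the adjoint is antilinear in the operator.
  let M : Submodule ℝ (WithLp 2 (H × H)) :=
    { carrier := {w | ∃ A ∈ S, w = WithLp.toLp 2 (A x, star A y)}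
      zero_mem' := ⟨0, zero_mem S, WithLp.ofLp_injective 2 (by simp; rfl)⟩
      add_mem' := by
        rintro _ _ ⟨A, hA, rfl⟩ ⟨B, hB, rfl⟩
        exact ⟨A + B, add_mem hA hB, WithLp.ofLp_injective 2 (by simp)⟩
      smul_mem' := by
        rintro c _ ⟨A, hA, rfl⟩
        exact ⟨(c : ℂ) • A, S.smul_mem hA _, WithLp.ofLp_injective 2 (by simp)⟩ }
  have key : WithLp.toLp 2 (W x, star W y) ∈ Mᗮᗮ := by
    rw [Submodule.mem_orthogonal]
    intro w hw
    obtain ⟨a, b, rfl⟩ : ∃ a b, w = WithLp.toLp 2 (a, b) := ⟨w.fst, w.snd, rfl⟩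
    have hin : ∀ A : H →L[ℂ] H, ⟪WithLp.toLp 2 (a, b), WithLp.toLp 2 (A x, star A y)⟫_ℝ =
        (⟪a, A x⟫_ℂ + ⟪y, A b⟫_ℂ).re := by
      intro A
      rw [real_inner_eq_re_inner ℂ, WithLp.prod_inner_apply]
      simp only [RCLike.re_to_complex, Complex.add_re]
      congr 1
      rw [ContinuousLinearMap.star_eq_adjoint, ContinuousLinearMap.adjoint_inner_right]
      exact inner_re_symm (𝕜 := ℂ) _ _
    have h0 : ∀ A ∈ S, (⟪a, A x⟫_ℂ + ⟪y, A b⟫_ℂ).re = 0 := by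
      intro A hA
      rw [← hin, real_inner_comm]
      exact (Submodule.mem_orthogonal _ _).1 hw _ ⟨A, hA, rfl⟩
    -- Moving the adjoint across turns the condition into a complex linear one, whose imaginary part
    -- is recovered by inserting `-i A`.
    have h1 : ∀ A ∈ S, ⟪a, A x⟫_ℂ + ⟪y, A b⟫_ℂ = 0 := by
      intro A hA
      refine Complex.ext (h0 A hA) ?_
      have := h0 _ (S.smul_mem hA (-Complex.I))
      simpa [inner_smul_right] using this
    rw [hin, inner_eq_zero_of_mem_weakClosure h1 hW, Complex.zero_re]
  rw [Submodule.orthogonal_orthogonal_eq_closure] at key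
  obtain ⟨_, ⟨T, hT, rfl⟩, hd⟩ := Metric.mem_closure_iff.1 key ε hε
  refine ⟨T, hT, ?_, ?_⟩
  · refine lt_of_le_of_lt ?_ hd
    rw [dist_comm, dist_eq_norm]
    exact WithLp.norm_fst_le (p := 2)
      (x := WithLp.toLp 2 (T x, star T y) - WithLp.toLp 2 (W x, star W y))
  · refine lt_of_le_of_lt ?_ hd
    rw [dist_comm, dist_eq_norm]
    exact WithLp.norm_snd_le (p := 2)
      (x := WithLp.toLp 2 (T x, star T y) - WithLp.toLp 2 (W x, star W y))

end Density

end LightCone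

/-! ### Unitaries in a C*-algebra and a Kaplansky-type approximation -/

namespace LightCone

open Set Filter Topology

section Unitaries

variable {𝔅 : Type*} [CStarAlgebra 𝔅]

/-- The Russo-Dye step: the sum of a unitary and a strict contraction is a sum of two unitaries. -/
theorem exists_unitary_add_eq {y u : 𝔅} (hy : ‖y‖ < 1) (hu : u ∈ unitary 𝔅) :
    ∃ v ∈ unitary 𝔅, ∃ w ∈ unitary 𝔅, y + u = v + w := by
  let _ := CStarAlgebra.spectralOrder 𝔅
  let _ := CStarAlgebra.spectralOrderedRing 𝔅
  -- Here `y + u = u c` with `c` invertible and `‖c‖ ≤ 2`. In the polar decomposition `c = p a` the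
  -- factor `p` is unitary, and `a`, being self-adjoint of norm at most `2`, is the sum of a unitary
  -- and its adjoint.
  set c : 𝔅 := 1 + star u * y with hc
  have hny : ‖star u * y‖ < 1 := by rwa [CStarRing.norm_mem_unitary_mul _ (Unitary.star_mem hu)]
  have hcu : IsUnit c := by
    have := isUnit_one_sub_of_norm_lt_one (x := -(star u * y)) (by rwa [norm_neg])
    rwa [sub_neg_eq_add] at this
  have hcn : ‖c‖ ≤ 2 := by
    have h1 : ‖(1 : 𝔅)‖ ≤ 1 := by
      rcases subsingleton_or_nontrivial 𝔅 with h | h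
      · rw [Subsingleton.elim (1 : 𝔅) 0, norm_zero]; exact zero_le_one
      · exact CStarRing.norm_one.le
    linarith [norm_add_le (1 : 𝔅) (star u * y)]
  set a : 𝔅 := CFC.abs c with ha
  have haa : a * a = star c * c := CFC.abs_mul_abs c
  have hasa : IsSelfAdjoint a := (CFC.abs_nonneg c).isSelfAdjoint
  have hau : IsUnit a := by
    have : IsUnit (a * a) := haa ▸ (hcu.star.mul hcu)
    exact isUnit_mul_self_iff.1 this
  obtain ⟨a', ha1⟩ := hau
  set p : 𝔅 := c * ↑a'⁻¹ with hp
  have hpa : p * a = c := by rw [hp, ← ha1, mul_assoc, Units.inv_mul, mul_one]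
  have hainv : star (↑a'⁻¹ : 𝔅) = ↑a'⁻¹ := by
    have h1 : star (↑a'⁻¹ : 𝔅) * a = 1 := by
      rw [← hasa.star_eq, ← star_mul, ← ha1, Units.mul_inv, star_one]
    calc star (↑a'⁻¹ : 𝔅) = star (↑a'⁻¹ : 𝔅) * (a * ↑a'⁻¹) := by
          rw [← ha1, Units.mul_inv, mul_one]
      _ = ↑a'⁻¹ := by rw [← mul_assoc, h1, one_mul]
  have hpp : star p * p = 1 := by
    calc star p * p = ↑a'⁻¹ * (star c * c) * ↑a'⁻¹ := by
          rw [hp, star_mul, hainv]; simp only [mul_assoc]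
      _ = 1 := by
          rw [← haa, ← ha1]
          simp
  have hpu : p ∈ unitary 𝔅 := by
    obtain ⟨p', hp'⟩ : IsUnit p := hcu.mul (Units.isUnit _)
    refine Unitary.mem_iff.2 ⟨hpp, ?_⟩
    have : star p = ↑p'⁻¹ := by
      rw [← hp'] at hpp ⊢
      exact eq_comm.1 (Units.inv_eq_of_mul_eq_one_left hpp)
    rw [this, ← hp', Units.mul_inv]
  let b : selfAdjoint 𝔅 := ⟨(2⁻¹ : ℝ) • a, (IsSelfAdjoint.all (2⁻¹ : ℝ)).smul hasa⟩
  have hb : ‖b‖ ≤ 1 := by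
    show ‖(2⁻¹ : ℝ) • a‖ ≤ 1
    rw [norm_smul, ha, CFC.norm_abs]
    norm_num
    linarith
  let x := selfAdjoint.unitarySelfAddISMul b hb
  have hx : (x : 𝔅) + star (x : 𝔅) = a := by
    have h1 := selfAdjoint.star_coe_unitarySelfAddISMul b hb
    have h2 := selfAdjoint.unitarySelfAddISMul_coe b hb
    rw [← Unitary.coe_star]
    show ((selfAdjoint.unitarySelfAddISMul b hb : unitary 𝔅) : 𝔅) +
      ((star (selfAdjoint.unitarySelfAddISMul b hb) : unitary 𝔅) : 𝔅) = a
    rw [Unitary.coe_star, h1, h2]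
    show (2⁻¹ : ℝ) • a + _ + ((2⁻¹ : ℝ) • a - _) = a
    module
  refine ⟨u * p * x, mul_mem (mul_mem hu hpu) x.2, u * p * star (x : 𝔅),
    mul_mem (mul_mem hu hpu) (Unitary.star_mem x.2), ?_⟩
  rw [← mul_add, hx, mul_assoc, hpa, hc, mul_add, mul_one, ← mul_assoc,
    Unitary.mul_star_self_of_mem hu, one_mul, add_comm]

/-- Each further `y` is absorbed by splitting `y` plus one of the unitaries into two. Up to a term
of order `1 / n`, a strict contraction is an average of unitaries. -/
theorem exists_sum_unitary_eq {y : 𝔅} (hy : ‖y‖ < 1) (n : ℕ) :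
    ∃ v : ℕ → 𝔅, (∀ i, v i ∈ unitary 𝔅) ∧ n • y + 1 = ∑ i ∈ Finset.range (n + 1), v i := by
  induction n with
  | zero => exact ⟨fun _ => 1, fun _ => one_mem _, by simp⟩
  | succ n ih =>
    obtain ⟨v, hv, he⟩ := ih
    obtain ⟨w, hw, w', hw', hww⟩ := exists_unitary_add_eq hy (hv n)
    refine ⟨fun i => if i < n then v i else if i = n then w else w', fun i => ?_, ?_⟩
    · dsimp only
      split_ifs
      exacts [hv i, hw, hw']
    · rw [Finset.sum_range_succ, Finset.sum_range_succ, succ_nsmul, add_right_comm, he,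
        Finset.sum_range_succ, Finset.sum_congr rfl (g := v)
          (fun i hi => if_pos (Finset.mem_range.1 hi))]
      simp only [lt_irrefl, if_false, if_true, Nat.not_succ_lt_self, Nat.succ_ne_self]
      rw [add_assoc, add_comm (v n) y, hww, add_assoc]

/-- The contraction `2 t (1 + t* t)⁻¹`. -/
theorem exists_contraction (t : 𝔅) : ∃ g : 𝔅, ‖g‖ ≤ 1 ∧ g + t * star t * g = (2 : ℂ) • t := by
  let _ := CStarAlgebra.spectralOrder 𝔅
  let _ := CStarAlgebra.spectralOrderedRing 𝔅
  have hd : IsUnit (1 + star t * t) :=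
    CStarAlgebra.isUnit_of_le (1 : 𝔅) (le_add_of_nonneg_right (star_mul_self_nonneg t))
  obtain ⟨d, hd⟩ := hd
  have hdsa : star (d : 𝔅) = d := by rw [hd]; simp
  have hdi : star (↑d⁻¹ : 𝔅) = ↑d⁻¹ := by
    have h1 : star (↑d⁻¹ : 𝔅) * d = 1 := by
      rw [show star (↑d⁻¹ : 𝔅) * d = star (d * ↑d⁻¹ : 𝔅) by rw [star_mul, hdsa], Units.mul_inv, star_one]
    calc star (↑d⁻¹ : 𝔅) = star (↑d⁻¹ : 𝔅) * (d * ↑d⁻¹) := by rw [Units.mul_inv, mul_one]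
      _ = ↑d⁻¹ := by rw [← mul_assoc, h1, one_mul]
  have e1 : (d : 𝔅) * ↑d⁻¹ = 1 := d.mul_inv
  have e2 : (↑d⁻¹ : 𝔅) * d = 1 := d.inv_mul
  refine ⟨(2 : ℂ) • (t * ↑d⁻¹), ?_, ?_⟩
  · set g := (2 : ℂ) • (t * (↑d⁻¹ : 𝔅)) with hg
    have hs : star t * t = d - 1 := by rw [hd]; abel
    have hgg : star g * g = (4 : ℂ) • (↑d⁻¹ * ((d : 𝔅) - 1) * ↑d⁻¹) := by
      rw [hg, star_smul, star_mul, hdi, smul_mul_smul_comm, ← hs]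
      congr 1
      · simp; norm_num
      · simp only [mul_assoc]
    have hg1 : star g * g ≤ 1 := by
      rw [← sub_nonneg]
      -- With `d = 1 + t* t` one has `g* g = 4 (d⁻¹ - d⁻²)`, so the difference is a perfect square.
      have : 1 - star g * g = star (1 - (2 : ℂ) • (↑d⁻¹ : 𝔅)) * (1 - (2 : ℂ) • (↑d⁻¹ : 𝔅)) := by
        have h3 : ↑d⁻¹ * ((d : 𝔅) - 1) * ↑d⁻¹ = ↑d⁻¹ - ↑d⁻¹ * ↑d⁻¹ := by
          rw [mul_sub, e2, sub_mul, one_mul, mul_one]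
        rw [hgg, h3, star_sub, star_one, star_smul, hdi]
        simp only [mul_sub, sub_mul, mul_one, one_mul, smul_mul_smul_comm, RCLike.star_def,
          map_ofNat]
        module
      rw [this]
      exact star_mul_self_nonneg _
    have h4 : ‖star g * g‖ ≤ 1 :=
      (CStarAlgebra.norm_le_one_iff_of_nonneg _ (star_mul_self_nonneg g)).2 hg1
    rw [CStarRing.norm_star_mul_self] at h4
    nlinarith [norm_nonneg g]
  · rw [mul_smul_comm, ← smul_add]
    congr 1
    calc t * ↑d⁻¹ + t * star t * (t * ↑d⁻¹) = t * (1 + star t * t) * ↑d⁻¹ := by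
          simp only [mul_add, add_mul, mul_one, mul_assoc]
      _ = t := by rw [← hd, mul_assoc, e1, mul_one]

variable {H : Type u} [NormedAddCommGroup H] [InnerProductSpace ℂ H] [CompleteSpace H]

theorem norm_apply_of_mem_unitary {U : H →L[ℂ] H} (hU : U ∈ unitary (H →L[ℂ] H)) (x : H) :
    ‖U x‖ = ‖x‖ := by
  have h1 : ⟪U x, U x⟫_ℂ = ⟪x, x⟫_ℂ := by
    rw [← ContinuousLinearMap.adjoint_inner_right, ← ContinuousLinearMap.star_eq_adjoint,
      ← mul_apply_eq_comp, Unitary.star_mul_self_of_mem hU]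
    rfl
  rw [@norm_eq_sqrt_re_inner ℂ, @norm_eq_sqrt_re_inner ℂ, h1]

/-- Vectors `W x` with `W` a unitary in the weak closure of a represented C*-algebra are limits of
vectors `u x` with `u` a unitary of the algebra. -/
theorem exists_unitary_approx (φ : 𝔅 →⋆ₐ[ℂ] (H →L[ℂ] H)) {W : H →L[ℂ] H}
    (hW : W ∈ weakClosure φ.range) (hWu : W ∈ unitary (H →L[ℂ] H)) {x : H} (hx : ‖x‖ = 1) {δ : ℝ}
    (hδ : 0 < δ) : ∃ u ∈ unitary 𝔅, ‖φ u x - W x‖ < δ := by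
  have hWi : ∀ z, ‖W z‖ = ‖z‖ := norm_apply_of_mem_unitary hWu
  obtain ⟨η, hη, hηδ⟩ : ∃ η : ℝ, 0 < η ∧ 8 * η ≤ δ ^ 2 / 2 :=
    ⟨δ ^ 2 / 16, by positivity, by linarith⟩
  obtain ⟨_, ⟨t, rfl⟩, ht1, ht2⟩ := exists_approx_star hW x (W x) hη
  replace ht1 : ‖φ t x - W x‖ < η := ht1
  replace ht2 : ‖star (φ t) (W x) - star W (W x)‖ < η := ht2
  obtain ⟨g, hg1, hg2⟩ := exists_contraction t
  -- The error `z` satisfies `(1 + t t*) z = a + t b` with `a`, `b` the two small approximation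
  -- errors; pairing with `z` bounds it although `t` itself is not bounded uniformly.
  have hgx : ‖φ g x - W x‖ ≤ 2 * η := by
    set z := φ g x - W x with hz
    set a := φ t x - W x with ha
    set b := star W (W x) - star (φ t) (W x) with hb
    have hWW : star W (W x) = x := by
      show (star W * W) x = x
      rw [Unitary.star_mul_self_of_mem hWu]; rfl
    have h1 : φ g x + φ t (star (φ t) (φ g x)) = (2 : ℂ) • φ t x := by
      have h : φ (g + t * star t * g) x = φ ((2 : ℂ) • t) x := by rw [hg2]
      rw [map_add, map_mul, map_mul, map_star, map_smul] at h
      exact h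
    have h2 : z + φ t (star (φ t) z) = a + φ t b := by
      rw [hz, ha, hb, hWW]
      simp only [map_sub]
      have h3 : φ t (star (φ t) (φ g x)) = (2 : ℂ) • φ t x - φ g x := by rw [← h1]; abel
      rw [h3, two_smul]
      abel
    have h3 : ‖z‖ ^ 2 + ‖star (φ t) z‖ ^ 2 ≤ ‖z‖ * ‖a‖ + ‖star (φ t) z‖ * ‖b‖ := by
      have h4 : (⟪z, z + φ t (star (φ t) z)⟫_ℂ).re = ‖z‖ ^ 2 + ‖star (φ t) z‖ ^ 2 := by
        rw [inner_add_right, Complex.add_re, ← ContinuousLinearMap.adjoint_inner_left,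
          ← ContinuousLinearMap.star_eq_adjoint]
        congr 1
        · exact inner_self_eq_norm_sq (𝕜 := ℂ) _
        · exact inner_self_eq_norm_sq (𝕜 := ℂ) _
      rw [← h4, h2, inner_add_right, Complex.add_re, ← ContinuousLinearMap.adjoint_inner_left,
        ← ContinuousLinearMap.star_eq_adjoint]
      exact add_le_add (re_inner_le_norm (𝕜 := ℂ) z a) (re_inner_le_norm (𝕜 := ℂ) _ b)
    have hb' : ‖b‖ < η := by rw [hb, norm_sub_rev]; exact ht2
    by_contra! hcon
    have h5 : ‖z‖ * ‖a‖ ≤ ‖z‖ * η := mul_le_mul_of_nonneg_left ht1.le (norm_nonneg _)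
    have h6 : ‖b‖ ^ 2 ≤ η ^ 2 := pow_le_pow_left₀ (norm_nonneg _) hb'.le 2
    nlinarith [sq_nonneg (‖star (φ t) z‖ - ‖b‖ / 2)]
  obtain ⟨n, hn⟩ := exists_nat_gt (2 / η)
  have hn0 : 0 < (n : ℝ) := lt_trans (by positivity) hn
  have hnη : 2 < n * η := by rwa [div_lt_iff₀ hη] at hn
  obtain ⟨r, hr0, hr1, hr⟩ : ∃ r : ℝ, 0 < r ∧ r < 1 ∧ 1 - r ≤ η :=
    ⟨max (1 / 2) (1 - η), by positivity, by simp [hη]; norm_num,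
      by linarith [le_max_right (1 / 2 : ℝ) (1 - η)]⟩
  have hy : ‖(r : ℂ) • g‖ < 1 := by
    rw [norm_smul, Complex.norm_real, Real.norm_of_nonneg hr0.le]
    nlinarith
  obtain ⟨v, hv, hs⟩ := exists_sum_unitary_eq hy n
  have hre : ∀ z : H, 1 - ‖z - W x‖ ≤ (⟪W x, z⟫_ℂ).re := by
    intro z
    have h1 : (⟪W x, z⟫_ℂ).re = 1 + (⟪W x, z - W x⟫_ℂ).re := by
      rw [inner_sub_right, Complex.sub_re]
      have : (⟪W x, W x⟫_ℂ).re = ‖W x‖ ^ 2 := inner_self_eq_norm_sq (𝕜 := ℂ) _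
      rw [this, hWi, hx]; ring
    have h2 := (Complex.abs_re_le_norm _).trans (norm_inner_le_norm (𝕜 := ℂ) (W x) (z - W x))
    rw [hWi, hx, one_mul] at h2
    linarith [(abs_le.1 h2).1]
  have hx1 : -1 ≤ (⟪W x, x⟫_ℂ).re := by
    have h2 := (Complex.abs_re_le_norm _).trans (norm_inner_le_norm (𝕜 := ℂ) (W x) x)
    rw [hWi, hx, one_mul] at h2
    exact (abs_le.1 h2).1
  have hsum : ∑ i ∈ Finset.range (n + 1), (⟪W x, φ (v i) x⟫_ℂ).re =
      n * (r * (⟪W x, φ g x⟫_ℂ).re) + (⟪W x, x⟫_ℂ).re := by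
    have h : φ (n • ((r : ℂ) • g) + 1) x = φ (∑ i ∈ Finset.range (n + 1), v i) x := by rw [hs]
    rw [map_add, map_nsmul, map_smul, map_one, map_sum, sum_apply] at h
    have h' := congrArg (fun w => (⟪W x, w⟫_ℂ).re) h
    rw [inner_sum, Complex.re_sum] at h'
    rw [← h', ← Nat.cast_smul_eq_nsmul ℂ]
    simp [Complex.mul_re]
  -- The average of these real parts is close to its maximal value `1`, so some term is. Unit
  -- vectors with such an inner product have squared distance below `16 η ≤ δ²`.
  obtain ⟨i, hi⟩ : ∃ i, 1 - 8 * η < (⟪W x, φ (v i) x⟫_ℂ).re := by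
    by_contra! hcon
    have h1 := Finset.sum_le_card_nsmul (Finset.range (n + 1)) _ _ fun i _ => hcon i
    rw [hsum, Finset.card_range, nsmul_eq_mul] at h1
    push_cast at h1
    have h2 : 1 - 3 * η ≤ r * (⟪W x, φ g x⟫_ℂ).re := by
      have := hre (φ g x)
      have h3 : r * (1 - 2 * η) ≤ r * (⟪W x, φ g x⟫_ℂ).re :=
        mul_le_mul_of_nonneg_left (by linarith) hr0.le
      rcases le_total 0 (1 - 2 * η) with h4 | h4 <;> nlinarith
    have h3 := mul_le_mul_of_nonneg_left h2 hn0.le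
    nlinarith
  refine ⟨v i, hv i, ?_⟩
  have hnv : ‖φ (v i) x‖ = 1 := by
    rw [norm_apply_of_mem_unitary (Unitary.map_mem φ (hv i)), hx]
  have h1 := norm_sub_sq (𝕜 := ℂ) (W x) (φ (v i) x)
  rw [hnv, hWi, hx, RCLike.re_to_complex, norm_sub_rev] at h1
  exact lt_of_pow_lt_pow_left₀ 2 hδ.le (by linarith)

end Unitaries

end LightCone

/-! ### Unitary conjugation, the net in hypercones, and intertwiners -/

namespace LightCone

open Set Filter Topology

section

variable {H : Type u} [NormedAddCommGroup H] [InnerProductSpace ℂ H] [CompleteSpace H]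

theorem star_mul_cancel {V : H →L[ℂ] H} (hV : V ∈ unitary (H →L[ℂ] H)) (X : H →L[ℂ] H) :
    star V * (V * X) = X := by
  rw [← mul_assoc, Unitary.star_mul_self_of_mem hV, one_mul]

theorem mul_star_cancel {V : H →L[ℂ] H} (hV : V ∈ unitary (H →L[ℂ] H)) (X : H →L[ℂ] H) :
    V * (star V * X) = X := by
  rw [← mul_assoc, Unitary.mul_star_self_of_mem hV, one_mul]

theorem conj_eq_iff {V : H →L[ℂ] H} (hV : V ∈ unitary (H →L[ℂ] H)) {A B : H →L[ℂ] H} :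
    V * A * star V = B ↔ V * A = B * V := by
  constructor
  · rintro rfl
    rw [mul_assoc _ (star V), Unitary.star_mul_self_of_mem hV, mul_one]
  · intro h
    rw [h, mul_assoc, Unitary.mul_star_self_of_mem hV, mul_one]

theorem star_conj_eq_iff {V : H →L[ℂ] H} (hV : V ∈ unitary (H →L[ℂ] H)) {A B : H →L[ℂ] H} :
    star V * B * V = A ↔ V * A = B * V := by
  constructor
  · rintro rfl
    rw [← mul_assoc, ← mul_assoc, Unitary.mul_star_self_of_mem hV, one_mul]
  · intro h
    rw [mul_assoc, ← h, star_mul_cancel hV]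

theorem eq_smul_one_of_star_conj {V X : H →L[ℂ] H} (hV : V ∈ unitary (H →L[ℂ] H)) {z : ℂ}
    (h : star V * X * V = z • (1 : H →L[ℂ] H)) : X = z • (1 : H →L[ℂ] H) := by
  have h1 := (star_conj_eq_iff hV).1 h
  rw [mul_smul_comm, mul_one] at h1
  calc X = X * V * star V := by rw [mul_assoc, Unitary.mul_star_self_of_mem hV, mul_one]
    _ = z • (1 : H →L[ℂ] H) := by
      rw [← h1, smul_mul_assoc, Unitary.mul_star_self_of_mem hV]

theorem star_comm_of_comm {V X : H →L[ℂ] H} (hV : V ∈ unitary (H →L[ℂ] H)) (h : V * X = X * V) :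
    star V * X = X * star V := by
  have h1 := (star_conj_eq_iff hV).2 h
  nth_rewrite 2 [← h1]
  rw [mul_assoc _ V, Unitary.mul_star_self_of_mem hV, mul_one]

theorem comm_of_mem_cstarGen {s : Set (H →L[ℂ] H)} (hs : ∀ A ∈ s, star A ∈ s) {X : H →L[ℂ] H}
    (h : ∀ A ∈ s, A * X = X * A) {A : H →L[ℂ] H} (hA : A ∈ cstarGen s) : A * X = X * A := by
  have hcl : IsClosed (StarSubalgebra.centralizer ℂ {X} : Set (H →L[ℂ] H)) := by
    have : (StarSubalgebra.centralizer ℂ {X} : Set (H →L[ℂ] H)) =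
        {A | X * A = A * X ∧ star X * A = A * star X} := by
      ext A
      rw [SetLike.mem_coe, StarSubalgebra.mem_centralizer_iff]
      simp
    rw [this, ofPred_and]
    exact (isClosed_eq (by fun_prop) (by fun_prop)).inter (isClosed_eq (by fun_prop) (by fun_prop))
  have hle : cstarGen s ≤ StarSubalgebra.centralizer ℂ {X} := by
    refine cstarGen_le hcl fun B hB => ?_
    rw [SetLike.mem_coe, StarSubalgebra.mem_centralizer_iff]
    rintro _ rfl
    refine ⟨(h B hB).symm, ?_⟩
    have := congrArg star (h _ (hs B hB))
    simpa using this
  exact ((StarSubalgebra.mem_centralizer_iff ℂ).1 (hle hA) X rfl).1.symm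

end

namespace ObservableNet

variable {τ : ℝ} {H : Type u} [NormedAddCommGroup H] [InnerProductSpace ℂ H] [CompleteSpace H]
  {T : ObservableNet τ H}

/-! ### The net -/

theorem regionAlg_mono {alg : DoubleCone → StarSubalgebra ℂ (H →L[ℂ] H)} {X Y : Set Minkowski}
    (h : X ⊆ Y) : regionAlg alg X ≤ regionAlg alg Y := by
  refine cstarGen_le (isClosed_cstarGen _) (Subset.trans ?_ (subset_cstarGen _))
  exact iUnion₂_subset fun O hO => subset_iUnion₂_of_subset O (hO.trans h) (Subset.refl _)

theorem mem_regionAlg {alg : DoubleCone → StarSubalgebra ℂ (H →L[ℂ] H)} {X : Set Minkowski}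
    {O : DoubleCone} (h : O.region ⊆ X) {A : H →L[ℂ] H} (hA : A ∈ alg O) : A ∈ regionAlg alg X :=
  subset_cstarGen _ (mem_iUnion₂.2 ⟨O, h, hA⟩)

theorem regionAlg_le {alg : DoubleCone → StarSubalgebra ℂ (H →L[ℂ] H)} {X : Set Minkowski}
    {S : StarSubalgebra ℂ (H →L[ℂ] H)} (hS : IsClosed (S : Set (H →L[ℂ] H)))
    (h : ∀ O : DoubleCone, O.region ⊆ X → alg O ≤ S) : regionAlg alg X ≤ S :=
  cstarGen_le hS (iUnion₂_subset h)

theorem isClosed_algV : IsClosed (T.algV : Set (H →L[ℂ] H)) := isClosed_cstarGen _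

theorem algC_le_algV (C : Hypercone τ) : T.algC C ≤ T.algV :=
  regionAlg_mono (region_subset_cone C)

theorem algC_le_algCc {C D : Hypercone τ} (h : D.SpacelikeSep C) : T.algC D ≤ T.algCc C :=
  fun _ hA => subset_cstarGen _ (mem_iUnion₂.2 ⟨D, h, hA⟩)

theorem algCc_le {C : Hypercone τ} {S : StarSubalgebra ℂ (H →L[ℂ] H)}
    (hS : IsClosed (S : Set (H →L[ℂ] H))) (h : ∀ D : Hypercone τ, D.SpacelikeSep C → T.algC D ≤ S) :
    T.algCc C ≤ S :=
  cstarGen_le hS (iUnion₂_subset h)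

theorem algCc_le_algV (C : Hypercone τ) : T.algCc C ≤ T.algV :=
  algCc_le isClosed_algV fun D _ => algC_le_algV D

theorem algCc_anti {C D : Hypercone τ} (h : C.region ⊆ D.region) : T.algCc D ≤ T.algCc C :=
  algCc_le (isClosed_cstarGen _) fun _ hE =>
    algC_le_algCc (hE.trans (spacelikeCompl_anti h))

theorem vnC_le_vnV {C : Hypercone τ} {X : H →L[ℂ] H} (hX : X ∈ T.vnC C) : X ∈ T.vnV :=
  weakClosure_mono (algC_le_algV C) hX

theorem vnCc_le_vnV {C : Hypercone τ} {X : H →L[ℂ] H} (hX : X ∈ T.vnCc C) : X ∈ T.vnV :=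
  weakClosure_mono (algCc_le_algV C) hX

theorem vnC_le_vnCc {C D : Hypercone τ} (h : D.SpacelikeSep C) {X : H →L[ℂ] H}
    (hX : X ∈ T.vnC D) : X ∈ T.vnCc C :=
  weakClosure_mono (algC_le_algCc h) hX

/-- Operators localized in spacelike separated hypercones commute. -/
theorem commute_of_sep {C D : Hypercone τ} (h : C.SpacelikeSep D) {X Y : H →L[ℂ] H}
    (hX : X ∈ T.vnC C) (hY : Y ∈ T.vnC D) : X * Y = Y * X :=
  (commute_of_mem_weakClosure hY ((T.duality_compl D X).2 (vnC_le_vnCc h hX)).2).symm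

theorem mem_vnC_of_commute {C : Hypercone τ} {X : H →L[ℂ] H} (hX : X ∈ T.vnV)
    (h : ∀ D : Hypercone τ, D.SpacelikeSep C → ∀ B ∈ T.algC D, B * X = X * B) : X ∈ T.vnC C := by
  refine (T.duality C X).1 ⟨hX, fun B hB => comm_of_mem_cstarGen ?_ ?_ hB⟩
  · intro A hA
    obtain ⟨D, hD, hA⟩ := mem_iUnion₂.1 hA
    exact mem_iUnion₂.2 ⟨D, hD, star_mem hA⟩
  · intro A hA
    obtain ⟨D, hD, hA⟩ := mem_iUnion₂.1 hA
    exact h D hD A hA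

theorem ext_algV {S : StarSubalgebra ℂ (H →L[ℂ] H)} (hS : IsClosed (S : Set (H →L[ℂ] H)))
    {X : Set Minkowski} (hX : X ⊆ cone) (φ : T.algV →⋆ₐ[ℂ] (H →L[ℂ] H))
    (ψ : S →⋆ₐ[ℂ] (H →L[ℂ] H))
    (h : ∀ O : DoubleCone, O.region ⊆ X → ∀ A : T.algV, (A : H →L[ℂ] H) ∈ T.alg O →
      ∃ hA : (A : H →L[ℂ] H) ∈ S, φ A = ψ ⟨A, hA⟩) (A : T.algV)
    (hA : (A : H →L[ℂ] H) ∈ regionAlg T.alg X) :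
    ∃ hA : (A : H →L[ℂ] H) ∈ S, φ A = ψ ⟨A, hA⟩ := by
  obtain ⟨_, h2, h3⟩ := eqOn_cstarGen isClosed_algV hS φ ψ (fun x hx => by
    obtain ⟨O, hO, hx⟩ := mem_iUnion₂.1 hx
    have hxV : x ∈ T.algV := mem_regionAlg (hO.trans hX) hx
    obtain ⟨h4, h5⟩ := h O hO ⟨x, hxV⟩ hx
    exact ⟨hxV, h4, h5⟩) hA
  exact ⟨h2, h3⟩

/-! ### Localized morphisms and intertwiners -/

theorem LocMorphism.hom_of_sep (σ : T.LocMorphism) {D : Hypercone τ} (h : D.SpacelikeSep σ.loc)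
    {A : T.algV} (hA : (A : H →L[ℂ] H) ∈ T.algC D) : σ.hom A = A :=
  σ.hom_eq A (algC_le_algCc h hA)

theorem LocMorphism.hom_mem_vnC (σ : T.LocMorphism) {C : Hypercone τ}
    (h : σ.loc.region ⊆ C.region) {A : T.algV} (hA : (A : H →L[ℂ] H) ∈ T.algC C) :
    σ.hom A ∈ T.vnC C := by
  rw [← σ.weakClosure_image C h]
  exact mem_weakClosure (StarSubalgebra.mem_map.2 ⟨A, (StarSubalgebra.mem_comap _ _ _).2 hA, rfl⟩)

/-- A property of operators that holds on `σ(𝔄(C))` and passes to weak closures holds on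
`ℜ(C)`. -/
theorem LocMorphism.mem_of_vnC (σ : T.LocMorphism) {C : Hypercone τ}
    (h : σ.loc.region ⊆ C.region) {S : StarSubalgebra ℂ (H →L[ℂ] H)} {V : H →L[ℂ] H}
    (hV : V ∈ unitary (H →L[ℂ] H))
    (hS : ∀ A : T.algV, (A : H →L[ℂ] H) ∈ T.algC C → V * σ.hom A * star V ∈ weakClosure S)
    {X : H →L[ℂ] H} (hX : X ∈ T.vnC C) : V * X * star V ∈ weakClosure S := by
  rw [← σ.weakClosure_image C h] at hX
  refine conj_mem_weakClosure hV (fun B hB => ?_) hX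
  obtain ⟨A, hA, rfl⟩ := StarSubalgebra.mem_map.1 hB
  exact hS A ((StarSubalgebra.mem_comap _ _ _).1 hA)

/-- This weak density of `σ(𝔄(C))` in `ℜ(C)` is what replaces surjectivity of the morphism. -/
theorem LocMorphism.commute_of_vnC (σ : T.LocMorphism) {C : Hypercone τ}
    (h : σ.loc.region ⊆ C.region) {Y : H →L[ℂ] H}
    (hY : ∀ A : T.algV, (A : H →L[ℂ] H) ∈ T.algC C → σ.hom A * Y = Y * σ.hom A)
    {X : H →L[ℂ] H} (hX : X ∈ T.vnC C) : X * Y = Y * X := by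
  rw [← σ.weakClosure_image C h] at hX
  refine commute_of_mem_weakClosure hX fun B hB => ?_
  obtain ⟨A, hA, rfl⟩ := StarSubalgebra.mem_map.1 hB
  exact hY A ((StarSubalgebra.mem_comap _ _ _).1 hA)

namespace IsIntertwiner

variable {σ ρ κ : T.LocMorphism} {V W : H →L[ℂ] H}

theorem comm (h : IsIntertwiner σ ρ W) (A : T.algV) : W * σ.hom A = ρ.hom A * W :=
  (conj_eq_iff h.2.1).1 (h.2.2 A)

theorem star_conj (h : IsIntertwiner σ ρ W) (A : T.algV) : star W * ρ.hom A * W = σ.hom A :=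
  (star_conj_eq_iff h.2.1).2 (h.comm A)

protected theorem symm (h : IsIntertwiner σ ρ W) : IsIntertwiner ρ σ (star W) :=
  ⟨star_mem h.1, Unitary.star_mem h.2.1, fun A => by rw [star_star]; exact h.star_conj A⟩

protected theorem trans (h : IsIntertwiner σ ρ V) (h' : IsIntertwiner ρ κ W) :
    IsIntertwiner σ κ (W * V) :=
  ⟨mul_mem h'.1 h.1, mul_mem h'.2.1 h.2.1, fun A => by
    rw [← h'.2.2 A, ← h.2.2 A, star_mul]
    simp only [mul_assoc]⟩

/-- An intertwiner commutes with the operators that are localized in the spacelike complement of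
the localization hypercones. -/
theorem commute (h : IsIntertwiner σ ρ W) {f : Hypercone τ} (h1 : f.SpacelikeSep σ.loc)
    (h2 : f.SpacelikeSep ρ.loc) {X : H →L[ℂ] H} (hX : X ∈ T.vnC f) : W * X = X * W := by
  refine (commute_of_mem_weakClosure hX fun A hA => ?_).symm
  have := h.comm ⟨A, algC_le_algV f hA⟩
  rw [σ.hom_of_sep h1 hA, ρ.hom_of_sep h2 hA] at this
  exact this.symm

/-- Both morphisms are trivial on hypercones spacelike to `e`, so `W` commutes with their algebras;
duality then localizes `W`. -/
theorem mem_vnC (hτ : 0 < τ) (h : IsIntertwiner σ ρ W) {e : Hypercone τ}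
    (h1 : σ.loc.region ⊆ e.region) (h2 : ρ.loc.region ⊆ e.region) : W ∈ T.vnC e :=
  mem_vnC_of_commute h.1 fun _ hD _ hB =>
    (h.commute (sep_mono hτ hD Subset.rfl h1) (sep_mono hτ hD Subset.rfl h2)
      (mem_weakClosure hB)).symm

theorem mem_vnCc (h : IsIntertwiner σ ρ W) {f : Hypercone τ} (h1 : f.SpacelikeSep σ.loc)
    (h2 : f.SpacelikeSep ρ.loc) : W ∈ T.vnCc f :=
  (T.duality_compl f W).1 ⟨h.1, fun _ hB => (h.commute h1 h2 (mem_weakClosure hB)).symm⟩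

/-- If `ρ` is localized in the spacelike complement of `e` then `σ` acts on `𝔄(e)` by
conjugation. -/
theorem hom_eq_of_sep (h : IsIntertwiner σ ρ V) {e : Hypercone τ} (he : e.SpacelikeSep ρ.loc)
    {A : T.algV} (hA : (A : H →L[ℂ] H) ∈ T.algC e) : σ.hom A = star V * A * V := by
  rw [← h.star_conj A, ρ.hom_of_sep he hA]

theorem conj_mem_vnC (h : IsIntertwiner σ ρ V) {e : Hypercone τ} (hσ : σ.loc.region ⊆ e.region)
    (he : e.SpacelikeSep ρ.loc) {X : H →L[ℂ] H} (hX : X ∈ T.vnC e) :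
    V * X * star V ∈ T.vnC e := by
  refine σ.mem_of_vnC hσ h.2.1 (fun A hA => ?_) hX
  rw [h.2.2 A, ρ.hom_of_sep he hA]
  exact mem_weakClosure hA

theorem star_conj_mem_vnC (h : IsIntertwiner σ ρ V) {e : Hypercone τ}
    (hσ : σ.loc.region ⊆ e.region) (he : e.SpacelikeSep ρ.loc) {X : H →L[ℂ] H}
    (hX : X ∈ T.vnC e) : star V * X * V ∈ T.vnC e := by
  have := conj_mem_weakClosure (Unitary.star_mem h.2.1) (S := T.algC e) (T := T.algC e)
    (fun A hA => ?_) hX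
  · rwa [star_star] at this
  · rw [star_star, ← h.hom_eq_of_sep he (A := ⟨A, algC_le_algV e hA⟩) hA]
    exact σ.hom_mem_vnC hσ hA

/-- The conjugation of `ℜ(e)` by an intertwiner to a morphism that is localized in the spacelike
complement of `e` does not depend on that morphism. -/
theorem conj_eq (hV : IsIntertwiner σ ρ V) (hW : IsIntertwiner σ κ W) {e : Hypercone τ}
    (hσ : σ.loc.region ⊆ e.region) (hρ : e.SpacelikeSep ρ.loc) (hκ : e.SpacelikeSep κ.loc)
    {X : H →L[ℂ] H} (hX : X ∈ T.vnC e) : V * X * star V = W * X * star W := by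
  -- The two conjugations differ by the intertwiner from `ρ` to `κ`, which commutes with the
  -- transported operator because that operator is again in `ℜ(e)`.
  have h1 := (hV.symm.trans hW).commute hρ hκ (hV.conj_mem_vnC hσ hρ hX)
  rw [← conj_eq_iff (mul_mem hW.2.1 (Unitary.star_mem hV.2.1))] at h1
  rw [← h1]
  simp only [star_mul, star_star, mul_assoc, star_mul_cancel hV.2.1]

end IsIntertwiner

end ObservableNet

end LightCone

namespace LightCone

open Set Filter Topology

namespace ObservableNet

variable {τ : ℝ} {H : Type u} [NormedAddCommGroup H] [InnerProductSpace ℂ H] [CompleteSpace H]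
  {T : ObservableNet τ H}

/-! ### Statistics -/

/-- The group commutator of `W` and `V`, which is the exchange intertwiner of `σ_a` and `σ_b` when
`W` intertwines from `σ_b` to `σ_a` and `V` from `σ_a` to a morphism localized far away. -/
noncomputable def exchange (W V : H →L[ℂ] H) : H →L[ℂ] H := star W * star V * W * V

section Moves

variable {σ σ' ρ ρ' κ κ' : T.LocMorphism} {U V W : H →L[ℂ] H}

/-- The transporter `U` is in `ℜ(e)`, where conjugation by `V` and by `W⁻¹` agree because both carry
`σ'` out of `e`; this makes all occurrences of `U` cancel. -/
theorem exchange_move_first (hW : IsIntertwiner ρ σ' W) (hV : IsIntertwiner σ' κ V)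
    (hU : IsIntertwiner σ σ' U) (hτ : 0 < τ) {e : Hypercone τ} (hσ : σ.loc.region ⊆ e.region)
    (hσ' : σ'.loc.region ⊆ e.region) (hρ : e.SpacelikeSep ρ.loc) (hκ : e.SpacelikeSep κ.loc) :
    exchange (star U * W) (V * U) = exchange W V := by
  have h1 := hU.mem_vnC hτ hσ hσ'
  have h2 : V * U * star V = star W * U * W := by
    have := hV.conj_eq hW.symm hσ' hκ hρ h1
    rwa [star_star] at this
  have h3 : V * U = star W * U * W * V := (conj_eq_iff hV.2.1).1 h2
  have h4 : star U * star V = star V * star W * star U * W := by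
    have := congrArg star h3
    simpa only [star_mul, star_star, mul_assoc] using this
  calc exchange (star U * W) (V * U)
      = star W * U * (star U * star V) * star U * W * (V * U) := by
        simp only [exchange, star_mul, star_star, mul_assoc]
    _ = star W * star V * star U * W * (star W * U * W * V) := by
        rw [← h3]; simp only [mul_assoc, mul_star_cancel hU.2.1]
    _ = exchange W V := by
        simp only [exchange, mul_assoc, mul_star_cancel hW.2.1, star_mul_cancel hU.2.1]

/-- `U` commutes with `V` and is only pulled outside, so the operator is conjugated. This is
harmless once it is known to be a scalar. -/
theorem exchange_move_second (hV : IsIntertwiner σ κ V) (W : H →L[ℂ] H)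
    (hU : IsIntertwiner ρ ρ' U) (hτ : 0 < τ) {e : Hypercone τ} (hρ : ρ.loc.region ⊆ e.region)
    (hρ' : ρ'.loc.region ⊆ e.region) (hσ : e.SpacelikeSep σ.loc) (hκ : e.SpacelikeSep κ.loc) :
    exchange (W * U) V = star U * exchange W V * U := by
  have h1 := hV.commute hσ hκ (hU.mem_vnC hτ hρ hρ')
  simp only [exchange, star_mul, mul_assoc]
  rw [h1]

theorem exchange_move_third (V : H →L[ℂ] H) (hW : IsIntertwiner ρ σ W)
    (hU : IsIntertwiner κ κ' U) (hτ : 0 < τ) {e : Hypercone τ} (hκ : κ.loc.region ⊆ e.region)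
    (hκ' : κ'.loc.region ⊆ e.region) (hσ : e.SpacelikeSep σ.loc) (hρ : e.SpacelikeSep ρ.loc) :
    exchange W (star U * V) = exchange W V := by
  have h1 := hW.commute hρ hσ (hU.mem_vnC hτ hκ hκ')
  calc exchange W (star U * V) = star W * star V * (U * W) * star U * V := by
        simp only [exchange, star_mul, star_star, mul_assoc]
    _ = exchange W V := by
        rw [← h1]
        simp only [exchange, mul_assoc, mul_star_cancel hU.2.1]

end Moves

variable (C : T.SimpleChargeClass)

/-- The operators `Wᴴ Vᴴ σ_a(A) V W` and `Vᴴ σ_b(A) V` agree on the algebra of a hypercone that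
contains `a` and `b` and is spacelike separated from `c`. -/
theorem conj_hom_eq (hτ : 0 < τ) {σa σb σc : T.LocMorphism} (ha : σa ∈ C.morphisms)
    (hb : σb ∈ C.morphisms) {W V : H →L[ℂ] H}
    (hW : IsIntertwiner σb σa W) (hV : IsIntertwiner σa σc V) {h : Hypercone τ}
    (hab : σa.loc.SpacelikeSep σb.loc) (hah : σa.loc.region ⊆ h.region)
    (hbh : σb.loc.region ⊆ h.region) (hch : h.SpacelikeSep σc.loc) {A : T.algV}
    (hA : (A : H →L[ℂ] H) ∈ T.algC h) :
    star V * σb.hom A * V = star (V * W) * σa.hom A * (V * W) := by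
  have hVW := hW.trans hV
  have hba := sep_symm hτ hab
  have hca : σa.loc.SpacelikeSep σc.loc := sep_mono hτ hch hah Subset.rfl
  have hcb : σb.loc.SpacelikeSep σc.loc := sep_mono hτ hch hbh Subset.rfl
  have key : ∀ O : DoubleCone, O.region ⊆ h.region → ∀ A : T.algV, (A : H →L[ℂ] H) ∈ T.alg O →
      star V * σb.hom A * V = star (V * W) * σa.hom A * (V * W) := by
    intro O hO A hA
    have hAh : (A : H →L[ℂ] H) ∈ T.algC h := mem_regionAlg hO hA
    -- On a single double cone a morphism is implemented by a unitary of its own localization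
    -- hypercone, obtained by transport to a place spacelike to `O`. The unitaries for `σa` and `σb`
    -- commute, which makes the two morphisms commute.
    have hsmall : ∀ σ ∈ C.morphisms, (∃ D : Hypercone τ, σ.loc.SpacelikeSep D) →
        ∃ X ∈ T.vnC σ.loc, σ.hom A = X * A * star X ∧ X ∈ unitary (H →L[ℂ] H) := by
      rintro σ hσ ⟨E, hE⟩
      obtain ⟨c, D, hc, -, hOD, hcD⟩ := exists_enclosing_sep hτ hE O
      obtain ⟨ρ, hρ, rfl⟩ := C.exists_loc c
      obtain ⟨X, hX⟩ := C.equivalent ρ hρ σ hσ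
      refine ⟨X, hX.mem_vnC hτ hc Subset.rfl, ?_, hX.2.1⟩
      rw [← hX.2.2 A, ρ.hom_of_sep (sep_symm hτ hcD) (mem_regionAlg hOD hA)]
    obtain ⟨X, hX, hXA, hXu⟩ := hsmall σa ha ⟨_, hab⟩
    obtain ⟨Y, hY, hYA, hYu⟩ := hsmall σb hb ⟨_, hba⟩
    have hXY : X * Y = Y * X := commute_of_sep hab hX hY
    have e1 : star V * Y = Y * star V := star_comm_of_comm hV.2.1 (hV.commute hba hcb hY)
    have e2 : star Y * V = V * star Y := by
      have := congrArg star e1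
      simpa only [star_mul, star_star] using this
    have e3 : star (V * W) * X = X * star (V * W) :=
      star_comm_of_comm hVW.2.1 (hVW.commute hab hca hX)
    have e4 : star X * (V * W) = V * W * star X := by
      have := congrArg star e3
      simpa only [star_mul, star_star, mul_assoc] using this
    have e5 : star X * star Y = star Y * star X := by
      rw [← star_mul, ← star_mul, hXY]
    calc star V * σb.hom A * V = Y * (star V * A * V) * star Y := by
          rw [hYA]
          simp only [← mul_assoc]
          rw [e1]
          simp only [mul_assoc]
          rw [e2]
      _ = Y * X * A * (star X * star Y) := by
          rw [← hV.hom_eq_of_sep hch hAh, hXA]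
          simp only [mul_assoc]
      _ = X * (Y * A * star Y) * star X := by
          rw [← hXY, e5]
          simp only [mul_assoc]
      _ = X * (star (V * W) * A * (V * W)) * star X := by
          rw [← hYA, hVW.hom_eq_of_sep hch hAh]
      _ = star (V * W) * (X * A * star X) * (V * W) := by
          generalize V * W = Q at e3 e4
          simp only [← mul_assoc]
          rw [← e3]
          simp only [mul_assoc]
          rw [e4]
      _ = _ := by rw [hXA]
  obtain ⟨_, h2⟩ := ext_algV isClosed_algV (region_subset_cone h)
    (conjHom σb.hom (star V) (Unitary.star_mem hV.2.1))
    (conjHom σa.hom (star (V * W)) (Unitary.star_mem hVW.2.1))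
    (fun O hO A hA => ⟨A.2, by simpa using key O hO A hA⟩) A hA
  simpa using h2

/-- By factoriality, an operator in `ℜ(V)` that commutes with all local observables is a multiple
of the identity. -/
theorem exists_eq_smul_one {E : H →L[ℂ] H} (hE : E ∈ T.vnV)
    (h : ∀ O : DoubleCone, ∀ A ∈ T.alg O, A * E = E * A) :
    ∃ z : ℂ, E = z • (1 : H →L[ℂ] H) := by
  refine T.factor E hE ?_
  rw [VonNeumannAlgebra.mem_commutant_iff]
  intro X hX
  refine commute_of_mem_weakClosure hX fun A hA => comm_of_mem_cstarGen ?_ ?_ hA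
  · intro A hA
    obtain ⟨O, hO, hA⟩ := mem_iUnion₂.1 hA
    exact mem_iUnion₂.2 ⟨O, hO, star_mem hA⟩
  · intro A hA
    obtain ⟨O, hO, hA⟩ := mem_iUnion₂.1 hA
    exact h O A hA

/-- Morally the exchange operator intertwines `σa σb` with `σb σa`, which coincide by `conj_hom_eq`.
It therefore commutes with their range, and weak density of that range in enclosing hypercone
algebras gives commutation with all observables. -/
theorem exists_exchange_eq_smul_one (hτ : 0 < τ) {σa σb σc : T.LocMorphism}
    (ha : σa ∈ C.morphisms) (hb : σb ∈ C.morphisms) (hc : σc ∈ C.morphisms) {W V : H →L[ℂ] H}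
    (hW : IsIntertwiner σb σa W) (hV : IsIntertwiner σa σc V) {D : Hypercone τ}
    (hab : σa.loc.SpacelikeSep σb.loc) (hD : σc.loc.SpacelikeSep D)
    (haD : σa.loc.region ⊆ D.region) (hbD : σb.loc.region ⊆ D.region) :
    ∃ z : ℂ, exchange W V = z • (1 : H →L[ℂ] H) := by
  refine exists_eq_smul_one (mul_mem (mul_mem (mul_mem (star_mem hW.1) (star_mem hV.1)) hW.1)
    hV.1) fun O B hB => ?_
  obtain ⟨c', h, hc', hDh, hOh, hch⟩ := exists_enclosing_sep hτ hD O
  obtain ⟨σc', hσc', rfl⟩ := C.exists_loc c'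
  -- The third localization is shrunk to leave room for a hypercone `h` containing `D` and the given
  -- double cone; this does not affect the exchange operator.
  obtain ⟨U, hU⟩ := C.equivalent σc' hσc' σc hc
  have hDc := sep_symm hτ hD
  rw [← exchange_move_third V hW hU hτ hc' Subset.rfl (sep_mono hτ hD Subset.rfl haD)
    (sep_mono hτ hD Subset.rfl hbD)]
  set V' := star U * V
  have hV' : IsIntertwiner σa σc' V' := hV.trans hU.symm
  clear_value V'
  have hhc := sep_symm hτ hch
  have hVW := hW.trans hV'
  have hah := haD.trans hDh
  have hbh := hbD.trans hDh
  set E := exchange W V' with hE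
  have hcomm : ∀ A : T.algV, (A : H →L[ℂ] H) ∈ T.algC h →
      star V' * σb.hom A * V' * E = E * (star V' * σb.hom A * V') := by
    intro A hA
    have e1 := conj_hom_eq C hτ ha hb hW hV' hab hah hbh hhc hA
    have e2 : E = star (V' * W) * W * V' := by rw [hE, exchange, star_mul]
    calc star V' * σb.hom A * V' * E
        = star (V' * W) * σa.hom A * (V' * W) * (star (V' * W) * W * V') := by rw [e1, e2]
      _ = star (V' * W) * (σa.hom A * W) * V' := by
          simp only [mul_assoc, star_mul, mul_star_cancel hV'.2.1, mul_star_cancel hW.2.1]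
      _ = E * (star V' * σb.hom A * V') := by
          rw [← hW.comm, e2]
          simp only [mul_assoc, mul_star_cancel hV'.2.1]
  -- Density of `σb(𝔄(h))` in `ℜ(h)` extends the commutation. It is then applied to `V' B V'*`,
  -- which lies in `ℜ(h)`.
  have hY : ∀ X ∈ T.vnC h, X * (V' * E * star V') = V' * E * star V' * X := by
    refine fun X hX => σb.commute_of_vnC hbh (fun A hA => ?_) hX
    have := congrArg (fun Z => V' * Z * star V') (hcomm A hA)
    simpa only [mul_assoc, mul_star_cancel hV'.2.1, Unitary.mul_star_self_of_mem hV'.2.1, mul_one]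
      using this
  have h1 := hY _ (hV'.conj_mem_vnC hah hhc (mem_weakClosure (mem_regionAlg hOh hB)))
  have h2 := congrArg (fun Z => star V' * Z * V') h1
  simpa only [mul_assoc, star_mul_cancel hV'.2.1, Unitary.star_mul_self_of_mem hV'.2.1, mul_one]
      using h2

/-- All exchange operators for morphisms localized in `a`, `b`, `c` have the value `z`. -/
def IsExchangeValue (z : ℂ) (a b c : Hypercone τ) : Prop :=
  ∀ σa ∈ C.morphisms, ∀ σb ∈ C.morphisms, ∀ σc ∈ C.morphisms, σa.loc = a → σb.loc = b →
    σc.loc = c → ∀ W V : H →L[ℂ] H, IsIntertwiner σb σa W → IsIntertwiner σa σc V →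
      exchange W V = z • (1 : H →L[ℂ] H)

variable {C} in
theorem IsExchangeValue.congr (hτ : 0 < τ) {z : ℂ} {a b c a' b' c' : Hypercone τ}
    (hab : a.SpacelikeSep b) (hac : a.SpacelikeSep c) (hbc : b.SpacelikeSep c)
    (hab' : a'.SpacelikeSep b') (hac' : a'.SpacelikeSep c') (hbc' : b'.SpacelikeSep c')
    (h : IsExchangeValue C z a b c) : IsExchangeValue C z a' b' c' := by
  refine triple_induction hτ (Q := IsExchangeValue C z) ?_ ?_ ?_ hab hac hbc hab' hac' hbc' h
  · rintro a a' b c e ha ha' hb hc h σ hσ ρ hρ κ hκ rfl rfl rfl W V hW hV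
    obtain ⟨σ', hσ', rfl⟩ := C.exists_loc a
    obtain ⟨U, hU⟩ := C.equivalent σ' hσ' σ hσ
    rw [← exchange_move_first hW hV hU hτ ha ha' hb hc]
    exact h σ' hσ' ρ hρ κ hκ rfl rfl rfl _ _ (hW.trans hU.symm) (hU.trans hV)
  · rintro a b b' c e hb hb' ha hc h σ hσ ρ hρ κ hκ rfl rfl rfl W V hW hV
    obtain ⟨ρ', hρ', rfl⟩ := C.exists_loc b
    obtain ⟨U, hU⟩ := C.equivalent ρ' hρ' ρ hρ
    have h1 := exchange_move_second hV W hU hτ hb hb' ha hc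
    rw [h σ hσ ρ' hρ' κ hκ rfl rfl rfl _ _ (hU.trans hW) hV] at h1
    exact eq_smul_one_of_star_conj hU.2.1 h1.symm
  · rintro a b c c' e hc hc' ha hb h σ hσ ρ hρ κ hκ rfl rfl rfl W V hW hV
    obtain ⟨κ', hκ', rfl⟩ := C.exists_loc c
    obtain ⟨U, hU⟩ := C.equivalent κ' hκ' κ hκ
    rw [← exchange_move_third V hW hU hτ hc hc' ha hb]
    exact h σ hσ ρ hρ κ' hκ' rfl rfl rfl _ _ hW (hV.trans hU.symm)

/-- The statistics parameter of a simple charge class. -/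
theorem exists_exchangeValue (hτ : 0 < τ) : ∃ ε : ℤˣ, ∀ a b c : Hypercone τ, a.SpacelikeSep b →
    a.SpacelikeSep c → b.SpacelikeSep c → IsExchangeValue C ((ε : ℤ) : ℂ) a b c := by
  obtain ⟨a, b, c, D, hab, hcD, haD, hbD⟩ := exists_triple hτ
  have hac := sep_symm hτ (sep_mono hτ hcD Subset.rfl haD)
  have hbc := sep_symm hτ (sep_mono hτ hcD Subset.rfl hbD)
  have hba := sep_symm hτ hab
  have hca := sep_symm hτ hac
  obtain ⟨σa, ha, rfl⟩ := C.exists_loc a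
  obtain ⟨σb, hb, rfl⟩ := C.exists_loc b
  obtain ⟨σc, hc, rfl⟩ := C.exists_loc c
  have hone : (1 : H →L[ℂ] H) ≠ 0 := by
    intro h
    have h1 := congrArg (fun X => X T.Ω) h
    have h2 : T.Ω = 0 := h1
    have := T.norm_Ω
    rw [h2, norm_zero] at this
    exact zero_ne_one this
  have hinj : ∀ z w : ℂ, z • (1 : H →L[ℂ] H) = w • 1 → z = w :=
    fun z w h => smul_left_injective ℂ hone h
  obtain ⟨W, hW⟩ := C.equivalent σb hb σa ha
  obtain ⟨V, hV⟩ := C.equivalent σa ha σc hc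
  obtain ⟨z, hz⟩ := exists_exchange_eq_smul_one C hτ ha hb hc hW hV hab hcD haD hbD
  -- Other morphisms and intertwiners for the same three hypercones are reached by moves that do not
  -- change the hypercones.
  have hval : IsExchangeValue C z σa.loc σb.loc σc.loc := by
    intro σa' ha' σb' hb' σc' hc' ea eb ec W' V' hW' hV'
    obtain ⟨U, hU⟩ := C.equivalent σa ha σa' ha'
    have hW1 := hW'.trans hU.symm
    have hV1 := hU.trans hV'
    have hUb := hW.trans hW1.symm
    have hUc := hV.symm.trans hV1
    have e1 := exchange_move_first hW' hV' hU hτ Subset.rfl (congrArg Hypercone.region ea).le (by rwa [eb]) (by rwa [ec])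
    have e2 := exchange_move_third (V' * U) hW1 hUc hτ Subset.rfl (congrArg Hypercone.region ec).le hca
      (by rw [eb]; exact sep_symm hτ hbc)
    have e3 := exchange_move_second hV (star U * W') hUb hτ Subset.rfl (congrArg Hypercone.region eb).le hba hbc
    rw [star_mul, star_star, mul_assoc V, Unitary.star_mul_self_of_mem hV1.2.1, mul_one] at e2
    rw [mul_star_cancel hW1.2.1, hz] at e3
    rw [← e1, ← e2]
    exact eq_smul_one_of_star_conj hUb.2.1 e3.symm
  -- The roles of `a` and `b` can be interchanged by moving the hypercones around each other, so the
  -- swapped configuration has the same value.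
  have hval' := hval.congr hτ hab hac hbc hba hbc hac
  have hstar : star (exchange W V) * exchange W V = 1 :=
    Unitary.star_mul_self_of_mem (mul_mem (mul_mem (mul_mem (Unitary.star_mem hW.2.1)
      (Unitary.star_mem hV.2.1)) hW.2.1) hV.2.1)
  have e1 := hval' σb hb σa ha σc hc rfl rfl rfl _ _ hW.symm (hW.trans hV)
  -- The adjoint is the exchange operator of the swapped pair; hence `z` is real, and unitarity
  -- gives `z² = 1`.
  have e2 : star (exchange W V) = exchange (star W) (V * W) := by
    simp only [exchange, star_mul, star_star, mul_assoc, mul_star_cancel hW.2.1]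
  have hzz : star z = z := hinj _ _ (by
    rw [← e1, ← e2, hz, star_smul, star_one])
  have hz2 : z * z = 1 := hinj _ _ (by
    rw [e2, e1, hz, smul_mul_smul_comm, one_mul] at hstar
    rw [hstar, one_smul])
  have hz1 : z = 1 ∨ z = -1 := mul_self_eq_one_iff.1 hz2
  rcases hz1 with rfl | rfl
  · exact ⟨1, fun _ _ _ h1 h2 h3 => by simpa using hval.congr hτ hab hac hbc h1 h2 h3⟩
  · exact ⟨-1, fun _ _ _ h1 h2 h3 => by simpa using hval.congr hτ hab hac hbc h1 h2 h3⟩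

end ObservableNet

end LightCone

/-! ### Normal extensions and the exchange intertwiner -/

namespace LightCone

open Set Filter Topology

section

variable {H : Type u} [NormedAddCommGroup H] [InnerProductSpace ℂ H] [CompleteSpace H]

theorem inner_star_conj (V A : H →L[ℂ] H) (x y : H) :
    ⟪x, (star V * A * V) y⟫_ℂ = ⟪V x, A (V y)⟫_ℂ := by
  have h : (star V * A * V) y = ContinuousLinearMap.adjoint V (A (V y)) := rfl
  rw [h, ContinuousLinearMap.adjoint_inner_right]

/-- An ultraweakly continuous functional that is a given matrix element on a star algebra is that
matrix element on its weak closure. -/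
theorem hasSum_inner_of_mem_weakClosure {S : StarSubalgebra ℂ (H →L[ℂ] H)} {u v : ℕ → H}
    (hu : Summable fun k => ‖u k‖ ^ 2) (hv : Summable fun k => ‖v k‖ ^ 2) {x y : H}
    (h : ∀ A ∈ S, HasSum (fun k => ⟪u k, A (v k)⟫_ℂ) ⟪x, A y⟫_ℂ) {X : H →L[ℂ] H}
    (hX : X ∈ weakClosure S) : HasSum (fun k => ⟪u k, X (v k)⟫_ℂ) ⟪x, X y⟫_ℂ := by
  -- Prepending `-x` and `y` to the two sequences turns the difference of the functionals into a
  -- single ultraweakly continuous one that vanishes on `S`.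
  have hseq : ∀ (a : H) (w : ℕ → H), (Summable fun k => ‖w k‖ ^ 2) →
      ∃ w' : lp (fun _ : ℕ => H) 2, w' 0 = a ∧ ∀ k, w' (k + 1) = w k := by
    intro a w hw
    refine ⟨⟨fun k => Nat.casesOn k a w, memℓp_gen ?_⟩, rfl, fun k => rfl⟩
    simp only [ENNReal.toReal_ofNat, Real.rpow_ofNat]
    exact (summable_nat_add_iff (f := fun k => ‖(Nat.casesOn k a w : H)‖ ^ 2) 1).1 hw
  obtain ⟨u', hu0, hus⟩ := hseq (-x) u hu
  obtain ⟨v', hv0, hvs⟩ := hseq y v hv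
  have hkey : ∀ A : H →L[ℂ] H,
      HasSum (fun k => ⟪u k, A (v k)⟫_ℂ) (⟪u', amplify ℕ A v'⟫_ℂ + ⟪x, A y⟫_ℂ) := by
    intro A
    have h0 : HasSum (fun k => ⟪u' k, A (v' k)⟫_ℂ) ⟪u', amplify ℕ A v'⟫_ℂ :=
      lp.hasSum_inner (𝕜 := ℂ) u' (amplify ℕ A v')
    have h1 := (hasSum_nat_add_iff' (f := fun k => ⟪u' k, A (v' k)⟫_ℂ) 1).2 h0
    simpa only [Finset.sum_range_one, hu0, hv0, hus, hvs, inner_neg_left,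
      sub_neg_eq_add] using h1
  have h0 := inner_amplify_eq_zero ℕ u' v' (fun A hA => by
    have := (hkey A).unique (h A hA)
    simpa using this) hX
  have := hkey X
  rwa [h0, zero_add] at this

end

namespace ObservableNet

variable {τ : ℝ} {H : Type u} [NormedAddCommGroup H] [InnerProductSpace ℂ H] [CompleteSpace H]
  {T : ObservableNet τ H}

/-! ### Extensions -/

theorem mem_funnelAlg {c : ℕ → Hypercone τ} {n : ℕ} {B : H →L[ℂ] H} (hB : B ∈ T.vnCc (c n)) :
    B ∈ T.funnelAlg c :=
  subset_cstarGen _ (mem_iUnion.2 ⟨n, hB⟩)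

theorem isClosed_funnelAlg (c : ℕ → Hypercone τ) :
    IsClosed (T.funnelAlg c : Set (H →L[ℂ] H)) := isClosed_cstarGen _

/-- An extension acts on `ℜ(c_n^c)` by conjugation with an intertwiner to a morphism localized
in `c_n`. -/
theorem Extension.hom_eq_conj {σ ρ : T.LocMorphism} {c : ℕ → Hypercone τ} (s : Extension σ c)
    {V : H →L[ℂ] H} (hV : IsIntertwiner σ ρ V) {n : ℕ} (hρ : ρ.loc.region ⊆ (c n).region)
    {B : T.funnelAlg c} (hB : (B : H →L[ℂ] H) ∈ T.vnCc (c n)) :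
    s.hom B = star V * B * V := by
  refine ContinuousLinearMap.ext fun y => ext_inner_left ℂ fun x => ?_
  obtain ⟨u, v, hu, hv, huv⟩ := s.normal n x y
  -- Normality reduces the claim to `𝔄(c_n^c)`, where the extension is `σ` and `ρ` is trivial.
  have h1 := hasSum_inner_of_mem_weakClosure hu hv (x := V x) (y := V y) (fun A hA => ?_) hB
  · rw [inner_star_conj]
    exact (huv B hB).unique h1
  · have hA' : A ∈ T.vnCc (c n) := mem_weakClosure hA
    have h2 := huv ⟨A, mem_funnelAlg hA'⟩ hA'
    have h3 := s.hom_eq ⟨A, algCc_le_algV _ hA⟩ (mem_funnelAlg hA')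
    rw [h3, ← hV.star_conj, ρ.hom_eq _ (algCc_anti hρ hA), inner_star_conj] at h2
    exact h2

theorem IsFunnel.region_anti {c : ℕ → Hypercone τ} (hc : IsFunnel c) :
    Antitone fun n => (c n).region :=
  antitone_nat_of_succ_le hc.1

/-- Morphisms of a simple charge class have extensions based on funnels whose members separate
from hypercones enclosing arbitrary double cones. -/
theorem exists_extension (hτ : 0 < τ) (C : T.SimpleChargeClass) {σ : T.LocMorphism}
    (hσ : σ ∈ C.morphisms) {c : ℕ → Hypercone τ} (hc : IsFunnel c)
    (h : ∀ O : DoubleCone, ∃ n, ∃ D : Hypercone τ, O.region ⊆ D.region ∧ (c n).SpacelikeSep D) :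
    Nonempty (Extension σ c) := by
  choose ρ hρ hρc using fun n => C.exists_loc (c n)
  choose V hV using fun n => C.equivalent σ hσ (ρ n) (hρ n)
  have hVs : ∀ n, star (V n) ∈ unitary (H →L[ℂ] H) := fun n => Unitary.star_mem (hV n).2.1
  -- For `m ≥ n` the intertwiner `V m * star (V n)` lies in `ℜ(c_n)` and commutes with `ℜ(c_n^c)`,
  -- so the conjugations stabilize and define the extension as a norm limit.
  have hconst : ∀ n, ∀ B ∈ T.vnCc (c n), ∀ m ≥ n,
      star (V m) * B * star (star (V m)) = star (V n) * B * star (star (V n)) := by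
    intro n B hB m hmn
    have hX := (hV n).symm.trans (hV m)
    have hXc : V m * star (V n) ∈ T.vnC (c n) := hX.mem_vnC hτ (by rw [hρc])
      (by rw [hρc]; exact IsFunnel.region_anti hc hmn)
    have hcomm : V m * star (V n) * B = B * (V m * star (V n)) :=
      commute_of_mem_weakClosure hXc ((T.duality_compl (c n) B).2 hB).2
    have h1 := (star_conj_eq_iff hX.2.1).2 hcomm
    rw [star_star, star_star]
    conv_rhs => rw [← h1]
    simp only [star_mul, star_star, mul_assoc, star_mul_cancel (hV n).2.1,
      Unitary.star_mul_self_of_mem (hV n).2.1, mul_one]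
  obtain ⟨φ, hφ⟩ : ∃ φ : T.funnelAlg c →⋆ₐ[ℂ] (H →L[ℂ] H), ∀ B : T.funnelAlg c,
      Tendsto (fun n => star (V n) * (B : H →L[ℂ] H) * star (star (V n))) atTop (𝓝 (φ B)) :=
    exists_limit_hom (fun n => star (V n)) hVs
    (⋃ n, (T.vnCc (c n) : Set (H →L[ℂ] H))) (fun B hB => by
      obtain ⟨n, hn⟩ := mem_iUnion.1 hB
      exact ⟨n, hconst n B hn⟩)
  have hφn : ∀ n, ∀ B : T.funnelAlg c, (B : H →L[ℂ] H) ∈ T.vnCc (c n) →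
      φ B = star (V n) * B * V n := by
    intro n B hB
    refine tendsto_nhds_unique (hφ B) (tendsto_const_nhds.congr' ?_)
    filter_upwards [eventually_ge_atTop n] with m hm
    rw [hconst n B hB m hm, star_star]
  have hle : T.funnelAlg c ≤ (T.vnV).toStarSubalgebra :=
    cstarGen_le (isClosed_weakClosure _) (iUnion_subset fun n B hB => vnCc_le_vnV hB)
  refine ⟨{ hom := φ, hom_mem := fun B => ?_, hom_eq := fun A hA => ?_, normal := ?_ }⟩
  · refine (isClosed_weakClosure T.algV).mem_of_tendsto (hφ B) (Eventually.of_forall fun n => ?_)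
    exact mul_mem (mul_mem (star_mem (hV n).1) (hle B.2)) (star_mem (star_mem (hV n).1))
  · obtain ⟨_, h1⟩ := ext_algV (isClosed_funnelAlg c) Subset.rfl σ.hom φ (fun O _ A hA => by
      obtain ⟨n, D, hOD, hD⟩ := h O
      have hAD : (A : H →L[ℂ] H) ∈ T.algC D := mem_regionAlg hOD hA
      have hAc : (A : H →L[ℂ] H) ∈ T.vnCc (c n) :=
        mem_weakClosure (algC_le_algCc (sep_symm hτ hD) hAD)
      refine ⟨mem_funnelAlg hAc, ?_⟩
      rw [hφn n _ hAc]
      exact (hV n).hom_eq_of_sep (by rw [hρc]; exact sep_symm hτ hD) hAD) A A.2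
    exact h1.symm
  · intro n x y
    refine ⟨fun k => if k = 0 then V n x else 0, fun k => if k = 0 then V n y else 0, ?_, ?_,
      fun B hB => ?_⟩
    · exact summable_of_ne_finset_zero (s := {0}) fun k hk => by simp at hk; simp [hk]
    · exact summable_of_ne_finset_zero (s := {0}) fun k hk => by simp at hk; simp [hk]
    · have h1 : ⟪x, φ B y⟫_ℂ = ⟪V n x, (B : H →L[ℂ] H) (V n y)⟫_ℂ := by
        rw [hφn n B hB, inner_star_conj]
      rw [h1]
      have h2 := hasSum_single (f := fun k : ℕ => ⟪(if k = 0 then V n x else 0 : H),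
        (B : H →L[ℂ] H) (if k = 0 then V n y else 0)⟫_ℂ) 0 (fun k hk => by simp [hk])
      simpa using h2

/-! ### The exchange intertwiner -/

variable {C : T.SimpleChargeClass}

/-- Whatever the choices, `W` lies in `ℜ(c_0^c)`, where the extension is a conjugation, so the
result is an exchange commutator with third hypercone `c 0`. A common spacelike hypercone and a
funnel inside it provide existence. -/
theorem isExchange_iff (hτ : 0 < τ) {z : ℂ} (hz : ∀ a b c : Hypercone τ, a.SpacelikeSep b →
    a.SpacelikeSep c → b.SpacelikeSep c → IsExchangeValue C z a b c) {σa σb : T.LocMorphism}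
    (ha : σa ∈ C.morphisms) (hb : σb ∈ C.morphisms) (hab : σa.loc.SpacelikeSep σb.loc)
    (E : H →L[ℂ] H) : IsExchange σa σb E ↔ E = z • (1 : H →L[ℂ] H) := by
  have key : ∀ {C₀ : Hypercone τ} {c : ℕ → Hypercone τ} (s : Extension σa c) {W : H →L[ℂ] H}
      (hWc : W ∈ T.funnelAlg c), C₀.SpacelikeSep σa.loc → C₀.SpacelikeSep σb.loc →
      (∀ n, (c n).region ⊆ C₀.region) → IsIntertwiner σb σa W →
      star W * s.hom ⟨W, hWc⟩ = z • (1 : H →L[ℂ] H) := by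
    intro C₀ c s W hWc h1 h2 hc hW
    obtain ⟨ρ, hρ, hρc⟩ := C.exists_loc (c 0)
    obtain ⟨V, hV⟩ := C.equivalent σa ha ρ hρ
    have ha0 := sep_mono hτ h1 (hc 0) Subset.rfl
    have hb0 := sep_mono hτ h2 (hc 0) Subset.rfl
    rw [s.hom_eq_conj hV (n := 0) (by rw [hρc]) (hW.mem_vnCc hb0 ha0), ← mul_assoc, ← mul_assoc]
    exact hz σa.loc σb.loc ρ.loc hab (by rw [hρc]; exact sep_symm hτ ha0)
      (by rw [hρc]; exact sep_symm hτ hb0) σa ha σb hb ρ hρ rfl rfl rfl W V hW hV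
  constructor
  · rintro ⟨C₀, c, s, W, hWc, h1, h2, -, hc, hW, rfl⟩
    exact key s hWc h1 h2 hc hW
  · rintro rfl
    obtain ⟨C₀, h1, h2⟩ := exists_common_sep hτ hab
    obtain ⟨c, hcf, hc, hO⟩ := exists_funnel_enclosing hτ h1
    obtain ⟨s⟩ := exists_extension hτ C ha hcf fun O =>
      let ⟨n, D, _, h3, h4⟩ := hO O
      ⟨n, D, h3, h4⟩
    obtain ⟨W, hW⟩ := C.equivalent σb hb σa ha
    have hWc : W ∈ T.funnelAlg c := mem_funnelAlg (n := 0)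
      (hW.mem_vnCc (sep_mono hτ h2 (hc 0) Subset.rfl) (sep_mono hτ h1 (hc 0) Subset.rfl))
    exact ⟨C₀, c, s, W, hWc, h1, h2, hcf, hc, hW, (key s hWc h1 h2 hc hW).symm⟩

end ObservableNet

end LightCone

namespace LightCone

open Set Filter Topology

variable {τ : ℝ}

/-- Three pairwise spacelike separated hypercones in a common hypercone. -/
theorem exists_triple_within (hτ : 0 < τ) : ∃ a b c D : Hypercone τ, a.SpacelikeSep b ∧
    a.SpacelikeSep c ∧ b.SpacelikeSep c ∧ a.region ⊆ D.region ∧ b.region ⊆ D.region ∧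
    c.region ⊆ D.region := by
  obtain ⟨D, hD, -⟩ := exists_hypercone_halfball hτ norm_basis (s := 1 / 2) (t := 3 / 4)
    (by norm_num) (by norm_num) (by norm_num)
  have h1 : ‖(!₂[(1 : ℝ), 0, 0] : Space)‖ = 1 := by
    simp [EuclideanSpace.norm_eq, Fin.sum_univ_three]
  have h2 : ‖(!₂[(-1 : ℝ), 0, 0] : Space)‖ = 1 := by
    simp [EuclideanSpace.norm_eq, Fin.sum_univ_three]
  have h3 : ‖(!₂[(0 : ℝ), 1, 0] : Space)‖ = 1 := by
    simp [EuclideanSpace.norm_eq, Fin.sum_univ_three]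
  -- In the unit ball `2 (9/10)² > 1` keeps caps around orthogonal axes disjoint, and `1 - (9/10)² <
  -- (1/2)²` puts each cap below height `1 / 2`.
  obtain ⟨a, ha⟩ := exists_hypercone_in_cap hτ h1 (s := 9 / 10) (by norm_num)
  obtain ⟨b, hb⟩ := exists_hypercone_in_cap hτ h2 (s := 9 / 10) (by norm_num)
  obtain ⟨c, hc⟩ := exists_hypercone_in_cap hτ h3 (s := 9 / 10) (by norm_num)
  have hn : ∀ v : Space, ‖v‖ < 1 → v 0 ^ 2 + v 1 ^ 2 + v 2 ^ 2 < 1 := by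
    intro v hv
    have := EuclideanSpace.norm_sq_eq v
    simp only [Fin.sum_univ_three, Real.norm_eq_abs, sq_abs] at this
    rw [← this]
    nlinarith [norm_nonneg v]
  have h : ∀ v ∈ base a, ‖v‖ < 1 ∧ 9 / 10 < v 0 := fun v hv => by
    have := ha hv
    refine ⟨this.1, ?_⟩
    simpa [PiLp.inner_apply, Fin.sum_univ_three] using this.2
  have h' : ∀ v ∈ base b, ‖v‖ < 1 ∧ 9 / 10 < -v 0 := fun v hv => by
    have := hb hv
    refine ⟨this.1, ?_⟩
    simpa [PiLp.inner_apply, Fin.sum_univ_three] using this.2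
  have h'' : ∀ v ∈ base c, ‖v‖ < 1 ∧ 9 / 10 < v 1 := fun v hv => by
    have := hc hv
    refine ⟨this.1, ?_⟩
    simpa [PiLp.inner_apply, Fin.sum_univ_three] using this.2
  have hsub : ∀ v : Space, ‖v‖ < 1 → v 2 < 1 / 2 → v ∈ base D := fun v hv hv2 => by
    refine hD v hv ?_
    simpa [PiLp.inner_apply, Fin.sum_univ_three] using hv2
  refine ⟨a, b, c, D, ?_, ?_, ?_, ?_, ?_, ?_⟩
  · refine (sep_iff hτ).2 (Set.disjoint_left.2 fun v hv hv' => ?_)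
    linarith [(h v hv).2, (h' v hv').2]
  · refine (sep_iff hτ).2 (Set.disjoint_left.2 fun v hv hv' => ?_)
    nlinarith [h v hv, h'' v hv', hn v (h v hv).1]
  · refine (sep_iff hτ).2 (Set.disjoint_left.2 fun v hv hv' => ?_)
    nlinarith [h' v hv, h'' v hv', hn v (h' v hv).1]
  · refine (region_subset_iff hτ).2 fun v hv => hsub v (h v hv).1 ?_
    nlinarith [h v hv, hn v (h v hv).1]
  · refine (region_subset_iff hτ).2 fun v hv => hsub v (h' v hv).1 ?_
    nlinarith [h' v hv, hn v (h' v hv).1]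
  · refine (region_subset_iff hτ).2 fun v hv => hsub v (h'' v hv).1 ?_
    nlinarith [h'' v hv, hn v (h'' v hv).1]

namespace ObservableNet

variable {H : Type u} [NormedAddCommGroup H] [InnerProductSpace ℂ H] [CompleteSpace H]
  {T : ObservableNet τ H}

/-! ### Conjugate morphisms -/

/-- `φ` is the conjugate of the morphism `σ`: it is localized in the same hypercone, and on the
algebra of each larger hypercone `h` it is the conjugation with any intertwiner from `σ` to
a morphism of the class that is localized in the spacelike complement of `h`. -/
def IsConjugateMorphism (C : T.SimpleChargeClass) (σ φ : T.LocMorphism) : Prop :=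
  φ.loc = σ.loc ∧ ∀ h : Hypercone τ, σ.loc.region ⊆ h.region → ∀ ρ ∈ C.morphisms,
    ρ.loc.SpacelikeSep h → ∀ V, IsIntertwiner σ ρ V → ∀ A : T.algV,
      (A : H →L[ℂ] H) ∈ T.algC h → φ.hom A = V * A * star V

variable (C : T.SimpleChargeClass)

/-- This is the well-definedness of the conjugate: carrying the charge away in two different
directions has the same effect on `𝔄(O)`, since the directions outside the cone of `σ` are connected
through short moves covered by `IsIntertwiner.conj_eq`. -/
theorem conj_eq_of_sep (hτ : 0 < τ) {σ ρ ρ' : T.LocMorphism}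
    (hσ : σ ∈ C.morphisms) {O : DoubleCone} {D D' : Hypercone τ}
    (hD : σ.loc.region ⊆ D.region) (hD' : σ.loc.region ⊆ D'.region) (hOD : O.region ⊆ D.region)
    (hOD' : O.region ⊆ D'.region) (h : ρ.loc.SpacelikeSep D) (h' : ρ'.loc.SpacelikeSep D')
    {V V' : H →L[ℂ] H} (hV : IsIntertwiner σ ρ V) (hV' : IsIntertwiner σ ρ' V')
    {A : H →L[ℂ] H} (hA : A ∈ T.alg O) : V * A * star V = V' * A * star V' := by
  obtain ⟨b, b', hb, hb', hR⟩ := exists_rel_of_sep hτ σ.loc O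
    (fun c c' => ∀ ρ ∈ C.morphisms, ∀ ρ' ∈ C.morphisms, ρ.loc = c → ρ'.loc = c' →
      ∀ V V', IsIntertwiner σ ρ V → IsIntertwiner σ ρ' V' → V * A * star V = V' * A * star V')
    (fun c c' h ρ hρ ρ' hρ' e e' V V' hV hV' => (h ρ' hρ' ρ hρ e' e V' V hV' hV).symm)
    (fun c c' c'' h h' ρ hρ ρ' hρ' e e' V V' hV hV' => by
      obtain ⟨κ, hκ, hκc⟩ := C.exists_loc c'
      obtain ⟨U, hU⟩ := C.equivalent σ hσ κ hκ
      exact (h ρ hρ κ hκ e hκc V U hV hU).trans (h' κ hκ ρ' hρ' hκc e' U V' hU hV'))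
    (fun c c' e E hc hc' heE hσE hOE ρ hρ ρ' hρ' h1 h2 V V' hV hV' => by
      subst h1 h2
      exact hV.conj_eq hV' hσE (sep_symm hτ (sep_mono hτ heE hc Subset.rfl))
        (sep_symm hτ (sep_mono hτ heE hc' Subset.rfl)) (mem_weakClosure (mem_regionAlg hOE hA)))
    (sep_mono hτ h Subset.rfl hD) (sep_mono hτ h' Subset.rfl hD')
  obtain ⟨κ, hκ, rfl⟩ := C.exists_loc b
  obtain ⟨κ', hκ', rfl⟩ := C.exists_loc b'
  obtain ⟨U, hU⟩ := C.equivalent σ hσ κ hκ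
  obtain ⟨U', hU'⟩ := C.equivalent σ hσ κ' hκ'
  calc V * A * star V = U * A * star U :=
        hV.conj_eq hU hD (sep_symm hτ h) (sep_symm hτ (sep_mono hτ h hb Subset.rfl))
          (mem_weakClosure (mem_regionAlg hOD hA))
    _ = U' * A * star U' := hR κ hκ κ' hκ' rfl rfl U U' hU hU'
    _ = V' * A * star V' :=
        hU'.conj_eq hV' hD' (sep_symm hτ (sep_mono hτ h' hb' Subset.rfl)) (sep_symm hτ h')
          (mem_weakClosure (mem_regionAlg hOD' hA))

/-- Locally `σ` is conjugation by the inverse of an intertwiner `V n`; its inverse is the limit of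
the conjugations by `V n` along a funnel. -/
theorem exists_isConjugateMorphism (hτ : 0 < τ) {σ : T.LocMorphism} (hσ : σ ∈ C.morphisms) :
    ∃ φ : T.LocMorphism, IsConjugateMorphism C σ φ := by
  obtain ⟨E, hE⟩ := exists_sep hτ σ.loc
  obtain ⟨c, hc, -, hcO⟩ := exists_funnel_enclosing hτ hE
  choose ρ hρ hρc using fun n => C.exists_loc (c n)
  choose V hV using fun n => C.equivalent σ hσ (ρ n) (hρ n)
  have hVu : ∀ n, V n ∈ unitary (H →L[ℂ] H) := fun n => (hV n).2.1
  have hconst : ∀ O : DoubleCone, ∃ n, ∃ D : Hypercone τ, σ.loc.region ⊆ D.region ∧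
      O.region ⊆ D.region ∧ (c n).SpacelikeSep D ∧ ∀ A ∈ T.alg O, ∀ m ≥ n,
        V m * A * star (V m) = V n * A * star (V n) := by
    intro O
    obtain ⟨n, D, h1, h2, h3⟩ := hcO O
    refine ⟨n, D, h1, h2, h3, fun A hA m hm => ?_⟩
    have h4 := sep_mono hτ h3 (IsFunnel.region_anti hc hm) Subset.rfl
    exact (hV m).conj_eq (hV n) h1 (by rw [hρc]; exact sep_symm hτ h4)
      (by rw [hρc]; exact sep_symm hτ h3) (mem_weakClosure (mem_regionAlg h2 hA))
  obtain ⟨φ, hφ⟩ : ∃ φ : T.algV →⋆ₐ[ℂ] (H →L[ℂ] H), ∀ A : T.algV,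
      Tendsto (fun n => V n * (A : H →L[ℂ] H) * star (V n)) atTop (𝓝 (φ A)) :=
    exists_limit_hom V hVu _ fun A hA => by
      obtain ⟨O, -, hA⟩ := mem_iUnion₂.1 hA
      obtain ⟨n, D, -, -, -, h⟩ := hconst O
      exact ⟨n, h A hA⟩
  have hφV : ∀ A : T.algV, φ A ∈ T.vnV := fun A =>
    (isClosed_weakClosure T.algV).mem_of_tendsto (hφ A) (Eventually.of_forall fun n =>
      mul_mem (mul_mem (hV n).1 (mem_weakClosure A.2)) (star_mem (hV n).1))
  have hlocal : ∀ (O : DoubleCone) (h : Hypercone τ), O.region ⊆ h.region →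
      σ.loc.region ⊆ h.region → ∀ ρ ∈ C.morphisms, ρ.loc.SpacelikeSep h →
      ∀ U, IsIntertwiner σ ρ U → ∀ A : T.algV, (A : H →L[ℂ] H) ∈ T.alg O →
        φ A = U * A * star U := by
    intro O h hOh hσh κ hκ hκh U hU A hA
    obtain ⟨n, D, h1, h2, h3, h4⟩ := hconst O
    have h5 : φ A = V n * A * star (V n) := by
      refine tendsto_nhds_unique (hφ A) (tendsto_const_nhds.congr' ?_)
      filter_upwards [eventually_ge_atTop n] with m hm
      exact (h4 A hA m hm).symm
    rw [h5]
    exact conj_eq_of_sep C hτ hσ h1 hσh h2 hOh (by rw [hρc]; exact h3) hκh (hV n) hU hA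
  have hstar : ∀ h : Hypercone τ, σ.loc.region ⊆ h.region → ∀ ρ ∈ C.morphisms,
      ρ.loc.SpacelikeSep h → ∀ V, IsIntertwiner σ ρ V → ∀ A : T.algV,
      (A : H →L[ℂ] H) ∈ T.algC h → φ A = V * A * star V := by
    intro h hσh κ hκ hκh U hU A hA
    obtain ⟨_, h1⟩ := ext_algV isClosed_algV (region_subset_cone h) φ
      (conjHom T.algV.subtype U hU.2.1)
      (fun O hO A hA => ⟨A.2, hlocal O h hO hσh κ hκ hκh U hU A hA⟩) A hA
    exact h1
  refine ⟨{ loc := σ.loc, hom := φ, hom_mem := hφV, hom_eq := ?_, weakClosure_image := ?_ },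
    rfl, hstar⟩
  · intro A hA
    have key : ∀ D : Hypercone τ, D.SpacelikeSep σ.loc → ∀ A : T.algV,
        (A : H →L[ℂ] H) ∈ T.algC D → φ A = A := by
      intro D hD A hA
      -- To see triviality on `𝔄(D)`, the charge is carried into a hypercone spacelike to both `σ`
      -- and `D`; the intertwiner then commutes with `𝔄(D)`.
      obtain ⟨K, hK1, hK2⟩ := exists_common_sep hτ (sep_symm hτ hD)
      obtain ⟨_, h1⟩ := ext_algV isClosed_algV (region_subset_cone D) φ T.algV.subtype
        (fun O hO A hA => by
          obtain ⟨e, h, heK, hσh, hOh, heh⟩ := exists_enclosing_sep hτ hK1 O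
          obtain ⟨κ, hκ, rfl⟩ := C.exists_loc e
          obtain ⟨U, hU⟩ := C.equivalent σ hσ κ hκ
          refine ⟨A.2, ?_⟩
          rw [hlocal O h hOh hσh κ hκ heh U hU A hA]
          exact (conj_eq_iff hU.2.1).2 (hU.commute hD
            (sep_symm hτ (sep_mono hτ hK2 heK Subset.rfl))
            (mem_weakClosure (mem_regionAlg hO hA)))) A hA
      exact h1
    obtain ⟨_, _, h1⟩ := eqOn_cstarGen isClosed_algV isClosed_algV φ T.algV.subtype
      (fun x hx => by
        obtain ⟨D, hD, hx⟩ := mem_iUnion₂.1 hx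
        have hxV := algC_le_algV D hx
        exact ⟨hxV, hxV, key D hD ⟨x, hxV⟩ hx⟩) hA
    exact h1
  · intro h hσh
    obtain ⟨e, he⟩ := exists_sep hτ h
    obtain ⟨κ, hκ, rfl⟩ := C.exists_loc e
    obtain ⟨U, hU⟩ := C.equivalent σ hσ κ hκ
    have hs := hstar h hσh κ hκ he U hU
    have heh := sep_symm hτ he
    refine SetLike.ext fun X => ⟨fun hX => ?_, fun hX => ?_⟩
    · refine weakClosure_subset (fun B hB => ?_) hX
      obtain ⟨A, hA, rfl⟩ := StarSubalgebra.mem_map.1 hB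
      have hA' := (StarSubalgebra.mem_comap _ _ _).1 hA
      rw [hs A hA']
      exact hU.conj_mem_vnC hσh heh (mem_weakClosure hA')
    · have h1 := conj_mem_weakClosure hU.2.1
        (T := ((T.algC h).comap T.algV.subtype).map φ) (fun A hA => ?_)
        (hU.star_conj_mem_vnC hσh heh hX)
      · simpa only [mul_assoc, Unitary.mul_star_self_of_mem hU.2.1, mul_one,
          mul_star_cancel hU.2.1] using h1
      · rw [← hs ⟨A, algC_le_algV h hA⟩ hA]
        exact mem_weakClosure (StarSubalgebra.mem_map.2
          ⟨⟨A, algC_le_algV h hA⟩, (StarSubalgebra.mem_comap _ _ _).2 hA, rfl⟩)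

variable {C} in
/-- The conjugates of two morphisms of a class that are localized in a common hypercone are
intertwined by the operator that transports one morphism to the other far away. -/
theorem IsConjugateMorphism.isIntertwiner (hτ : 0 < τ) {σ σ' φ φ' ρ : T.LocMorphism}
    (hφ : IsConjugateMorphism C σ φ) (hφ' : IsConjugateMorphism C σ' φ') {h : Hypercone τ}
    (hσ : σ.loc.region ⊆ h.region) (hσ' : σ'.loc.region ⊆ h.region) (hρ : ρ ∈ C.morphisms)
    (hρh : ρ.loc.SpacelikeSep h) {V V' : H →L[ℂ] H} (hV : IsIntertwiner σ ρ V)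
    (hV' : IsIntertwiner σ' ρ V') : IsIntertwiner φ φ' (V' * star V) := by
  have hUu : V' * star V ∈ unitary (H →L[ℂ] H) := mul_mem hV'.2.1 (Unitary.star_mem hV.2.1)
  -- The operator is the transport by `V` of an intertwiner from `σ'` to `σ`, which already lies in
  -- `ℜ(h)`.
  have hU : V' * star V ∈ T.vnC h := by
    have h1 := (hV.trans hV'.symm).mem_vnC hτ hσ hσ'
    have h2 := hV.conj_mem_vnC hσ (sep_symm hτ hρh) (star_mem h1)
    rw [star_mul, star_star] at h2
    rwa [mul_assoc, mul_assoc, mul_star_cancel hV.2.1] at h2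
  refine ⟨vnC_le_vnV hU, hUu, fun A => ?_⟩
  obtain ⟨_, h1⟩ := ext_algV isClosed_algV Subset.rfl (conjHom φ.hom _ hUu) φ'.hom
    (fun O _ A hA => by
      obtain ⟨e, D, heρ, hhD, hOD, heD⟩ := exists_enclosing_sep hτ hρh O
      obtain ⟨κ, hκ, rfl⟩ := C.exists_loc e
      obtain ⟨X, hX⟩ := C.equivalent ρ hρ κ hκ
      have hAD : (A : H →L[ℂ] H) ∈ T.algC D := mem_regionAlg hOD hA
      -- Moving the reference morphism further away, to make room for `O`, multiplies both
      -- intertwiners by `X`, which is spacelike to `h`.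
      have hcomm : V' * star V * X = X * (V' * star V) :=
        (commute_of_sep hρh (hX.mem_vnC hτ Subset.rfl heρ) hU).symm
      have h2 : V' * star V * (X * V) = X * V' := by
        rw [← mul_assoc, hcomm]
        simp only [mul_assoc, Unitary.star_mul_self_of_mem hV.2.1, mul_one]
      refine ⟨A.2, ?_⟩
      rw [conjHom_apply, hφ.2 D (hσ.trans hhD) κ hκ heD _ (hV.trans hX) A hAD,
        hφ'.2 D (hσ'.trans hhD) κ hκ heD _ (hV'.trans hX) A hAD, ← h2]
      simp only [star_mul, mul_assoc]) A A.2
  exact h1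

variable {C} in
theorem IsConjugateMorphism.equivalent_of_subset (hτ : 0 < τ) {σ σ' φ φ' : T.LocMorphism}
    (hσC : σ ∈ C.morphisms) (hσC' : σ' ∈ C.morphisms)
    (hφ : IsConjugateMorphism C σ φ) (hφ' : IsConjugateMorphism C σ' φ') {h : Hypercone τ}
    (hσ : σ.loc.region ⊆ h.region) (hσ' : σ'.loc.region ⊆ h.region) : Equivalent φ φ' := by
  obtain ⟨e, he⟩ := exists_sep hτ h
  obtain ⟨ρ, hρ, rfl⟩ := C.exists_loc e
  obtain ⟨V, hV⟩ := C.equivalent σ hσC ρ hρ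
  obtain ⟨V', hV'⟩ := C.equivalent σ' hσC' ρ hρ
  exact ⟨_, hφ.isIntertwiner hτ hφ' hσ hσ' hρ he hV hV'⟩

protected theorem Equivalent.symm {σ ρ : T.LocMorphism} (h : Equivalent σ ρ) : Equivalent ρ σ :=
  let ⟨_, hW⟩ := h
  ⟨_, hW.symm⟩

protected theorem Equivalent.trans {σ ρ κ : T.LocMorphism} (h : Equivalent σ ρ)
    (h' : Equivalent ρ κ) : Equivalent σ κ :=
  let ⟨_, hW⟩ := h
  let ⟨_, hW'⟩ := h'
  ⟨_, hW.trans hW'⟩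

variable {C} in
-- Two hypercones need not fit into a common one, so the comparison passes through smaller
-- hypercones that do.
theorem IsConjugateMorphism.equivalent (hτ : 0 < τ) {σ σ' φ φ' : T.LocMorphism}
    (hσC : σ ∈ C.morphisms) (hσC' : σ' ∈ C.morphisms)
    (hφ : IsConjugateMorphism C σ φ) (hφ' : IsConjugateMorphism C σ' φ') : Equivalent φ φ' := by
  obtain ⟨b, b', D, hb, hb', hbD, hbD'⟩ := exists_common_enclosing hτ σ.loc σ'.loc
  obtain ⟨ρ, hρ, rfl⟩ := C.exists_loc b
  obtain ⟨ρ', hρ', rfl⟩ := C.exists_loc b'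
  obtain ⟨ψ, hψ⟩ := exists_isConjugateMorphism C hτ hρ
  obtain ⟨ψ', hψ'⟩ := exists_isConjugateMorphism C hτ hρ'
  exact ((hφ.equivalent_of_subset hτ hσC hρ hψ Subset.rfl hb).trans
    (hψ.equivalent_of_subset hτ hρ hρ' hψ' hbD hbD')).trans
    (hψ'.equivalent_of_subset hτ hρ' hσC' hφ' hb' Subset.rfl)

end ObservableNet

end LightCone

namespace LightCone

open Set Filter Topology

namespace ObservableNet

variable {τ : ℝ} {H : Type u} [NormedAddCommGroup H] [InnerProductSpace ℂ H] [CompleteSpace H]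
  {T : ObservableNet τ H}

/-! ### The conjugate class -/

/-- Every double cone lies in a hypercone enclosing that of `σ`, where the image is weakly dense.
Thus the GNS representation of `ω₀ ∘ σ` is `σ` itself and inherits cyclicity and factoriality. -/
theorem LocMorphism.weakClosure_range (hτ : 0 < τ) (σ : T.LocMorphism) :
    weakClosure σ.hom.range = T.vnV := by
  refine SetLike.ext fun X => ⟨fun hX => ?_, fun hX => ?_⟩
  · refine weakClosure_subset ?_ hX
    rintro _ ⟨A, rfl⟩
    exact σ.hom_mem A
  · have hle : T.algV ≤ (weakClosure σ.hom.range).toStarSubalgebra := by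
      refine regionAlg_le (isClosed_weakClosure _) fun O _ A hA => ?_
      obtain ⟨E, hE⟩ := exists_sep hτ σ.loc
      obtain ⟨-, h, -, hσh, hOh, -⟩ := exists_enclosing_sep hτ hE O
      have h1 : A ∈ T.vnC h := mem_weakClosure (mem_regionAlg hOh hA)
      rw [← σ.weakClosure_image h hσh] at h1
      refine weakClosure_subset (fun B hB => ?_) h1
      obtain ⟨A, -, rfl⟩ := StarSubalgebra.mem_map.1 hB
      exact mem_weakClosure ⟨A, rfl⟩
    exact weakClosure_subset hle hX

theorem dense_of_cyclic {x : H} {S : StarSubalgebra ℂ (H →L[ℂ] H)}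
    (h : Dense {y : H | ∃ X ∈ weakClosure S, X x = y}) : Dense {y : H | ∃ X ∈ S, X x = y} := by
  let M : Submodule ℂ H :=
    { carrier := {y | ∃ X ∈ S, X x = y}
      zero_mem' := ⟨0, zero_mem S, by simp⟩
      add_mem' := by
        rintro _ _ ⟨A, hA, rfl⟩ ⟨B, hB, rfl⟩
        exact ⟨A + B, add_mem hA hB, rfl⟩
      smul_mem' := by
        rintro c _ ⟨A, hA, rfl⟩
        exact ⟨c • A, S.smul_mem hA c, rfl⟩ }
  suffices hM : M.topologicalClosure = ⊤ from Submodule.dense_iff_topologicalClosure_eq_top.2 hM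
  rw [Submodule.topologicalClosure_eq_top_iff, Submodule.eq_bot_iff]
  intro z hz
  have h1 : ∀ X ∈ weakClosure S, ⟪z, X x⟫_ℂ = 0 := by
    intro X hX
    have h2 := inner_eq_zero_of_mem_weakClosure (x := z) (y := x) (x' := 0) (y' := 0)
      (fun A hA => by
        rw [inner_zero_left, add_zero]
        exact (Submodule.mem_orthogonal' _ _).1 hz _ ⟨A, hA, rfl⟩) hX
    simpa using h2
  have h2 : closure {y : H | ∃ X ∈ weakClosure S, X x = y} ⊆ {y | ⟪z, y⟫_ℂ = 0} := by
    refine closure_minimal ?_ (isClosed_eq (by fun_prop) continuous_const)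
    rintro _ ⟨X, hX, rfl⟩
    exact h1 X hX
  rw [h.closure_eq] at h2
  exact inner_self_eq_zero.1 (h2 (mem_univ z))

theorem LocMorphism.isState (σ : T.LocMorphism) : T.IsState σ.vacuumComp := by
  refine ⟨?_, fun A => ?_⟩
  · show ⟪T.Ω, σ.hom 1 T.Ω⟫_ℂ = 1
    rw [map_one]
    show ⟪T.Ω, T.Ω⟫_ℂ = 1
    rw [inner_self_eq_norm_sq_to_K, T.norm_Ω]
    simp
  · show 0 ≤ ⟪T.Ω, σ.hom (star A * A) T.Ω⟫_ℂ
    rw [map_mul, map_star, ContinuousLinearMap.star_eq_adjoint]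
    have : (ContinuousLinearMap.adjoint (σ.hom A) * σ.hom A) T.Ω =
        ContinuousLinearMap.adjoint (σ.hom A) (σ.hom A T.Ω) := rfl
    rw [this, ContinuousLinearMap.adjoint_inner_right]
    rw [inner_self_eq_norm_sq_to_K]
    exact (Complex.zero_le_real.2 (sq_nonneg ‖σ.hom A T.Ω‖)).trans_eq (Complex.ofReal_pow _ _)

theorem LocMorphism.isPrimary (hτ : 0 < τ) (σ : T.LocMorphism) : T.IsPrimary σ.vacuumComp := by
  refine ⟨H, inferInstance, inferInstance, inferInstance, σ.hom, T.Ω, ?_, fun A => rfl, ?_⟩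
  · have h1 : Dense {y : H | ∃ X ∈ weakClosure σ.hom.range, X T.Ω = y} := by
      rw [σ.weakClosure_range hτ]
      refine T.cyclic_Ω.mono ?_
      rintro _ ⟨A, hA, rfl⟩
      exact ⟨A, mem_weakClosure hA, rfl⟩
    refine (dense_of_cyclic h1).mono ?_
    rintro _ ⟨_, ⟨A, rfl⟩, rfl⟩
    exact ⟨A, rfl⟩
  · rw [σ.weakClosure_range hτ]
    exact T.factor

theorem inner_conj_apply (W A : H →L[ℂ] H) (x : H) :
    ⟪x, (W * A * star W) x⟫_ℂ = ⟪star W x, A (star W x)⟫_ℂ := by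
  have := inner_star_conj (star W) A x x
  rwa [star_star] at this

omit [CompleteSpace H] in
theorem norm_inner_apply_sub_le (B : H →L[ℂ] H) {x y : H} (hx : ‖x‖ = 1) (hy : ‖y‖ = 1) :
    ‖⟪x, B x⟫_ℂ - ⟪y, B y⟫_ℂ‖ ≤ 2 * ‖y - x‖ * ‖B‖ := by
  have h1 : ⟪x, B x⟫_ℂ - ⟪y, B y⟫_ℂ = ⟪x - y, B x⟫_ℂ + ⟪y, B (x - y)⟫_ℂ := by
    rw [inner_sub_left, map_sub, inner_sub_right]; ring
  have h2 : ‖⟪x - y, B x⟫_ℂ‖ ≤ ‖x - y‖ * (‖B‖ * ‖x‖) :=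
    (norm_inner_le_norm _ _).trans (mul_le_mul_of_nonneg_left (B.le_opNorm _) (norm_nonneg _))
  have h3 : ‖⟪y, B (x - y)⟫_ℂ‖ ≤ ‖y‖ * (‖B‖ * ‖x - y‖) :=
    (norm_inner_le_norm _ _).trans (mul_le_mul_of_nonneg_left (B.le_opNorm _) (norm_nonneg _))
  rw [hx] at h2
  rw [hy] at h3
  rw [h1, norm_sub_rev y x]
  linarith [norm_add_le ⟪x - y, B x⟫_ℂ ⟪y, B (x - y)⟫_ℂ]

/-- The intertwiner is only in the weak closure, but its adjoint's action on the vacuum vector is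
approximated by unitaries of `𝔄(V)`, and nearby vectors give norm-close states. -/
theorem vacuumComp_mem_chargeClass (hτ : 0 < τ) {σ ρ : T.LocMorphism} (h : Equivalent σ ρ) :
    ρ.vacuumComp ∈ T.chargeClass σ.vacuumComp := by
  obtain ⟨W, hW⟩ := h
  intro δ hδ
  let _ : IsClosed (T.algV : Set (H →L[ℂ] H)) := isClosed_algV
  obtain ⟨u, hu, hux⟩ := exists_unitary_approx σ.hom (W := star W)
    (by rw [σ.weakClosure_range hτ]; exact hW.symm.1) hW.symm.2.1 T.norm_Ω (half_pos hδ)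
  refine ⟨star u, Unitary.star_mem hu, fun A => ?_⟩
  have h1 : ρ.vacuumComp A = ⟪star W T.Ω, σ.hom A (star W T.Ω)⟫_ℂ := by
    show ⟪T.Ω, ρ.hom A T.Ω⟫_ℂ = _
    rw [← hW.2.2 A, inner_conj_apply]
  have h2 : σ.vacuumComp (star u * A * star (star u)) =
      ⟪σ.hom u T.Ω, σ.hom A (σ.hom u T.Ω)⟫_ℂ := by
    show ⟪T.Ω, σ.hom (star u * A * star (star u)) T.Ω⟫_ℂ = _
    rw [map_mul, map_mul, map_star, map_star, map_star, inner_conj_apply, star_star]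
  have hu' : σ.hom u ∈ unitary (H →L[ℂ] H) := Unitary.map_mem σ.hom hu
  rw [h1, h2]
  calc _ ≤ 2 * ‖σ.hom u T.Ω - star W T.Ω‖ * ‖σ.hom A‖ := norm_inner_apply_sub_le _
        (by rw [norm_apply_of_mem_unitary hW.symm.2.1, T.norm_Ω])
        (by rw [norm_apply_of_mem_unitary hu', T.norm_Ω])
    _ ≤ δ * ‖A‖ := mul_le_mul (by linarith) (norm_starAlgHom_le isClosed_algV _ _)
        (norm_nonneg _) hδ.le

/-! ### Compositions -/

theorem eq_top_of_alg_le {E : StarSubalgebra ℂ T.algV} (hE : IsClosed (E : Set T.algV))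
    (h : ∀ O : DoubleCone, ∀ A : T.algV, (A : H →L[ℂ] H) ∈ T.alg O → A ∈ E) (A : T.algV) :
    A ∈ E := by
  have hcl : IsClosed ((E.map T.algV.subtype : StarSubalgebra ℂ (H →L[ℂ] H)) :
      Set (H →L[ℂ] H)) := by
    rw [StarSubalgebra.coe_map]
    exact isClosed_algV.isClosedEmbedding_subtypeVal.isClosedMap _ hE
  have hle : T.algV ≤ E.map T.algV.subtype := regionAlg_le hcl fun O hO B hB =>
    StarSubalgebra.mem_map.2 ⟨⟨B, mem_regionAlg hO hB⟩, h O _ hB, rfl⟩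
  obtain ⟨B, hB, hBA⟩ := StarSubalgebra.mem_map.1 (hle A.2)
  rwa [show B = A from Subtype.ext hBA] at hB

/-- A composition is the identity as soon as it acts trivially on the local algebras. -/
theorem isComposition_id {σ ρ : T.LocMorphism} {c : ℕ → Hypercone τ} (s : Extension σ c)
    (hc : IsFunnel c) {m : ℕ} (hm : (c m).region ⊆ ρ.loc.compl)
    (h : ∀ O : DoubleCone, ∀ A : T.algV, (A : H →L[ℂ] H) ∈ T.alg O →
      ∃ hA : ρ.hom A ∈ T.funnelAlg c, s.hom ⟨ρ.hom A, hA⟩ = A) :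
    IsComposition σ ρ (fun A => (A : H →L[ℂ] H)) := by
  have hmem : ∀ A, ρ.hom A ∈ T.funnelAlg c := by
    refine eq_top_of_alg_le (E := (T.funnelAlg c).comap ρ.hom) ?_ fun O A hA => ?_
    · exact (isClosed_funnelAlg c).preimage (continuous_starAlgHom isClosed_algV ρ.hom)
    · exact (h O A hA).1
  refine ⟨c, s, hc, ⟨m, hm⟩, fun A => ⟨hmem A, ?_⟩⟩
  obtain ⟨_, h1⟩ := ext_algV isClosed_algV Subset.rfl T.algV.subtype
    (s.hom.comp (ρ.hom.codRestrict (T.funnelAlg c) hmem))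
    (fun O _ A hA => ⟨A.2, (h O A hA).2.symm⟩) A A.2
  exact h1

/-- The simple charge class conjugate to `C`. -/
theorem exists_conjugate_class (hτ : 0 < τ) (C : T.SimpleChargeClass) :
    ∃ D : T.SimpleChargeClass, ∀ σ ∈ C.morphisms, ∀ φ, IsConjugateMorphism C σ φ →
      φ ∈ D.morphisms := by
  obtain ⟨a, -⟩ := exists_hypercone hτ
  obtain ⟨σ₀, hσ₀, -⟩ := C.exists_loc a
  obtain ⟨φ₀, hφ₀⟩ := exists_isConjugateMorphism C hτ hσ₀
  refine ⟨{ states := T.chargeClass φ₀.vacuumComp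
            isChargeClass := ⟨_, φ₀.isState, φ₀.isPrimary hτ, rfl⟩
            morphisms := {ψ | Equivalent φ₀ ψ}
            exists_loc := fun c => ?_
            vacuumComp_mem := fun ψ hψ => vacuumComp_mem_chargeClass hτ hψ
            equivalent := fun ψ hψ ψ' hψ' => hψ.symm.trans hψ'
            mem_of_equivalent := fun ψ hψ ψ' hψ' => hψ.trans hψ' },
    fun σ hσ φ hφ => hφ₀.equivalent hτ hσ₀ hσ hφ⟩
  obtain ⟨σ, hσ, rfl⟩ := C.exists_loc c
  obtain ⟨φ, hφ⟩ := exists_isConjugateMorphism C hτ hσ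
  exact ⟨φ, hφ₀.equivalent hτ hσ₀ hσ hφ, hφ.1⟩

theorem exists_isConjugate (hτ : 0 < τ) (C : T.SimpleChargeClass) :
    ∃ D : T.SimpleChargeClass, IsConjugate C D := by
  obtain ⟨D, hD⟩ := exists_conjugate_class hτ C
  refine ⟨D, fun σ hσ => ?_⟩
  obtain ⟨φ, hφ⟩ := exists_isConjugateMorphism C hτ hσ
  have hφD := hD σ hσ φ hφ
  obtain ⟨E, hE⟩ := exists_sep hτ σ.loc
  obtain ⟨c, hc, hcE, hO⟩ := exists_funnel_enclosing hτ hE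
  have hO' : ∀ O : DoubleCone, ∃ n, ∃ D : Hypercone τ, O.region ⊆ D.region ∧
      (c n).SpacelikeSep D := fun O =>
    let ⟨n, D, _, h1, h2⟩ := hO O
    ⟨n, D, h1, h2⟩
  have hm : (c 0).region ⊆ σ.loc.compl := (hcE 0).trans hE
  refine ⟨φ, hφD, hφ.1, ?_, ?_⟩
  · obtain ⟨s⟩ := exists_extension hτ D hφD hc hO'
    refine isComposition_id s hc hm fun O A hA => ?_
    obtain ⟨n, F, hσF, hOF, hnF⟩ := hO O
    have hFn := sep_symm hτ hnF
    obtain ⟨ρ, hρ, hρc⟩ := C.exists_loc (c n)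
    obtain ⟨V, hV⟩ := C.equivalent σ hσ ρ hρ
    obtain ⟨ρ', hρ', hρc'⟩ := D.exists_loc (c n)
    obtain ⟨Z, hZ⟩ := D.equivalent φ hφD ρ' hρ'
    have hAF : (A : H →L[ℂ] H) ∈ T.algC F := mem_regionAlg hOF hA
    have hσA := σ.hom_mem_vnC hσF hAF
    have hmem := vnC_le_vnCc hFn hσA
    refine ⟨mem_funnelAlg hmem, ?_⟩
    rw [s.hom_eq_conj hZ (n := n) (by rw [hρc']) hmem]
    -- On `𝔄(F)` the conjugate acts both by `V` and by `Z⁻¹`, so `Z V` commutes with `𝔄(F)` and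
    -- hence with `σ(A)` in `ℜ(F)`; this yields the trivial composition.
    have hcomm : ∀ B ∈ T.algC F, B * (Z * V) = Z * V * B := by
      intro B hB
      have h1 := hφ.2 F hσF ρ hρ (by rwa [hρc]) V hV ⟨B, algC_le_algV F hB⟩ hB
      rw [hZ.hom_eq_of_sep (by rw [hρc']; exact hFn) (A := ⟨B, algC_le_algV F hB⟩) hB] at h1
      have h2 := (star_conj_eq_iff hZ.2.1).1 h1
      have h3 := congrArg (fun X => X * V) h2
      simpa only [mul_assoc, Unitary.star_mul_self_of_mem hV.2.1, mul_one] using h3.symm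
    have h1 := (star_conj_eq_iff (mul_mem hZ.2.1 hV.2.1)).2
      (commute_of_mem_weakClosure hσA hcomm).symm
    rw [hV.hom_eq_of_sep (by rw [hρc]; exact hFn) hAF, star_mul] at h1
    have h2 := congrArg (fun X => V * X * star V) h1
    simp only [mul_assoc, mul_star_cancel hV.2.1, Unitary.mul_star_self_of_mem hV.2.1, mul_one]
      at h2
    show star Z * σ.hom A * Z = A
    rw [hV.hom_eq_of_sep (by rw [hρc]; exact hFn) hAF]
    simpa only [mul_assoc] using h2
  · obtain ⟨s⟩ := exists_extension hτ C hσ hc hO'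
    refine isComposition_id s hc (m := 0) (by rw [hφ.1]; exact hm) fun O A hA => ?_
    obtain ⟨n, F, hσF, hOF, hnF⟩ := hO O
    have hFn := sep_symm hτ hnF
    obtain ⟨ρ, hρ, hρc⟩ := C.exists_loc (c n)
    obtain ⟨V, hV⟩ := C.equivalent σ hσ ρ hρ
    have hAF : (A : H →L[ℂ] H) ∈ T.algC F := mem_regionAlg hOF hA
    have hφA := φ.hom_mem_vnC (by rw [hφ.1]; exact hσF) hAF
    have hmem := vnC_le_vnCc hFn hφA
    refine ⟨mem_funnelAlg hmem, ?_⟩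
    rw [s.hom_eq_conj hV (n := n) (by rw [hρc]) hmem]
    show star V * φ.hom A * V = A
    rw [hφ.2 F hσF ρ hρ (by rwa [hρc]) V hV A hAF]
    simp only [mul_assoc, Unitary.star_mul_self_of_mem hV.2.1, mul_one, star_mul_cancel hV.2.1]

/-! ### Uniqueness of the conjugate and its statistics -/

/-- A morphism, regarded as localized in a larger hypercone. -/
def LocMorphism.enlarge (σ : T.LocMorphism) (C' : Hypercone τ) (h : σ.loc.region ⊆ C'.region) :
    T.LocMorphism where
  loc := C'
  hom := σ.hom
  hom_mem := σ.hom_mem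
  hom_eq A hA := σ.hom_eq A (algCc_anti h hA)
  weakClosure_image C₁ h₁ := σ.weakClosure_image C₁ (h.trans h₁)

theorem equivalent_of_hom_eq {σ ρ : T.LocMorphism} (h : σ.hom = ρ.hom) : Equivalent σ ρ :=
  ⟨1, one_mem _, one_mem _, fun A => by rw [h, star_one, one_mul, mul_one]⟩

/-- The conjugate morphisms belong to every conjugate class. -/
theorem IsConjugate.mem_morphisms (hτ : 0 < τ) {C D : T.SimpleChargeClass} (h : IsConjugate C D)
    {σ φ : T.LocMorphism} (hσ : σ ∈ C.morphisms) (hφ : IsConjugateMorphism C σ φ) :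
    φ ∈ D.morphisms := by
  -- The definition of a conjugate gives no control over the funnel it uses; regarding `σ` as
  -- localized in the larger `C'` ensures room for arbitrary double cones.
  obtain ⟨C', hC', hfun⟩ := exists_enlargement hτ σ.loc
  have hσ' : σ.enlarge C' hC' ∈ C.morphisms :=
    C.mem_of_equivalent σ hσ _ (equivalent_of_hom_eq rfl)
  obtain ⟨ψ, hψ, -, ⟨c, s, hc, ⟨m, hm⟩, hs⟩, -⟩ := h _ hσ'
  have hO := hfun c hc ⟨m, hm⟩
  refine D.mem_of_equivalent ψ hψ φ (equivalent_of_hom_eq (StarAlgHom.ext fun A => ?_))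
  obtain ⟨_, h1⟩ := ext_algV isClosed_algV Subset.rfl ψ.hom φ.hom (fun O _ A hA => by
    obtain ⟨n, F, hσF, hOF, hnF⟩ := hO O
    have hFn := sep_symm hτ hnF
    obtain ⟨ρ, hρ, hρc⟩ := C.exists_loc (c n)
    obtain ⟨V, hV⟩ := C.equivalent σ hσ ρ hρ
    obtain ⟨ρ', hρ', hρc'⟩ := D.exists_loc (c n)
    obtain ⟨Z, hZ⟩ := D.equivalent ψ hψ ρ' hρ'
    have hAF : (A : H →L[ℂ] H) ∈ T.algC F := mem_regionAlg hOF hA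
    refine ⟨A.2, ?_⟩
    rw [hφ.2 F hσF ρ hρ (by rwa [hρc]) V hV A hAF,
      hZ.hom_eq_of_sep (by rw [hρc']; exact hFn) hAF]
    -- The trivial composition says that `V Z` implements the identity on `𝔄(F)`, so it also
    -- commutes with the transported `V A V⁻¹` in `ℜ(F)`.
    have hcomm : ∀ B ∈ T.algC F, B * (V * Z) = V * Z * B := by
      intro B hB
      obtain ⟨h2, h3⟩ := hs ⟨B, algC_le_algV F hB⟩
      have h4 := σ.hom_mem_vnC hσF (A := ⟨B, algC_le_algV F hB⟩) hB
      have h5 := s.hom_eq_conj hZ (n := n) (by rw [hρc']) (B := ⟨_, h2⟩) (vnC_le_vnCc hFn h4)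
      have h6 : B = star Z * σ.hom ⟨B, algC_le_algV F hB⟩ * Z := h3.trans h5
      rw [hV.hom_eq_of_sep (by rw [hρc]; exact hFn) (A := ⟨B, algC_le_algV F hB⟩) hB] at h6
      have h7 := (star_conj_eq_iff (mul_mem hV.2.1 hZ.2.1) (A := B) (B := B)).1 (by
        rw [star_mul]
        simpa only [mul_assoc] using h6.symm)
      exact h7.symm
    have h8 := commute_of_mem_weakClosure (hV.conj_mem_vnC hσF (by rw [hρc]; exact hFn)
      (mem_weakClosure hAF)) hcomm
    have h9 := (star_conj_eq_iff (mul_mem hV.2.1 hZ.2.1)).2 h8.symm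
    rw [star_mul] at h9
    simpa only [mul_assoc, star_mul_cancel hV.2.1, Unitary.star_mul_self_of_mem hV.2.1, mul_one]
      using h9) A A.2
  exact h1

/-- With transporters `Ua`, `Ub`, `Uc` to a common `ρ`, the exchange operators of the two classes
are products of the same two unitaries in opposite orders. They are unitarily conjugate, so the
scalars are equal. -/
theorem exchange_value_eq_of_isConjugate (hτ : 0 < τ) {C D : T.SimpleChargeClass}
    (h : IsConjugate C D) {z w : ℂ}
    (hz : ∀ a b c : Hypercone τ, a.SpacelikeSep b → a.SpacelikeSep c → b.SpacelikeSep c →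
      IsExchangeValue C z a b c)
    (hw : ∀ a b c : Hypercone τ, a.SpacelikeSep b → a.SpacelikeSep c → b.SpacelikeSep c →
      IsExchangeValue D w a b c) : w = z := by
  obtain ⟨a, b, c, F, hab, hac, hbc, haF, hbF, hcF⟩ := exists_triple_within hτ
  obtain ⟨e, he⟩ := exists_sep hτ F
  obtain ⟨σa, ha, rfl⟩ := C.exists_loc a
  obtain ⟨σb, hb, rfl⟩ := C.exists_loc b
  obtain ⟨σc, hc, rfl⟩ := C.exists_loc c
  obtain ⟨ρ, hρ, rfl⟩ := C.exists_loc e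
  obtain ⟨φa, hφa⟩ := exists_isConjugateMorphism C hτ ha
  obtain ⟨φb, hφb⟩ := exists_isConjugateMorphism C hτ hb
  obtain ⟨φc, hφc⟩ := exists_isConjugateMorphism C hτ hc
  obtain ⟨Ua, hUa⟩ := C.equivalent σa ha ρ hρ
  obtain ⟨Ub, hUb⟩ := C.equivalent σb hb ρ hρ
  obtain ⟨Uc, hUc⟩ := C.equivalent σc hc ρ hρ
  have e1 := hz _ _ _ hab hac hbc σa ha σb hb σc hc rfl rfl rfl _ _ (hUb.trans hUa.symm)
    (hUa.trans hUc.symm)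
  have e2 := hw _ _ _ hab hac hbc φa (h.mem_morphisms hτ ha hφa) φb (h.mem_morphisms hτ hb hφb)
    φc (h.mem_morphisms hτ hc hφc) hφa.1 hφb.1 hφc.1 _ _
    (hφb.isIntertwiner hτ hφa hbF haF hρ he hUb hUa)
    (hφa.isIntertwiner hτ hφc haF hcF hρ he hUa hUc)
  have hg : star Ub * Uc * star Ua ∈ unitary (H →L[ℂ] H) :=
    mul_mem (mul_mem (Unitary.star_mem hUb.2.1) hUc.2.1) (Unitary.star_mem hUa.2.1)
  have h1 : exchange (star Ua * Ub) (star Uc * Ua) =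
      star Ub * Uc * star Ua * (Ub * star Uc * Ua) := by
    simp only [exchange, star_mul, star_star, mul_assoc, mul_star_cancel hUa.2.1]
  have h2 : exchange (Ua * star Ub) (Uc * star Ua) =
      Ub * star Uc * Ua * (star Ub * Uc * star Ua) := by
    simp only [exchange, star_mul, star_star, mul_assoc, star_mul_cancel hUa.2.1]
  rw [h1] at e1
  rw [h2] at e2
  have h3 : (Ub * star Uc * Ua) * (star Ub * Uc * star Ua) = z • (1 : H →L[ℂ] H) := by
    have h4 := congrArg (fun X => star (star Ub * Uc * star Ua) * X * (star Ub * Uc * star Ua)) e1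
    rw [star_mul_cancel hg] at h4
    rw [h4, mul_smul_comm, mul_one, smul_mul_assoc, Unitary.star_mul_self_of_mem hg]
  have h5 := congrArg (fun X => ⟪T.Ω, X T.Ω⟫_ℂ) (e2.symm.trans h3)
  simpa [inner_smul_right, inner_self_eq_norm_sq_to_K, T.norm_Ω] using h5

end ObservableNet

end LightCone

/-- In the equivalence for all `E`, one direction expresses independence of the choices of
hypercone, funnel, extension and intertwiner, the other the existence of an exchange intertwiner. -/
theorem mainTheorem7 {τ : ℝ} (hτ : 0 < τ) {H : Type u} [NormedAddCommGroup H]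
    [InnerProductSpace ℂ H] [CompleteSpace H] (T : LightCone.ObservableNet τ H) :
    (∀ C : T.SimpleChargeClass, ∃ D : T.SimpleChargeClass,
      LightCone.ObservableNet.IsConjugate C D) ∧
    ∃ ε : T.SimpleChargeClass → ℤˣ,
      (∀ (C : T.SimpleChargeClass), ∀ σa ∈ C.morphisms, ∀ σb ∈ C.morphisms,
        σa.loc.SpacelikeSep σb.loc →
        ∀ E : H →L[ℂ] H, LightCone.ObservableNet.IsExchange σa σb E ↔
          E = ((ε C : ℤ) : ℂ) • (1 : H →L[ℂ] H)) ∧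
      (∀ C D : T.SimpleChargeClass, LightCone.ObservableNet.IsConjugate C D → ε D = ε C) := by
  refine ⟨fun C => LightCone.ObservableNet.exists_isConjugate hτ C, ?_⟩
  choose ε hε using fun C : T.SimpleChargeClass =>
    LightCone.ObservableNet.exists_exchangeValue C hτ
  refine ⟨ε, fun C σa ha σb hb hab E =>
    LightCone.ObservableNet.isExchange_iff hτ (hε C) ha hb hab E, fun C D hCD => ?_⟩
  have h := LightCone.ObservableNet.exchange_value_eq_of_isConjugate hτ hCD (hε C) (hε D)
  exact Units.ext (Int.cast_injective h)
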